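/- **Setting.** Let $0<\beta<\sqrt\mu$ and let $f:\mathbb R\to[0,1]$ be measurable with $f(x)+f(-x)\le 1$ for all $x$. Let $A,B$ be qubits, with $\ket\pm=(\ket0\pm\ket1)/\sqrt2$, and let $C$ be an optical mode with Hilbert space $L^2(\mathbb R)$ (wave functions $\psi(x)=\braket{x|\psi}$). For $\omega=\omega_r+i\omega_i\in\mathbb C$ the coherent state $\ket\omega$ has wave function $$\braket{x|\omega}=(2/\pi)^{1/4}\exp[-(x-\omega_r)^2+2i\omega_i x-i\omega_r\omega_i].$$ The $n$-photon state has wave function $(2/\pi)^{1/4}(n!)^{-1/2}\mathrm{He}_n(2x)e^{-x^2}$, where $\mathrm{He}_n$ is the probabilists' Hermite polynomial, and $\Pi_{\rm ev}$, $\Pi_{\rm od}$ are the projections onto the closed spans of the even and odd photon-number states. All operator integrals below are weak, i.e. defined through matrix elements. **Phase-error operator.** Put $q=(1-e^{-2(\mu-\beta^2)})/2$, let $g_{m,V}$ be the normal density with mean $m$ and variance $V$, let $v_\pm(w)=\sqrt{g_{\beta,1/2}(w)}\ket0\pm\sqrt{g_{-\beta,1/2}(w)}\ket1$, and $$T(w)=\bra0_B\bigl[(1-q)\,v_+(w)v_+(w)^\dagger\otimes\ket+\!\bra+_B+q\,v_-(w)v_-(w)^\dagger\otimes\ket-\!\bra-_B\bigr]\ket1_B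 .$$ Let $u_+(w),u_-(w)$ be unit eigenvectors of $T(w)$ with positive and negative eigenvalue respectively, and $W(w)=u_+(w)u_+(w)^\dagger-u_-(w)u_-(w)^\dagger$. With $R=e^{-i\omega_i\beta Z_A}$ and $\text{C-}X_{BA}=\ket0\!\bra0_B\otimes I_A+\ket1\!\bra1_B\otimes X_A$, put $$K(\omega)=\sqrt{f(\omega_r)/\pi}\,(\ket0_B\bra\omega_C+\ket1_B\bra{-\omega}_C),\qquad V(\omega)=\bigl[\ket0\!\bra0_B\otimes R^\dagger+\ket1\!\bra1_B\otimes W(\omega_r)R^\dagger\bigr]\text{C-}X_{BA},$$ $$M^{\rm het}_{\rm ph}=\iint d\omega_r\,d\omega_i\,(I_A\otimes K(\omega))^\dagger V(\omega)^\dagger(I_A\otimes\ket-\!\bra-_B)V(\omega)(I_A\otimes K(\omega)).$$ For real $\kappa,\gamma$ let $$M^{\rm het}[\kappa,\gamma]=M^{\rm het}_{\rm ph}+\kappa\bigl(\ket0\!\bra0_A\otimes\ket\beta\!\bra\beta_C+\ket1\!\bra1_A\otimes\ket{-\beta}\!\bra{-\beta}_C\bigr)-\gamma\,\ket-\!\bra-_A\otimes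 I_C .$$ **Blocks.** Let $\theta(w)\in(-\pi/2,\pi/2)$ with $\tan\theta(w)=e^{-2(\mu-\beta^2)}\sinh(2\beta w)$. Write $w$ for $\omega_r$, let $\ket w$ be the coherent state with real amplitude $w$, and let $E_{x,y}(w)=\ket x\!\braket{x|w}\!\braket{w|y}\!\bra y$. Define $$M_{\rm oo}=\iint f(w)\,\Pi_{\rm od}\Bigl[E_{x,x}+\tfrac{\cos\theta(w)}2(E_{x,x-\beta}+E_{x-\beta,x})\Bigr]\Pi_{\rm od}\,dw\,dx,$$ $$M_{\rm ee}=\iint f(w)\,\Pi_{\rm ev}\Bigl[E_{x,x}-\tfrac{\cos\theta(w)}2(E_{x,x-\beta}+E_{x-\beta,x})\Bigr]\Pi_{\rm ev}\,dw\,dx,$$ and, for $s=\pm1$ ($s=1$ is $M_{(+,{\rm o})(-,{\rm e})}$ and $s=-1$ is $M_{(-,{\rm o})(+,{\rm e})}$), $$M^s_{\rm oe}=\iint f(w)\,\Pi_{\rm od}\Bigl[s\sin\theta(w)\,E_{x,x}-\tfrac{\cos\theta(w)}2(E_{x,x-\beta}-E_{x-\beta,x})\Bigr]\Pi_{\rm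 ev}\,dw\,dx,\qquad M^s_{\rm eo}=(M^s_{\rm oe})^\dagger .$$ **Parameters.** With the convention $0^{-1}=0$, put $C_{\rm o}=\bra\beta\Pi_{\rm od}\ket\beta$, $C_{\rm e}=\bra\beta\Pi_{\rm ev}\ket\beta$, and - $\lambda_{\rm oo}=C_{\rm o}^{-1}\bra\beta M_{\rm oo}\ket\beta$, $\lambda_{\rm ee}=C_{\rm e}^{-1}\bra\beta M_{\rm ee}\ket\beta$, $\lambda^s_{\rm oe}=(C_{\rm o}C_{\rm e})^{-1/2}\bra\beta M^s_{\rm oe}\ket\beta$; - $\sigma_{\rm oo}=(C_{\rm o}^{-1}\|M_{\rm oo}\ket\beta\|^2-\lambda_{\rm oo}^2)^{1/2}$, $\sigma^s_{\rm eo}=(C_{\rm o}^{-1}\|M^s_{\rm eo}\ket\beta\|^2-|\lambda^s_{\rm oe}|^2)^{1/2}$; - $\sigma^s_{\rm oe}=\sigma_{\rm oo}^{-1}\bigl((C_{\rm o}C_{\rm e})^{-1/2}\bra\beta M_{\rm oo}M^s_{\rm oe}\ket\beta-\lambda_{\rm oo}\lambda^s_{\rm oe}\bigr)$, $\sigma^s_{\rm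 ee}=(\sigma^s_{\rm eo})^{-1}\bigl((C_{\rm o}C_{\rm e})^{-1/2}\bra\beta M^s_{\rm oe}M_{\rm ee}\ket\beta-\lambda^s_{\rm oe}\lambda_{\rm ee}\bigr)$; - $\Delta^s_{\rm oe}=(C_{\rm e}^{-1}\|M^s_{\rm oe}\ket\beta\|^2-|\lambda^s_{\rm oe}|^2-|\sigma^s_{\rm oe}|^2)^{1/2}$, $\Delta^s_{\rm ee}=(C_{\rm e}^{-1}\|M_{\rm ee}\ket\beta\|^2-\lambda_{\rm ee}^2-|\sigma^s_{\rm ee}|^2)^{1/2}$. For real $a,b$ let $c^s=\kappa\sqrt{C_{\rm o}C_{\rm e}}+\lambda^s_{\rm oe}$ and $$N^s(\kappa;a,b)=\begin{pmatrix}1-a&0&0&\Delta^s_{\rm oe}&0&0\\0&1-a&\sigma_{\rm oo}&\sigma^s_{\rm oe}&0&0\\0&\sigma_{\rm oo}&\kappa C_{\rm o}+\lambda_{\rm oo}-a&c^s&\sigma^s_{\rm eo}&0\\\Delta^s_{\rm oe}&\sigma^s_{\rm oe}&c^s&\kappa C_{\rm e}+\lambda_{\rm ee}-b&\sigma^s_{\rm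 ee}&\Delta^s_{\rm ee}\\0&0&\sigma^s_{\rm eo}&\sigma^s_{\rm ee}&1-b&0\\0&0&0&\Delta^s_{\rm ee}&0&1-b\end{pmatrix},$$ and put $M'^{(0)}_{\rm 6d}=N^{+1}(\kappa;0,\gamma)$ and $M'^{(1)}_{\rm 6d}=N^{-1}(\kappa;\gamma,0)$. Let $B^{\rm het}(\kappa,\gamma)=\max\{\sigma_{\sup}(M'^{(0)}_{\rm 6d}),\sigma_{\sup}(M'^{(1)}_{\rm 6d})\}$, where $\sigma_{\sup}$ is the supremum of the spectrum, i.e. the largest eigenvalue. **Claim.** All the operator integrals above define bounded operators; $C_{\rm o}=e^{-\beta^2}\sinh\beta^2$ and $C_{\rm e}=e^{-\beta^2}\cosh\beta^2$; the parameters $\lambda_{\rm oo},\lambda_{\rm ee},\lambda^s_{\rm oe},\sigma^s_{\rm oe},\sigma^s_{\rm ee}$ are real; $B^{\rm het}$ is a convex function of $(\kappa,\gamma)\in\mathbb R^2$; and for all $\kappa,\gamma\ge0$ $$M^{\rm het}[\kappa,\gamma]\le B^{\rm het}(\kappa,\gamma)\,I_{AC}.$$ -/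

import Mathlib

open MeasureTheory ProbabilityTheory Complex
open scoped InnerProductSpace Kronecker

noncomputable section

namespace HetQKD

/-! ### Weak operator integrals -/

section Weak

variable {α H : Type*} [MeasurableSpace α] [NormedAddCommGroup H] [InnerProductSpace ℂ H]

/-- The bounded operator `M` is the weak integral of the family of forms `s a`, read as
`s a φ ψ = ⟨φ| k(a) |ψ⟩`: every matrix element is absolutely integrable and
`⟨φ| M |ψ⟩ = ∫ ⟨φ| k(a) |ψ⟩ dm(a)`. -/
def HasWeakIntegral (m : Measure α) (s : α → H → H → ℂ) (M : H →L[ℂ] H) : Prop :=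
  ∀ φ ψ : H, Integrable (fun a => s a φ ψ) m ∧ ⟪φ, M ψ⟫_ℂ = ∫ a, s a φ ψ ∂m

/-- The weak integral exists as a bounded operator. -/
def WeaklyIntegrable (m : Measure α) (s : α → H → H → ℂ) : Prop :=
  ∃ M : H →L[ℂ] H, HasWeakIntegral m s M

open Classical in
/-- The weak integral (unique when it exists; `0` otherwise). -/
def weakIntegral (m : Measure α) (s : α → H → H → ℂ) : H →L[ℂ] H :=
  if h : WeaklyIntegrable m s then h.choose else 0

end Weak

/-- Supremum of the (real) spectrum. -/
def sigmaSup {A : Type*} [Ring A] [Algebra ℝ A] (a : A) : ℝ := sSup (spectrum ℝ a)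

/-! ### The optical mode `C` in the position representation -/

/-- The Hilbert space of the optical pulse `C`: a vector is its wave function `x ↦ ⟨x|ψ⟩`. -/
abbrev Mode := Lp ℂ 2 (volume : Measure ℝ)

/-- Wave function `⟨x|n⟩` of the `n`-photon state, for the quadrature normalised to vacuum
variance `1/4`. (`Polynomial.hermite` is the probabilists' Hermite polynomial.) -/
def numberWave (n : ℕ) (x : ℝ) : ℂ :=
  (((2 / Real.pi) ^ (1 / 4 : ℝ) / Real.sqrt (n.factorial : ℝ)
    * (Polynomial.aeval (2 * x) (Polynomial.hermite n)) * Real.exp (-x ^ 2) : ℝ) : ℂ)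

/-- Wave function `⟨x|ω⟩` of the coherent state with amplitude `ω`. -/
def coherentWave (ω : ℂ) (x : ℝ) : ℂ :=
  (((2 / Real.pi) ^ (1 / 4 : ℝ) : ℝ) : ℂ)
    * exp (-((x : ℂ) - ω.re) ^ 2 + 2 * I * ω.im * x - I * ω.re * ω.im)

theorem memLp_pow_mul_gauss (k : ℕ) :
    MemLp (fun x : ℝ => x ^ k * Real.exp (-x ^ 2)) 2 (volume : Measure ℝ) := by
  rw [memLp_two_iff_integrable_sq (by fun_prop)]
  have h := integrable_rpow_mul_exp_neg_mul_sq (b := 2) (by norm_num) (s := ((2 * k : ℕ) : ℝ))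
    (lt_of_lt_of_le (by norm_num) (Nat.cast_nonneg _))
  refine h.congr (Filter.Eventually.of_forall fun x => ?_)
  simp only [Real.rpow_natCast]
  rw [mul_pow, ← pow_mul, ← Real.exp_nat_mul, mul_comm k 2]
  congr 2
  push_cast
  ring

theorem memLp_poly_mul_gauss (p : Polynomial ℝ) :
    MemLp (fun x : ℝ => p.eval x * Real.exp (-x ^ 2)) 2 (volume : Measure ℝ) := by
  induction p using Polynomial.induction_on' with
  | add p q hp hq =>
    refine (hp.add hq).congr_norm (by fun_prop) (Filter.Eventually.of_forall fun x => ?_)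
    simp [add_mul]
  | monomial k c =>
    refine ((memLp_pow_mul_gauss k).const_mul c).congr_norm (by fun_prop)
      (Filter.Eventually.of_forall fun x => ?_)
    simp [mul_assoc]

theorem memLp_numberWave (n : ℕ) : MemLp (numberWave n) 2 (volume : Measure ℝ) := by
  have h := ((memLp_poly_mul_gauss
    (((Polynomial.hermite n).map (Int.castRingHom ℝ)).comp (Polynomial.C 2 * Polynomial.X))).const_mul
      ((2 / Real.pi) ^ (1 / 4 : ℝ) / Real.sqrt (n.factorial : ℝ))).ofReal (K := ℂ)
  refine h.congr_norm ?_ (Filter.Eventually.of_forall fun x => ?_)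
  · unfold numberWave
    fun_prop
  · simp [numberWave, Polynomial.aeval_def, Polynomial.eval_map, mul_assoc]

theorem memLp_coherentWave (ω : ℂ) : MemLp (coherentWave ω) 2 (volume : Measure ℝ) := by
  have h0 := memLp_pow_mul_gauss 0
  have h1 := (h0.comp_measurePreserving (measurePreserving_sub_right volume ω.re)).const_mul
    ((2 / Real.pi) ^ (1 / 4 : ℝ))
  refine h1.congr_norm ?_ (Filter.Eventually.of_forall fun x => ?_)
  · unfold coherentWave
    fun_prop
  · have hre : (-((x : ℂ) - ω.re) ^ 2 + 2 * I * ω.im * x - I * ω.re * ω.im).re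
        = -(x - ω.re) ^ 2 := by
      simp [pow_two]
    rw [coherentWave, norm_mul, norm_mul, norm_exp, hre, norm_real]
    simp

/-- The number state `|n⟩`. -/
def numberState (n : ℕ) : Mode := (memLp_numberWave n).toLp (numberWave n)

/-- The coherent state `|ω⟩`. -/
def coherent (ω : ℂ) : Mode := (memLp_coherentWave ω).toLp (coherentWave ω)

/-- Projection onto the subspace of even photon numbers. -/
def evProj : Mode →L[ℂ] Mode :=
  (Submodule.span ℂ (Set.range fun k : ℕ => numberState (2 * k))).topologicalClosure.starProjection

/-- Projection onto the subspace of odd photon numbers. -/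
def odProj : Mode →L[ℂ] Mode :=
  (Submodule.span ℂ
    (Set.range fun k : ℕ => numberState (2 * k + 1))).topologicalClosure.starProjection

/-! ### Qubits and composite systems -/

abbrev Qubit := EuclideanSpace ℂ (Fin 2)

/-- `ℂ² ⊗ H`, the first factor being Alice's qubit `A`: the vector `|0⟩⊗ψ₀ + |1⟩⊗ψ₁` is the
pair `(ψ₀, ψ₁)` with the Hilbert-sum norm. -/
abbrev WithA (H : Type*) [NormedAddCommGroup H] [InnerProductSpace ℂ H] :=
  PiLp 2 (fun _ : Fin 2 => H)

section Tensor

variable {H K : Type*} [NormedAddCommGroup H] [InnerProductSpace ℂ H]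
  [NormedAddCommGroup K] [InnerProductSpace ℂ K]

/-- The operator `a ⊗ T : ℂ² ⊗ H → ℂ² ⊗ K`. -/
def tens (a : Matrix (Fin 2) (Fin 2) ℂ) (T : H →L[ℂ] K) : WithA H →L[ℂ] WithA K :=
  ((PiLp.continuousLinearEquiv 2 ℂ (fun _ : Fin 2 => K)).symm :
      (Fin 2 → K) →L[ℂ] WithA K) ∘L
    ContinuousLinearMap.pi fun i => ∑ j, a i j • (T ∘L PiLp.proj 2 (fun _ : Fin 2 => H) j)

theorem tens_apply (a : Matrix (Fin 2) (Fin 2) ℂ) (T : H →L[ℂ] K) (Ψ : WithA H) (i : Fin 2) :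
    tens a T Ψ i = ∑ j, a i j • T (Ψ j) := by
  simp [tens]

end Tensor

/-- Components of `|0⟩`, `|1⟩`, `|+⟩`, `|-⟩`. -/
def ket0 : Fin 2 → ℂ := ![1, 0]
def ket1 : Fin 2 → ℂ := ![0, 1]
def ketP : Fin 2 → ℂ := ![1 / (Real.sqrt 2 : ℂ), 1 / (Real.sqrt 2 : ℂ)]
def ketM : Fin 2 → ℂ := ![1 / (Real.sqrt 2 : ℂ), -(1 / (Real.sqrt 2 : ℂ))]

/-- The matrix `|u⟩⟨u|`. -/
def proj (u : Fin 2 → ℂ) : Matrix (Fin 2) (Fin 2) ℂ := Matrix.vecMulVec u (star u)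

/-- The operator `|u⟩⟨u|` on Bob's qubit `B`. -/
def projB (u : Fin 2 → ℂ) : Qubit →L[ℂ] Qubit :=
  InnerProductSpace.rankOne ℂ (WithLp.toLp 2 u : Qubit) (WithLp.toLp 2 u : Qubit)

def pauliX : Matrix (Fin 2) (Fin 2) ℂ := !![0, 1; 1, 0]

/-- The rotation `exp(-iθZ/2)`. -/
def rotZ (θ : ℝ) : Matrix (Fin 2) (Fin 2) ℂ :=
  Matrix.diagonal ![exp (-I * θ / 2), exp (I * θ / 2)]

/-- Controlled-NOT with control `B` and target `A`. -/
def cX : WithA Qubit →L[ℂ] WithA Qubit := tens 1 (projB ket0) + tens pauliX (projB ket1)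

/-! ### The twisting unitary -/

def qErr (μ β : ℝ) : ℝ := (1 - Real.exp (-2 * (μ - β ^ 2))) / 2

/-- `√g_{β,1/2}(w) |0⟩ ± √g_{-β,1/2}(w) |1⟩` with sign `s = ±1`, where `g_{m,V}` is the normal
density with mean `m` and variance `V`. -/
def gaussKet (β s w : ℝ) : Fin 2 → ℂ :=
  ![(Real.sqrt (gaussianPDFReal β (1 / 2) w) : ℂ),
    (s * Real.sqrt (gaussianPDFReal (-β) (1 / 2) w) : ℂ)]

/-- The operator `τ_{AB}(w)`; indices are pairs (index of `A`, index of `B`). -/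
def tauAB (μ β w : ℝ) : Matrix (Fin 2 × Fin 2) (Fin 2 × Fin 2) ℂ :=
  ((1 - qErr μ β : ℝ) : ℂ) • (proj (gaussKet β 1 w) ⊗ₖ proj ketP)
    + (qErr μ β : ℂ) • (proj (gaussKet β (-1) w) ⊗ₖ proj ketM)

/-- `⟨0|_B τ_{AB}(w) |1⟩_B`. -/
def tau01 (μ β w : ℝ) : Matrix (Fin 2) (Fin 2) ℂ :=
  Matrix.of fun i j => tauAB μ β w (i, 0) (j, 1)

/-- `v` is a unit eigenvector of `T` with positive eigenvalue. -/
def IsPosEigenvector (T : Matrix (Fin 2) (Fin 2) ℂ) (v : Fin 2 → ℂ) : Prop :=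
  star v ⬝ᵥ v = 1 ∧ ∃ l : ℝ, 0 < l ∧ T.mulVec v = (l : ℂ) • v

/-- `v` is a unit eigenvector of `T` with negative eigenvalue. -/
def IsNegEigenvector (T : Matrix (Fin 2) (Fin 2) ℂ) (v : Fin 2 → ℂ) : Prop :=
  star v ⬝ᵥ v = 1 ∧ ∃ l : ℝ, l < 0 ∧ T.mulVec v = (l : ℂ) • v

/-- `W_A(w) = |u₊(w)⟩⟨u₊(w)| - |u₋(w)⟩⟨u₋(w)|`. -/
def twistW (up um : ℝ → Fin 2 → ℂ) (w : ℝ) : Matrix (Fin 2) (Fin 2) ℂ :=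
  proj (up w) - proj (um w)

/-- The controlled isometry
`[|0⟩⟨0|_B ⊗ R† + |1⟩⟨1|_B ⊗ W_A(ω_r) R†] C-X_{BA}` with `R = R^Z(2 ω_i β)`. -/
def ctrlV (β : ℝ) (up um : ℝ → Fin 2 → ℂ) (ω : ℂ) : WithA Qubit →L[ℂ] WithA Qubit :=
  (tens (rotZ (2 * ω.im * β)).conjTranspose (projB ket0)
    + tens (twistW up um ω.re * (rotZ (2 * ω.im * β)).conjTranspose) (projB ket1)) ∘L cX

/-! ### The phase-error operator -/

/-- `K_suc(ω) = √(f(ω_r)/π) (|0⟩_B⟨ω|_C + |1⟩_B⟨-ω|_C)`. -/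
def Ksuc (f : ℝ → ℝ) (ω : ℂ) : Mode →L[ℂ] Qubit :=
  (Real.sqrt (f ω.re / Real.pi) : ℂ) •
    (InnerProductSpace.rankOne ℂ (WithLp.toLp 2 ket0 : Qubit) (coherent ω)
      + InnerProductSpace.rankOne ℂ (WithLp.toLp 2 ket1 : Qubit) (coherent (-ω)))

/-- The adjoint of `ρ ↦ Tr_A[V(ω) (I⊗K_suc(ω)) ρ (I⊗K_suc(ω))† V(ω)†]`, applied to
`|-⟩⟨-|_B`. -/
def phaseErrorDensity (β : ℝ) (f : ℝ → ℝ) (up um : ℝ → Fin 2 → ℂ) (ω : ℂ) :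
    WithA Mode →L[ℂ] WithA Mode :=
  ContinuousLinearMap.adjoint (ctrlV β up um ω ∘L tens 1 (Ksuc f ω)) ∘L
    tens 1 (projB ketM) ∘L (ctrlV β up um ω ∘L tens 1 (Ksuc f ω))

/-- Matrix elements of the density, as a function of `(ω_r, ω_i)`. -/
def phForm (β : ℝ) (f : ℝ → ℝ) (up um : ℝ → Fin 2 → ℂ) (p : ℝ × ℝ) (φ ψ : WithA Mode) : ℂ :=
  ⟪φ, phaseErrorDensity β f up um ⟨p.1, p.2⟩ ψ⟫_ℂ

/-- `M_ph^het`. -/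
def Mph (β : ℝ) (f : ℝ → ℝ) (up um : ℝ → Fin 2 → ℂ) : WithA Mode →L[ℂ] WithA Mode :=
  weakIntegral volume (phForm β f up um)

/-- `Π^fid = |0⟩⟨0|⊗|β⟩⟨β| + |1⟩⟨1|⊗|-β⟩⟨-β|`. -/
def fidProj (β : ℝ) : WithA Mode →L[ℂ] WithA Mode :=
  tens (proj ket0) (InnerProductSpace.rankOne ℂ (coherent β) (coherent β))
    + tens (proj ket1) (InnerProductSpace.rankOne ℂ (coherent (-β)) (coherent (-β)))

/-- `Π^trash_- = |-⟩⟨-|⊗I`. -/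
def trashProj : WithA Mode →L[ℂ] WithA Mode := tens (proj ketM) (ContinuousLinearMap.id ℂ Mode)

/-- `M^het[κ,γ] = M_ph^het + κ Π^fid - γ Π^trash_-`. -/
def Mhet (β : ℝ) (f : ℝ → ℝ) (up um : ℝ → Fin 2 → ℂ) (κ γ : ℝ) :
    WithA Mode →L[ℂ] WithA Mode :=
  Mph β f up um + (κ : ℂ) • fidProj β - (γ : ℂ) • trashProj

/-! ### The operators on `C` entering the bound -/

/-- The angle in `(-π/2, π/2)` with `tan θ = e^{-2(μ-β²)} sinh(2βw)`. -/
def theta (μ β w : ℝ) : ℝ := Real.arctan (Real.exp (-2 * (μ - β ^ 2)) * Real.sinh (2 * β * w))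

/-- `⟨φ|x⟩⟨x|w⟩⟨w|y⟩⟨y|ψ⟩`, where `|w⟩` is the coherent state with real amplitude `w`. -/
def posTerm (w x y : ℝ) (φ ψ : Mode) : ℂ :=
  star (φ x) * coherentWave w x * star (coherentWave w y) * ψ y

/-- Integrand of `M_oo`, with `p = (ω_r, x)`. -/
def ooForm (μ β : ℝ) (f : ℝ → ℝ) (p : ℝ × ℝ) (φ ψ : Mode) : ℂ :=
  (f p.1 : ℂ) * (posTerm p.1 p.2 p.2 (odProj φ) (odProj ψ)
    + (Real.cos (theta μ β p.1) / 2 : ℂ) *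
      (posTerm p.1 p.2 (p.2 - β) (odProj φ) (odProj ψ)
        + posTerm p.1 (p.2 - β) p.2 (odProj φ) (odProj ψ)))

/-- Integrand of `M_ee`. -/
def eeForm (μ β : ℝ) (f : ℝ → ℝ) (p : ℝ × ℝ) (φ ψ : Mode) : ℂ :=
  (f p.1 : ℂ) * (posTerm p.1 p.2 p.2 (evProj φ) (evProj ψ)
    - (Real.cos (theta μ β p.1) / 2 : ℂ) *
      (posTerm p.1 p.2 (p.2 - β) (evProj φ) (evProj ψ)
        + posTerm p.1 (p.2 - β) p.2 (evProj φ) (evProj ψ)))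

/-- Integrand of `M_{(+,o)(-,e)}` for `s = 1`, and of `M_{(-,o)(+,e)}` for `s = -1`. -/
def oeForm (μ β : ℝ) (f : ℝ → ℝ) (s : ℝ) (p : ℝ × ℝ) (φ ψ : Mode) : ℂ :=
  (f p.1 : ℂ) * ((s * Real.sin (theta μ β p.1) : ℂ) *
      posTerm p.1 p.2 p.2 (odProj φ) (evProj ψ)
    - (Real.cos (theta μ β p.1) / 2 : ℂ) *
      (posTerm p.1 p.2 (p.2 - β) (odProj φ) (evProj ψ)
        - posTerm p.1 (p.2 - β) p.2 (odProj φ) (evProj ψ)))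

def Moo (μ β : ℝ) (f : ℝ → ℝ) : Mode →L[ℂ] Mode := weakIntegral volume (ooForm μ β f)

def Mee (μ β : ℝ) (f : ℝ → ℝ) : Mode →L[ℂ] Mode := weakIntegral volume (eeForm μ β f)

/-- `M_{(+,o)(-,e)}` for `s = 1`, `M_{(-,o)(+,e)}` for `s = -1`. -/
def Moe (μ β : ℝ) (f : ℝ → ℝ) (s : ℝ) : Mode →L[ℂ] Mode := weakIntegral volume (oeForm μ β f s)

/-- `M_{(-,e)(+,o)}` for `s = 1`, `M_{(+,e)(-,o)}` for `s = -1`. -/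
def Meo (μ β : ℝ) (f : ℝ → ℝ) (s : ℝ) : Mode →L[ℂ] Mode :=
  ContinuousLinearMap.adjoint (Moe μ β f s)

/-! ### Scalar parameters. In all of them `s = 1` selects the `(+,o),(-,e)` sector and
`s = -1` the `(-,o),(+,e)` sector. -/

/-- `⟨β|T|β⟩`. -/
def expect (β : ℝ) (T : Mode →L[ℂ] Mode) : ℂ := ⟪coherent β, T (coherent β)⟫_ℂ

def Co (β : ℝ) : ℝ := (expect β odProj).re
def Ce (β : ℝ) : ℝ := (expect β evProj).re

/-- `(C_o C_e)^{-1/2}`. -/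
def cInv (β : ℝ) : ℝ := (Real.sqrt (Co β * Ce β))⁻¹

def lamOO (μ β : ℝ) (f : ℝ → ℝ) : ℂ := ((Co β)⁻¹ : ℝ) * expect β (Moo μ β f)
def lamEE (μ β : ℝ) (f : ℝ → ℝ) : ℂ := ((Ce β)⁻¹ : ℝ) * expect β (Mee μ β f)

/-- `λ_{(+,o)(-,e)}`, `λ_{(-,o)(+,e)}`. -/
def lamOE (μ β : ℝ) (f : ℝ → ℝ) (s : ℝ) : ℂ := (cInv β : ℂ) * expect β (Moe μ β f s)

def sigOO (μ β : ℝ) (f : ℝ → ℝ) : ℝ :=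
  Real.sqrt ((Co β)⁻¹ * ‖Moo μ β f (coherent β)‖ ^ 2 - ‖lamOO μ β f‖ ^ 2)

/-- `σ_{(-,e)(+,o)}`, `σ_{(+,e)(-,o)}`. -/
def sigEO (μ β : ℝ) (f : ℝ → ℝ) (s : ℝ) : ℝ :=
  Real.sqrt ((Co β)⁻¹ * ‖Meo μ β f s (coherent β)‖ ^ 2 - ‖lamOE μ β f s‖ ^ 2)

/-- `σ_{(+,o)(-,e)}`, `σ_{(-,o)(+,e)}`. If `σ_oo = 0`, this is `0`. -/
def sigOE (μ β : ℝ) (f : ℝ → ℝ) (s : ℝ) : ℂ :=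
  ((sigOO μ β f)⁻¹ : ℝ) * ((cInv β : ℂ) * expect β (Moo μ β f ∘L Moe μ β f s)
    - lamOO μ β f * lamOE μ β f s)

/-- `σ_{(-,e)(-,e)}`, `σ_{(+,e)(+,e)}`. If `σ_{(∓,e)(±,o)} = 0`, this is `0`. -/
def sigEE (μ β : ℝ) (f : ℝ → ℝ) (s : ℝ) : ℂ :=
  ((sigEO μ β f s)⁻¹ : ℝ) * ((cInv β : ℂ) * expect β (Moe μ β f s ∘L Mee μ β f)
    - lamOE μ β f s * lamEE μ β f)

/-- `Δ_{(+,o)(-,e)}`, `Δ_{(-,o)(+,e)}`. -/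
def delOE (μ β : ℝ) (f : ℝ → ℝ) (s : ℝ) : ℝ :=
  Real.sqrt ((Ce β)⁻¹ * ‖Moe μ β f s (coherent β)‖ ^ 2 - ‖lamOE μ β f s‖ ^ 2
    - ‖sigOE μ β f s‖ ^ 2)

/-- `Δ_{(-,e)(-,e)}`, `Δ_{(+,e)(+,e)}`. -/
def delEE (μ β : ℝ) (f : ℝ → ℝ) (s : ℝ) : ℝ :=
  Real.sqrt ((Ce β)⁻¹ * ‖Mee μ β f (coherent β)‖ ^ 2 - ‖lamEE μ β f‖ ^ 2
    - ‖sigEE μ β f s‖ ^ 2)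

/-- The common shape of the two matrices; `go`, `ge` are the multiples of `γ` subtracted on the
odd and on the even part of the sector. -/
def sixMatrix (μ β : ℝ) (f : ℝ → ℝ) (s κ go ge : ℝ) : Matrix (Fin 6) (Fin 6) ℂ :=
  let d : ℂ := delOE μ β f s
  let e : ℂ := delEE μ β f s
  let soo : ℂ := sigOO μ β f
  let seo : ℂ := sigEO μ β f s
  let soe : ℂ := sigOE μ β f s
  let see : ℂ := sigEE μ β f s
  let c : ℂ := κ * Real.sqrt (Co β * Ce β) + lamOE μ β f s
  !![1 - go, 0, 0, d, 0, 0;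
     0, 1 - go, soo, soe, 0, 0;
     0, soo, κ * Co β + lamOO μ β f - go, c, seo, 0;
     d, soe, c, κ * Ce β + lamEE μ β f - ge, see, e;
     0, 0, seo, see, 1 - ge, 0;
     0, 0, 0, e, 0, 1 - ge]

/-- `M'^{(0)}_{6d}`. -/
def M6d0 (μ β : ℝ) (f : ℝ → ℝ) (κ γ : ℝ) : Matrix (Fin 6) (Fin 6) ℂ :=
  sixMatrix μ β f 1 κ 0 γ

/-- `M'^{(1)}_{6d}`. -/
def M6d1 (μ β : ℝ) (f : ℝ → ℝ) (κ γ : ℝ) : Matrix (Fin 6) (Fin 6) ℂ :=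
  sixMatrix μ β f (-1) κ γ 0

/-- `B^het(κ,γ)`. -/
def Bhet (μ β : ℝ) (f : ℝ → ℝ) (κ γ : ℝ) : ℝ :=
  max (sigmaSup (M6d0 μ β f κ γ)) (sigmaSup (M6d1 μ β f κ γ))

end HetQKD

end

/-!
Plancherel's theorem in the imaginary part of the amplitude turns every operator integral of the
problem into a coherent-state (Toeplitz) operator with a bounded symbol on the phase plane.

The unitary `W(w)` is the reflection `sin θ(w) Z + cos θ(w) X`, and `M_ph^het` is the sum of two
operators with orthogonal supports, one for each `s = ±1`: the odd part of the mode goes with the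
state `|s⟩` of Alice's qubit and the even part with `|-s⟩`. On its support the operator of the
sector is the block matrix of `M_oo`, `M_oe^s`, `M_ee`. At the amplitude `w + it` the symbol of
that matrix is `f(w)` times twice a rank-one projection. Without the factor `f(w)` the density of
the quadratic form is even under `ω ↦ -ω`, so `f(w)` may be replaced by its average
`(f(w) + f(-w)) / 2 ≤ 1 / 2`, and each sector is bounded by the identity.

The perturbation by `κ` and `γ` only adds to a sector the projection onto the coherent state and
multiples of the identity on its two components. Gram–Schmidt orthonormalization of the odd and
even parts of `|β⟩`, followed by their images under the blocks, gives at most six vectors. The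
quadratic form couples the rest of the space to the first two of them only through these images,
so replacing the rest by the bound `1` of the sector leaves the form of the matrix `N^s`.

All symbols are invariant under complex conjugation combined with `Im ω ↦ -Im ω`, hence the
parameters are real. The matrices `N^s` are affine in `(κ, γ)` and the largest eigenvalue is a
supremum of affine functions, hence convex.
-/

noncomputable section

namespace HetQKD

theorem inner_toLp_eq_integral {α F : Type*} [MeasurableSpace α] [NormedAddCommGroup F]
    [InnerProductSpace ℂ F] {m : Measure α} {u v : α → F} (hu : MemLp u 2 m)
    (hv : MemLp v 2 m) :
    ⟪hu.toLp u, hv.toLp v⟫_ℂ = ∫ x, ⟪u x, v x⟫_ℂ ∂m := by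
  rw [L2.inner_def]
  refine integral_congr_ae ?_
  filter_upwards [hu.coeFn_toLp, hv.coeFn_toLp] with x hx hy
  rw [hx, hy]

theorem integral_norm_toLp_sq {α F : Type*} [MeasurableSpace α] [NormedAddCommGroup F]
    [InnerProductSpace ℂ F] {m : Measure α} {u : α → F} (hu : MemLp u 2 m) :
    ∫ x, ‖u x‖ ^ 2 ∂m = ‖hu.toLp u‖ ^ 2 := by
  have h := inner_toLp_eq_integral hu hu
  simp only [inner_self_eq_norm_sq_to_K] at h
  have e : ((‖hu.toLp u‖ ^ 2 : ℝ) : ℂ) = ∫ x, ((‖u x‖ ^ 2 : ℝ) : ℂ) ∂m := by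
    push_cast
    exact h
  rw [integral_complex_ofReal, ofReal_inj] at e
  exact e.symm

section Plancherel

open FourierTransform SchwartzMap
open scoped ContDiff

variable {E F : Type*} [NormedAddCommGroup E] [InnerProductSpace ℝ E] [FiniteDimensional ℝ E]
  [MeasurableSpace E] [BorelSpace E] [NormedAddCommGroup F] [InnerProductSpace ℂ F]
  [CompleteSpace F] {h k : E → F}

/- Both sides are locally integrable and define the same tempered distribution. -/
theorem fourier_toLp_ae_eq (h1 : Integrable h) (h2 : MemLp h 2) :
    (𝓕 (h2.toLp h) : Lp F 2 (volume : Measure E)) =ᵐ[volume] 𝓕 h := by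
  have hcont : Continuous (𝓕 h) := VectorFourier.fourierIntegral_continuous
    Real.continuous_fourierChar continuous_inner h1
  refine ae_eq_of_integral_contDiff_smul_eq
    ((Lp.memLp _).locallyIntegrable one_le_two) hcont.locallyIntegrable fun g hg hgs => ?_
  have g_compact : HasCompactSupport (Complex.ofRealCLM ∘ g) := hgs.comp_left rfl
  have g_smooth : ContDiff ℝ ∞ (Complex.ofRealCLM ∘ g) := by fun_prop
  set η : 𝓢(E, ℂ) := g_compact.toSchwartzMap g_smooth
  have tempered := congrArg (fun T => T η) (Lp.fourier_toTemperedDistribution_eq (h2.toLp h))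
  simp only [TemperedDistribution.fourier_apply, Lp.toTemperedDistribution_apply] at tempered
  have flip := VectorFourier.integral_fourierIntegral_smul_eq_flip (L := innerₗ E) (μ := volume)
    (ν := volume) (f := (η : E → ℂ)) (g := h) Real.continuous_fourierChar continuous_inner
    η.integrable h1
  rw [flip_innerₗ] at flip
  calc ∫ x, g x • (𝓕 (h2.toLp h) : Lp F 2 (volume : Measure E)) x
      = ∫ x, η x • (𝓕 (h2.toLp h) : Lp F 2 (volume : Measure E)) x :=
        integral_congr_ae (Filter.Eventually.of_forall fun x => (Complex.coe_smul (g x) _).symm)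
    _ = ∫ x, (𝓕 η) x • (h2.toLp h) x := tempered.symm
    _ = ∫ x, (𝓕 η) x • h x :=
        integral_congr_ae (h2.coeFn_toLp.mono fun x hx => congrArg ((𝓕 η) x • ·) hx)
    _ = ∫ x, η x • 𝓕 h x := flip
    _ = ∫ x, g x • 𝓕 h x :=
        integral_congr_ae (Filter.Eventually.of_forall fun x => Complex.coe_smul (g x) _)

theorem memLp_fourier (h1 : Integrable h) (h2 : MemLp h 2) : MemLp (𝓕 h) 2 :=
  (Lp.memLp _).ae_eq (fourier_toLp_ae_eq h1 h2)

theorem integral_inner_fourier_fourier (h1 : Integrable h) (h2 : MemLp h 2)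
    (k1 : Integrable k) (k2 : MemLp k 2) :
    ∫ ξ, ⟪𝓕 h ξ, 𝓕 k ξ⟫_ℂ = ∫ x, ⟪h x, k x⟫_ℂ := by
  calc ∫ ξ, ⟪𝓕 h ξ, 𝓕 k ξ⟫_ℂ
      = ⟪𝓕 (h2.toLp h), 𝓕 (k2.toLp k)⟫_ℂ := by
        rw [L2.inner_def]
        refine integral_congr_ae ?_
        filter_upwards [fourier_toLp_ae_eq h1 h2, fourier_toLp_ae_eq k1 k2] with ξ hξ kξ
        rw [hξ, kξ]
    _ = ⟪h2.toLp h, k2.toLp k⟫_ℂ := Lp.inner_fourier_eq _ _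
    _ = ∫ x, ⟪h x, k x⟫_ℂ := inner_toLp_eq_integral h2 k2

end Plancherel

/-! ### Coherent states and the short-time Fourier transform -/

/-- The wave function of the coherent state with real amplitude `w`. -/
def realWave (w x : ℝ) : ℝ := (2 / Real.pi) ^ (1 / 4 : ℝ) * Real.exp (-(x - w) ^ 2)

theorem coherentWave_ofReal (w x : ℝ) : coherentWave w x = (realWave w x : ℂ) := by
  simp [coherentWave, realWave]

theorem coherentWave_mk (w t x : ℝ) :
    coherentWave ⟨w, t⟩ x = realWave w x * exp (2 * I * t * x - I * w * t) := by
  simp only [coherentWave, realWave]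
  rw [Complex.ofReal_mul, Complex.ofReal_exp, mul_assoc (((_ : ℝ) : ℂ)) (exp _) (exp _),
    ← Complex.exp_add]
  congr 2
  push_cast
  ring

theorem measurable_realWave : Measurable (fun p : ℝ × ℝ => realWave p.1 p.2) := by
  unfold realWave; fun_prop

theorem realWave_sq (w x : ℝ) :
    realWave w x ^ 2 = Real.sqrt (2 / Real.pi) * Real.exp (-2 * (x - w) ^ 2) := by
  rw [realWave, mul_pow, ← Real.exp_nat_mul, ← Real.rpow_natCast, ← Real.rpow_mul (by positivity),
    Real.sqrt_eq_rpow]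
  norm_num

theorem integrable_realWave_sq_left (x : ℝ) : Integrable (fun w => realWave w x ^ 2) := by
  simp_rw [realWave_sq]
  exact ((integrable_exp_neg_mul_sq two_pos).comp_sub_left x).const_mul _

theorem integral_realWave_sq_left (x : ℝ) : ∫ w, realWave w x ^ 2 = 1 := by
  simp_rw [realWave_sq]
  rw [integral_const_mul, integral_sub_left_eq_self (fun y => Real.exp (-2 * y ^ 2)) volume x,
    integral_gaussian, ← Real.sqrt_mul (by positivity)]
  rw [show 2 / Real.pi * (Real.pi / 2) = 1 by field_simp, Real.sqrt_one]

theorem norm_realWave_le (w x : ℝ) : ‖realWave w x‖ ≤ (2 / Real.pi) ^ (1 / 4 : ℝ) := by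
  rw [realWave, Real.norm_of_nonneg (by positivity)]
  refine mul_le_of_le_one_right (by positivity) ?_
  rw [Real.exp_le_one_iff]
  exact neg_nonpos.2 (sq_nonneg _)

/-- The wave function of `ψ` seen through the Gaussian window centred at `w`. The overlaps
`⟨w+it|ψ⟩` are, up to phases, the values of its Fourier transform. -/
def windowed (w : ℝ) (ψ : Mode) (x : ℝ) : ℂ := realWave w x * ψ x

theorem memLp_windowed (w : ℝ) (ψ : Mode) : MemLp (windowed w ψ) 2 := by
  have hw : AEStronglyMeasurable (fun x => (realWave w x : ℂ)) :=
    (Complex.measurable_ofReal.comp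
      (measurable_realWave.comp measurable_prodMk_left)).aestronglyMeasurable
  refine (Lp.memLp ψ).of_le_mul (c := (2 / Real.pi) ^ (1 / 4 : ℝ))
    (hw.mul (Lp.aestronglyMeasurable ψ))
    (Filter.Eventually.of_forall fun x => ?_)
  rw [windowed, norm_mul, norm_real]
  exact mul_le_mul_of_nonneg_right (norm_realWave_le w x) (norm_nonneg _)

theorem integrable_windowed (w : ℝ) (ψ : Mode) : Integrable (windowed w ψ) := by
  have h : MemLp (fun x => (realWave w x : ℂ)) 2 := by
    simpa only [funext (coherentWave_ofReal w)] using memLp_coherentWave (w : ℂ)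
  exact h.integrable_mul (Lp.memLp ψ)

theorem posTerm_eq (w x y : ℝ) (φ ψ : Mode) :
    posTerm w x y φ ψ = star (windowed w φ x) * windowed w ψ y := by
  simp only [posTerm, windowed, coherentWave_ofReal, star_mul', RCLike.star_def, conj_ofReal]
  ring

theorem norm_windowed_sq (w x : ℝ) (ψ : Mode) :
    ‖windowed w ψ x‖ ^ 2 = realWave w x ^ 2 * ‖ψ x‖ ^ 2 := by
  rw [windowed, norm_mul, mul_pow, norm_real, Real.norm_eq_abs, sq_abs]

theorem measurable_windowed (ψ : Mode) : Measurable fun p : ℝ × ℝ => windowed p.1 ψ p.2 :=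
  (Complex.measurable_ofReal.comp measurable_realWave).mul
    ((Lp.stronglyMeasurable ψ).measurable.comp measurable_snd)

theorem memLp_windowed_prod (ψ : Mode) : MemLp (fun p : ℝ × ℝ => windowed p.1 ψ p.2) 2 := by
  have hm := measurable_windowed ψ
  rw [memLp_two_iff_integrable_sq_norm hm.aestronglyMeasurable, Measure.volume_eq_prod,
    integrable_prod_iff' (hm.norm.pow_const 2).aestronglyMeasurable]
  simp only [norm_pow, norm_norm]
  simp only [norm_windowed_sq, integral_mul_const, integral_realWave_sq_left, one_mul]
  exact ⟨Filter.Eventually.of_forall fun x => (integrable_realWave_sq_left x).mul_const _,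
    (Lp.memLp ψ).integrable_norm_pow two_ne_zero⟩

theorem integral_norm_windowed_sq (ψ : Mode) :
    ∫ p : ℝ × ℝ, ‖windowed p.1 ψ p.2‖ ^ 2 = ‖ψ‖ ^ 2 := by
  rw [Measure.volume_eq_prod,
    integral_prod_symm _ ((memLp_windowed_prod ψ).integrable_norm_pow two_ne_zero)]
  simp only [norm_windowed_sq, integral_mul_const, integral_realWave_sq_left, one_mul]
  rw [integral_norm_toLp_sq (Lp.memLp ψ), Lp.toLp_coeFn]

theorem inner_coherent_eq_integral (ω : ℂ) (ψ : Mode) :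
    ⟪coherent ω, ψ⟫_ℂ = ∫ x, star (coherentWave ω x) * ψ x := by
  rw [L2.inner_def]
  refine integral_congr_ae ?_
  filter_upwards [(memLp_coherentWave ω).coeFn_toLp] with x hx
  rw [coherent, hx, RCLike.inner_apply', RCLike.star_def]

theorem stronglyMeasurable_inner_coherent (ψ : Mode) :
    StronglyMeasurable (fun p : ℝ × ℝ => ⟪coherent ⟨p.1, p.2⟩, ψ⟫_ℂ) := by
  simp_rw [inner_coherent_eq_integral]
  refine StronglyMeasurable.integral_prod_right'
    (f := fun q : (ℝ × ℝ) × ℝ => star (coherentWave ⟨q.1.1, q.1.2⟩ q.2) * ψ q.2) ?_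
  have hwave : Measurable fun q : (ℝ × ℝ) × ℝ => coherentWave ⟨q.1.1, q.1.2⟩ q.2 := by
    unfold coherentWave; fun_prop
  exact ((continuous_star.measurable.comp hwave).mul
    ((Lp.stronglyMeasurable ψ).measurable.comp measurable_snd)).stronglyMeasurable

open FourierTransform in
theorem fourier_windowed_sub (w t c : ℝ) (ψ : Mode) :
    𝓕 (fun x => windowed w ψ (x - c)) (t / Real.pi)
      = exp (-(I * (w + 2 * c) * t)) * ⟪coherent ⟨w, t⟩, ψ⟫_ℂ := by
  rw [inner_coherent_eq_integral, Real.fourier_real_eq_integral_exp_smul,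
    ← integral_sub_right_eq_self (fun x => star (coherentWave ⟨w, t⟩ x) * ψ x) c,
    ← integral_const_mul]
  congr 1 with x
  have hpi : (Real.pi : ℂ) ≠ 0 := ofReal_ne_zero.2 Real.pi_ne_zero
  have phase : exp (((-2 * Real.pi * x * (t / Real.pi) : ℝ) : ℂ) * I)
      = exp (-(I * (w + 2 * c) * t))
        * exp ((starRingEnd ℂ) (2 * I * t * ((x - c : ℝ) : ℂ) - I * w * t)) := by
    rw [← Complex.exp_add]
    congr 1
    simp only [map_sub, map_mul, Complex.conj_I, Complex.conj_ofReal, map_ofNat]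
    push_cast
    field_simp
    ring
  rw [phase, windowed, coherentWave_mk, star_mul', smul_eq_mul]
  simp only [RCLike.star_def, Complex.conj_ofReal, ← Complex.exp_conj]
  ring

open FourierTransform in
theorem norm_inner_coherent_eq (w t : ℝ) (ψ : Mode) :
    ‖⟪coherent ⟨w, t⟩, ψ⟫_ℂ‖ = ‖𝓕 (windowed w ψ) (t / Real.pi)‖ := by
  have h := congrArg norm (fourier_windowed_sub w t 0 ψ)
  have phase : -(I * ((w : ℂ) + 2 * (0 : ℝ)) * t) = ((-(w * t) : ℝ) : ℂ) * I := by push_cast; ring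
  rw [norm_mul, phase, norm_exp_ofReal_mul_I, one_mul] at h
  simpa only [sub_zero] using h.symm

theorem integrable_norm_sq_inner_coherent_slice (w : ℝ) (ψ : Mode) :
    Integrable (fun t : ℝ => ‖⟪coherent ⟨w, t⟩, ψ⟫_ℂ‖ ^ 2) := by
  simp only [norm_inner_coherent_eq]
  exact ((memLp_fourier (integrable_windowed w ψ) (memLp_windowed w ψ)).integrable_norm_pow
    two_ne_zero).comp_div Real.pi_ne_zero

open FourierTransform in
theorem integral_inner_coherent_slice (w a b : ℝ) (φ ψ : Mode) :
    ∫ t : ℝ, exp (2 * I * (a - b) * t) * (⟪φ, coherent ⟨w, t⟩⟫_ℂ * ⟪coherent ⟨w, t⟩, ψ⟫_ℂ)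
      = Real.pi * ∫ x, posTerm w (x - a) (x - b) φ ψ := by
  have fourier_mul : ∀ t : ℝ, exp (2 * I * (a - b) * t)
        * (⟪φ, coherent ⟨w, t⟩⟫_ℂ * ⟪coherent ⟨w, t⟩, ψ⟫_ℂ)
      = ⟪𝓕 (fun x => windowed w φ (x - a)) (t / Real.pi),
          𝓕 (fun x => windowed w ψ (x - b)) (t / Real.pi)⟫_ℂ := by
    intro t
    have phase : exp (2 * I * (a - b) * t)
        = (starRingEnd ℂ) (exp (-(I * (w + 2 * a) * t))) * exp (-(I * (w + 2 * b) * t)) := by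
      rw [← Complex.exp_conj, ← Complex.exp_add]
      congr 1
      simp only [map_neg, map_mul, map_add, Complex.conj_I, Complex.conj_ofReal, map_ofNat]
      ring
    rw [fourier_windowed_sub, fourier_windowed_sub, RCLike.inner_apply', map_mul,
      inner_conj_symm, phase]
    ring
  have mp := fun c => measurePreserving_sub_right (volume : Measure ℝ) c
  simp_rw [fourier_mul]
  rw [Measure.integral_comp_div fun t => ⟪𝓕 (fun x => windowed w φ (x - a)) t,
      𝓕 (fun x => windowed w ψ (x - b)) t⟫_ℂ,
    integral_inner_fourier_fourier ((integrable_windowed w φ).comp_sub_right a)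
      ((memLp_windowed w φ).comp_measurePreserving (mp a))
      ((integrable_windowed w ψ).comp_sub_right b)
      ((memLp_windowed w ψ).comp_measurePreserving (mp b)),
    abs_of_pos Real.pi_pos, Complex.real_smul]
  simp only [posTerm_eq, RCLike.inner_apply', RCLike.star_def]

theorem integral_norm_sq_inner_coherent_slice (w : ℝ) (ψ : Mode) :
    ∫ t : ℝ, ‖⟪coherent ⟨w, t⟩, ψ⟫_ℂ‖ ^ 2 = Real.pi * ∫ x, ‖windowed w ψ x‖ ^ 2 := by
  have h := integral_inner_coherent_slice w 0 0 ψ ψ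
  simp only [sub_self, mul_zero, zero_mul, Complex.exp_zero, one_mul, sub_zero, posTerm_eq,
    RCLike.star_def, ← inner_conj_symm ψ, ← Complex.normSq_eq_conj_mul_self,
    Complex.normSq_eq_norm_sq, integral_complex_ofReal] at h
  exact_mod_cast h

theorem memLp_inner_coherent (ψ : Mode) :
    MemLp (fun p : ℝ × ℝ => ⟪coherent ⟨p.1, p.2⟩, ψ⟫_ℂ) 2 := by
  have hm := (stronglyMeasurable_inner_coherent ψ).aestronglyMeasurable
    (μ := (volume : Measure (ℝ × ℝ)))
  rw [memLp_two_iff_integrable_sq_norm hm, Measure.volume_eq_prod,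
    integrable_prod_iff (by exact hm.norm.pow 2)]
  simp only [norm_pow, norm_norm, integral_norm_sq_inner_coherent_slice]
  exact ⟨Filter.Eventually.of_forall fun w => integrable_norm_sq_inner_coherent_slice w ψ,
    ((memLp_windowed_prod ψ).integrable_norm_pow two_ne_zero).integral_prod_left.const_mul _⟩

/- The resolution of the identity by coherent states. -/
theorem integral_norm_sq_inner_coherent (ψ : Mode) :
    ∫ p : ℝ × ℝ, ‖⟪coherent ⟨p.1, p.2⟩, ψ⟫_ℂ‖ ^ 2 = Real.pi * ‖ψ‖ ^ 2 := by
  rw [Measure.volume_eq_prod,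
    integral_prod _ ((memLp_inner_coherent ψ).integrable_norm_pow two_ne_zero)]
  simp only [integral_norm_sq_inner_coherent_slice]
  rw [integral_const_mul, ← integral_norm_windowed_sq ψ, Measure.volume_eq_prod,
    integral_prod _ ((memLp_windowed_prod ψ).integrable_norm_pow two_ne_zero)]

/-! ### Weak integrals and coherent-state Toeplitz operators -/

section Weak

variable {α H K : Type*} [MeasurableSpace α] [NormedAddCommGroup H] [InnerProductSpace ℂ H]
  [NormedAddCommGroup K] [InnerProductSpace ℂ K] {m : Measure α}
  {s s' : α → H → H → ℂ} {M M' : H →L[ℂ] H}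

theorem HasWeakIntegral.unique (h : HasWeakIntegral m s M) (h' : HasWeakIntegral m s M') :
    M = M' := by
  ext ψ
  refine ext_inner_left ℂ fun φ => ?_
  rw [(h φ ψ).2, (h' φ ψ).2]

theorem HasWeakIntegral.weakIntegral_eq (h : HasWeakIntegral m s M) : weakIntegral m s = M := by
  have hw : WeaklyIntegrable m s := ⟨M, h⟩
  rw [weakIntegral, dif_pos hw]
  exact hw.choose_spec.unique h

theorem HasWeakIntegral.add (h : HasWeakIntegral m s M) (h' : HasWeakIntegral m s' M') :
    HasWeakIntegral m (fun a φ ψ => s a φ ψ + s' a φ ψ) (M + M') := fun φ ψ =>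
  ⟨(h φ ψ).1.add (h' φ ψ).1, by
    rw [integral_add (h φ ψ).1 (h' φ ψ).1, ← (h φ ψ).2, ← (h' φ ψ).2, _root_.add_apply,
      inner_add_right]⟩

theorem HasWeakIntegral.comp [CompleteSpace H] [CompleteSpace K] (h : HasWeakIntegral m s M)
    (S T : K →L[ℂ] H) :
    HasWeakIntegral m (fun a φ ψ => s a (S φ) (T ψ))
      (ContinuousLinearMap.adjoint S ∘L M ∘L T) := fun φ ψ =>
  ⟨(h _ _).1, by
    rw [← (h _ _).2, ContinuousLinearMap.comp_apply, ContinuousLinearMap.comp_apply,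
      ContinuousLinearMap.adjoint_inner_right]⟩

theorem HasWeakIntegral.adjoint [CompleteSpace H] (h : HasWeakIntegral m s M) :
    HasWeakIntegral m (fun a φ ψ => star (s a ψ φ)) (ContinuousLinearMap.adjoint M) := fun φ ψ =>
  ⟨Complex.conjCLE.toContinuousLinearMap.integrable_comp (h ψ φ).1, by
    simp only [RCLike.star_def]
    rw [integral_conj, ← (h _ _).2, ContinuousLinearMap.adjoint_inner_right, inner_conj_symm]⟩

end Weak

/-- The coherent-state transform `ψ ↦ (ω ↦ ⟨ω|ψ⟩ / √π)`, an isometric embedding into the `L²`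
space of the phase plane. -/
def coherentTransform : Mode →ₗᵢ[ℂ] Lp ℂ 2 (volume : Measure (ℝ × ℝ)) where
  toFun ψ := ((memLp_inner_coherent ψ).const_mul (Real.sqrt Real.pi : ℂ)⁻¹).toLp _
  map_add' ψ ψ' := by
    rw [← MemLp.toLp_add]
    refine MemLp.toLp_congr _ _ (Filter.Eventually.of_forall fun p => ?_)
    simp only [Pi.add_apply, inner_add_right, mul_add]
  map_smul' c ψ := by
    rw [RingHom.id_apply, ← MemLp.toLp_const_smul]
    refine MemLp.toLp_congr _ _ (Filter.Eventually.of_forall fun p => ?_)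
    simp only [Pi.smul_apply, smul_eq_mul, inner_smul_right]
    ring
  norm_map' ψ := by
    rw [← sq_eq_sq₀ (norm_nonneg _) (norm_nonneg _)]
    refine (integral_norm_toLp_sq ((memLp_inner_coherent ψ).const_mul _)).symm.trans ?_
    simp only [norm_mul, norm_inv, norm_real, Real.norm_eq_abs, mul_pow, inv_pow, sq_abs,
      Real.sq_sqrt Real.pi_pos.le]
    rw [integral_const_mul, integral_norm_sq_inner_coherent, inv_mul_cancel_left₀ Real.pi_ne_zero]

theorem coeFn_coherentTransform (ψ : Mode) : coherentTransform ψ =ᵐ[volume]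
    fun p => (Real.sqrt Real.pi : ℂ)⁻¹ * ⟪coherent ⟨p.1, p.2⟩, ψ⟫_ℂ :=
  ((memLp_inner_coherent ψ).const_mul _).coeFn_toLp

/-- The form of the coherent-state Toeplitz (anti-Wick) operator with symbol `h`, namely
`π⁻¹ h(ω) ⟨φ|ω⟩⟨ω|ψ⟩` at `ω = p.1 + i p.2`. -/
def toeplitzForm (h : ℝ × ℝ → ℂ) (p : ℝ × ℝ) (φ ψ : Mode) : ℂ :=
  h p * ((Real.pi : ℂ)⁻¹ * (⟪φ, coherent ⟨p.1, p.2⟩⟫_ℂ * ⟪coherent ⟨p.1, p.2⟩, ψ⟫_ℂ))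

/-- The coherent-state Toeplitz operator `π⁻¹ ∫ h(ω) |ω⟩⟨ω| d²ω`. -/
def toeplitz (h : ℝ × ℝ → ℂ) : Mode →L[ℂ] Mode := weakIntegral volume (toeplitzForm h)

theorem inner_coherentTransform_holder {h : ℝ × ℝ → ℂ} (hh : MemLp h ⊤) (φ ψ : Mode) :
    ⟪coherentTransform φ, (ContinuousLinearMap.mul ℂ ℂ).holder 2 (hh.toLp h)
      (coherentTransform ψ)⟫_ℂ = ∫ p, toeplitzForm h p φ ψ := by
  rw [L2.inner_def]
  refine integral_congr_ae ?_
  filter_upwards [coeFn_coherentTransform φ, coeFn_coherentTransform ψ, hh.coeFn_toLp,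
    (ContinuousLinearMap.mul ℂ ℂ).coeFn_holder (r := 2) (hh.toLp h) (coherentTransform ψ)]
    with p hφ hψ hp hmul
  have sq_sqrt_pi : (Real.sqrt Real.pi : ℂ)⁻¹ * (Real.sqrt Real.pi : ℂ)⁻¹ = (Real.pi : ℂ)⁻¹ := by
    rw [← mul_inv, ← ofReal_mul, Real.mul_self_sqrt Real.pi_pos.le]
  rw [hmul, hφ, hψ, hp, RCLike.inner_apply', ContinuousLinearMap.mul_apply', toeplitzForm,
    map_mul, map_inv₀, conj_ofReal, inner_conj_symm, ← sq_sqrt_pi]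
  ring

theorem integrable_toeplitzForm {h : ℝ × ℝ → ℂ} (hh : MemLp h ⊤) (φ ψ : Mode) :
    Integrable fun p => toeplitzForm h p φ ψ := by
  have overlaps := (memLp_inner_coherent φ).star.integrable_mul (memLp_inner_coherent ψ)
  have h1 := memLp_one_iff_integrable.1 (MemLp.mul' (r := 1)
    (memLp_one_iff_integrable.2 (overlaps.const_mul (Real.pi : ℂ)⁻¹)) hh)
  refine h1.congr (Filter.Eventually.of_forall fun p => ?_)
  simp only [toeplitzForm, Pi.mul_apply, Pi.star_apply, RCLike.star_def, inner_conj_symm]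

theorem hasWeakIntegral_toeplitz {h : ℝ × ℝ → ℂ} (hh : MemLp h ⊤) :
    HasWeakIntegral volume (toeplitzForm h) (toeplitz h) := by
  have key : HasWeakIntegral volume (toeplitzForm h)
      (ContinuousLinearMap.adjoint coherentTransform.toContinuousLinearMap ∘L
        (ContinuousLinearMap.mul ℂ ℂ).holderL volume ⊤ 2 2 (hh.toLp h) ∘L
          coherentTransform.toContinuousLinearMap) := fun φ ψ =>
    ⟨integrable_toeplitzForm hh φ ψ, by
      rw [ContinuousLinearMap.comp_apply, ContinuousLinearMap.adjoint_inner_right]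
      exact inner_coherentTransform_holder hh φ ψ⟩
  rwa [toeplitz, key.weakIntegral_eq]

theorem toeplitz_add {h k : ℝ × ℝ → ℂ} (hh : MemLp h ⊤) (hk : MemLp k ⊤) :
    toeplitz (h + k) = toeplitz h + toeplitz k := by
  refine HasWeakIntegral.unique (hasWeakIntegral_toeplitz (hh.add hk)) ?_
  convert (hasWeakIntegral_toeplitz hh).add (hasWeakIntegral_toeplitz hk) using 4
  exact add_mul _ _ _

theorem adjoint_toeplitz {h : ℝ × ℝ → ℂ} (hh : MemLp h ⊤) :
    ContinuousLinearMap.adjoint (toeplitz h) = toeplitz (star h) := by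
  refine HasWeakIntegral.unique (hasWeakIntegral_toeplitz hh).adjoint ?_
  convert hasWeakIntegral_toeplitz hh.star using 4 with p φ ψ
  simp only [toeplitzForm, star_mul', RCLike.star_def, inner_conj_symm, map_inv₀, conj_ofReal,
    Pi.star_apply]
  ring

/-- The form `k(w) ⟨φ|x-a⟩⟨x-a|w⟩⟨w|x-b⟩⟨x-b|ψ⟩` at `(w, x) = p`. -/
def posForm (k : ℝ → ℂ) (a b : ℝ) (p : ℝ × ℝ) (φ ψ : Mode) : ℂ :=
  k p.1 * posTerm p.1 (p.2 - a) (p.2 - b) φ ψ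

theorem memLp_top_comp_fst {α β E : Type*} [MeasurableSpace α] [MeasurableSpace β]
    [NormedAddCommGroup E] {m : Measure α} {n : Measure β} [SFinite n] {k : α → E}
    (hk : MemLp k ⊤ m) : MemLp (fun p : α × β => k p.1) ⊤ (m.prod n) :=
  memLp_top_of_bound_enorm hk.1.comp_fst (eLpNormEssSup k m).toNNReal <| by
    rw [ENNReal.coe_toNNReal (eLpNorm_exponent_top (f := k) ▸ hk.2.ne)]
    exact Measure.quasiMeasurePreserving_fst.ae ae_le_eLpNormEssSup

theorem integrable_posForm {k : ℝ → ℂ} (hk : MemLp k ⊤) (a b : ℝ) (φ ψ : Mode) :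
    Integrable fun p => posForm k a b p φ ψ := by
  have shift : ∀ c : ℝ, MeasurePreserving (fun p : ℝ × ℝ => (p.1, p.2 - c)) volume volume :=
    fun c => (MeasurePreserving.id volume).prod (measurePreserving_sub_right volume c)
  have hφ := ((memLp_windowed_prod φ).comp_measurePreserving (shift a)).star
  have hψ := (memLp_windowed_prod ψ).comp_measurePreserving (shift b)
  have h1 := memLp_one_iff_integrable.1 (MemLp.mul' (r := 1)
    (memLp_one_iff_integrable.2 (hφ.integrable_mul hψ))
    (memLp_top_comp_fst (n := (volume : Measure ℝ)) hk))
  refine h1.congr (Filter.Eventually.of_forall fun p => ?_)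
  simp only [posForm, posTerm_eq, Pi.mul_apply, Pi.star_apply, Function.comp_apply]

/-- The phase-plane symbol of the operator with form `posForm k a b`: a relative displacement
in position is a modulation in the conjugate variable. -/
def shiftSymbol (k : ℝ → ℂ) (a b : ℝ) (p : ℝ × ℝ) : ℂ := k p.1 * exp (2 * I * (a - b) * p.2)

theorem memLp_shiftSymbol {k : ℝ → ℂ} (hk : MemLp k ⊤) (a b : ℝ) :
    MemLp (shiftSymbol k a b) ⊤ := by
  have phase : MemLp (fun p : ℝ × ℝ => exp (2 * I * (a - b) * p.2)) ⊤ := by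
    refine memLp_top_of_bound (by fun_prop) 1 (Filter.Eventually.of_forall fun p => ?_)
    have e : 2 * I * ((a : ℂ) - b) * p.2 = ((2 * (a - b) * p.2 : ℝ) : ℂ) * I := by push_cast; ring
    rw [e, norm_exp_ofReal_mul_I]
  exact phase.mul' (memLp_top_comp_fst (n := (volume : Measure ℝ)) hk)

/- Plancherel's theorem in the imaginary part of the amplitude turns coherent-state forms into
position-space forms. -/
theorem hasWeakIntegral_posForm {k : ℝ → ℂ} (hk : MemLp k ⊤) (a b : ℝ) :
    HasWeakIntegral volume (posForm k a b) (toeplitz (shiftSymbol k a b)) := by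
  intro φ ψ
  have htoep := hasWeakIntegral_toeplitz (memLp_shiftSymbol hk a b) φ ψ
  refine ⟨integrable_posForm hk a b φ ψ, htoep.2.trans ?_⟩
  have slice : ∀ w : ℝ, ∫ t, toeplitzForm (shiftSymbol k a b) (w, t) φ ψ
      = ∫ x, posForm k a b (w, x) φ ψ := by
    intro w
    calc ∫ t, toeplitzForm (shiftSymbol k a b) (w, t) φ ψ
        = ∫ t : ℝ, (k w * (Real.pi : ℂ)⁻¹) * (exp (2 * I * (a - b) * t)
            * (⟪φ, coherent ⟨w, t⟩⟫_ℂ * ⟪coherent ⟨w, t⟩, ψ⟫_ℂ)) := by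
          congr 1 with t
          rw [toeplitzForm, shiftSymbol]
          ring
      _ = ∫ x, posForm k a b (w, x) φ ψ := by
          have hpi : (Real.pi : ℂ) ≠ 0 := ofReal_ne_zero.2 Real.pi_ne_zero
          simp only [posForm]
          rw [integral_const_mul, integral_inner_coherent_slice, integral_const_mul, mul_assoc,
            inv_mul_cancel_left₀ hpi]
  rw [Measure.volume_eq_prod, integral_prod _ htoep.1,
    integral_prod _ (integrable_posForm hk a b φ ψ)]
  exact integral_congr_ae (Filter.Eventually.of_forall slice)

/-! ### Parity and completeness of the number states -/

/-- The parity operator `(Pψ)(x) = ψ(-x)`. -/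
def parity : Mode →L[ℂ] Mode :=
  (Lp.compMeasurePreservingₗᵢ ℂ (Neg.neg : ℝ → ℝ)
    (Measure.measurePreserving_neg volume)).toContinuousLinearMap

theorem coeFn_parity (ψ : Mode) : parity ψ =ᵐ[volume] fun x => ψ (-x) :=
  Lp.coeFn_compMeasurePreserving ψ (Measure.measurePreserving_neg volume)

theorem parity_parity (ψ : Mode) : parity (parity ψ) = ψ := by
  refine Lp.ext ?_
  have h := (Measure.measurePreserving_neg (volume : Measure ℝ)).quasiMeasurePreserving.ae
    (coeFn_parity ψ)
  filter_upwards [coeFn_parity (parity ψ), h] with x hx hx'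
  rw [hx, hx', neg_neg]

theorem inner_parity_left (φ ψ : Mode) : ⟪parity φ, ψ⟫_ℂ = ⟪φ, parity ψ⟫_ℂ := by
  rw [← parity_parity ψ]
  exact (LinearIsometry.inner_map_map _ φ (parity ψ)).trans (by rw [parity_parity])

theorem parity_toLp {g k : ℝ → ℂ} (hg : MemLp g 2 volume) (hk : MemLp k 2 volume) {c : ℂ}
    (h : ∀ x, g (-x) = c * k x) : parity (hg.toLp g) = c • hk.toLp k := by
  refine Lp.ext ?_
  have hgneg := (Measure.measurePreserving_neg (volume : Measure ℝ)).quasiMeasurePreserving.ae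
    hg.coeFn_toLp
  filter_upwards [coeFn_parity (hg.toLp g), hgneg, hk.coeFn_toLp, Lp.coeFn_smul c (hk.toLp k)]
    with x hpar hx hkx hsmul
  rw [hpar, hx, hsmul, Pi.smul_apply, hkx, h, smul_eq_mul]

theorem parity_coherent (ω : ℂ) : parity (coherent ω) = coherent (-ω) := by
  refine (parity_toLp (memLp_coherentWave ω) (memLp_coherentWave (-ω)) fun x => ?_).trans
    (one_smul ℂ _)
  simp only [coherentWave, Complex.neg_re, Complex.neg_im, one_mul]
  push_cast
  ring_nf

theorem hermite_comp_neg (n : ℕ) :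
    (Polynomial.hermite n).comp (-Polynomial.X) = (-1) ^ n * Polynomial.hermite n := by
  induction n with
  | zero => simp
  | succ n ih =>
    have hderiv := congrArg Polynomial.derivative ih
    have hC : ((-1) ^ n : Polynomial ℤ) = Polynomial.C ((-1) ^ n) := by simp
    rw [Polynomial.derivative_comp, hC, Polynomial.derivative_C_mul, ← hC,
      Polynomial.derivative_neg, Polynomial.derivative_X] at hderiv
    rw [Polynomial.hermite_succ, Polynomial.sub_comp, Polynomial.mul_comp, Polynomial.X_comp, ih]
    linear_combination hderiv

theorem parity_numberState (n : ℕ) :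
    parity (numberState n) = ((-1) ^ n : ℂ) • numberState n := by
  refine parity_toLp (memLp_numberWave n) (memLp_numberWave n) fun x => ?_
  have h := congrArg (Polynomial.aeval (2 * x)) (hermite_comp_neg n)
  rw [Polynomial.aeval_comp] at h
  simp only [map_neg, Polynomial.aeval_X, map_mul, map_pow, map_one] at h
  rw [numberWave, numberWave, mul_neg, h]
  push_cast
  ring_nf

/-- The functional `p ↦ ∫ p(x) e^{-x²} h(x) dx`. -/
def gaussMoment (h : Mode) : Polynomial ℝ →ₗ[ℝ] ℂ where
  toFun p := ∫ x : ℝ, ((p.eval x * Real.exp (-x ^ 2) : ℝ) : ℂ) * h x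
  map_add' p q := by
    have integrable : ∀ p : Polynomial ℝ,
        Integrable fun x : ℝ => ((p.eval x * Real.exp (-x ^ 2) : ℝ) : ℂ) * h x := fun p =>
      ((memLp_poly_mul_gauss p).ofReal (K := ℂ)).integrable_mul (Lp.memLp h)
    rw [← integral_add (integrable p) (integrable q)]
    simp only [Polynomial.eval_add, add_mul, ofReal_add]
  map_smul' c p := by
    rw [RingHom.id_apply, ← integral_smul]
    simp only [Polynomial.eval_smul, smul_eq_mul, mul_assoc, ofReal_mul, Complex.real_smul]

/-- The polynomials `He_n(2x)`. -/
def hermiteSequence : Polynomial.Sequence ℝ where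
  elems' n := ((Polynomial.hermite n).map (Int.castRingHom ℝ)).comp
    (Polynomial.C 2 * Polynomial.X)
  degree_eq' n := by
    rw [Polynomial.degree_comp (by simp), Polynomial.degree_C_mul_X two_ne_zero, mul_one,
      (Polynomial.hermite_monic n).degree_map, Polynomial.degree_hermite]

theorem inner_numberState (n : ℕ) (h : Mode) :
    ⟪numberState n, h⟫_ℂ = ((2 / Real.pi) ^ (1 / 4 : ℝ) / Real.sqrt (n.factorial : ℝ) : ℝ)
      * gaussMoment h (hermiteSequence n) := by
  have eval_eq (x : ℝ) : (hermiteSequence n).eval x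
      = Polynomial.aeval (2 * x) (Polynomial.hermite n) := by
    simp [hermiteSequence, Polynomial.eval_comp, Polynomial.aeval_def, Polynomial.eval_map]
  refine Eq.trans ?_ (integral_const_mul _ _)
  rw [L2.inner_def]
  refine integral_congr_ae ?_
  filter_upwards [(memLp_numberWave n).coeFn_toLp] with x hx
  rw [numberState, hx, RCLike.inner_apply', numberWave, Complex.conj_ofReal, eval_eq]
  push_cast
  ring

theorem gaussMoment_eq_zero {h : Mode} (hh : ∀ n, ⟪numberState n, h⟫_ℂ = 0) :
    gaussMoment h = 0 := by
  have unit (n : ℕ) : IsUnit (hermiteSequence n).leadingCoeff :=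
    isUnit_iff_ne_zero.2 (Polynomial.leadingCoeff_ne_zero.2 (hermiteSequence.ne_zero n))
  refine (hermiteSequence.basis unit).ext fun n => ?_
  have hn := hh n
  rw [inner_numberState] at hn
  have hc : (2 / Real.pi) ^ (1 / 4 : ℝ) / Real.sqrt (n.factorial : ℝ) ≠ 0 := by positivity
  rw [Polynomial.Sequence.basis_eq_self, LinearMap.zero_apply]
  exact (mul_eq_zero.1 hn).resolve_left (ofReal_ne_zero.2 hc)

theorem memLp_exp_mul_gauss (r : ℝ) :
    MemLp (fun x : ℝ => Real.exp (r * x) * Real.exp (-x ^ 2)) 2 := by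
  have h := ((memLp_pow_mul_gauss 0).comp_measurePreserving
    (measurePreserving_sub_right volume (r / 2))).const_mul (Real.exp (r ^ 2 / 4))
  refine h.congr_norm (by fun_prop) (Filter.Eventually.of_forall fun x => ?_)
  simp only [Function.comp, pow_zero, one_mul, ← Real.exp_add]
  ring_nf

theorem memLp_exp_abs_mul_gauss (r : ℝ) :
    MemLp (fun x : ℝ => Real.exp (r * |x|) * Real.exp (-x ^ 2)) 2 := by
  refine ((memLp_exp_mul_gauss r).add (memLp_exp_mul_gauss (-r))).mono (by fun_prop)
    (Filter.Eventually.of_forall fun x => ?_)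
  rw [Pi.add_apply, ← add_mul, Real.norm_of_nonneg (by positivity),
    Real.norm_of_nonneg (by positivity)]
  gcongr
  rcases abs_choice x with hx | hx <;> rw [hx]
  · exact le_add_of_nonneg_right (Real.exp_pos _).le
  · rw [neg_mul_comm]
    exact le_add_of_nonneg_left (Real.exp_pos _).le

/- Expand `exp (z x)` in powers of `x` and integrate term by term. -/
theorem integral_exp_mul_gauss_mul_eq_zero {h : Mode} (hmoment : gaussMoment h = 0) (z : ℂ) :
    ∫ x : ℝ, exp (z * x) * ((Real.exp (-x ^ 2) : ℂ) * h x) = 0 := by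
  have hpow (n : ℕ) : ∫ x : ℝ, z ^ n / n.factorial *
      (x ^ n * ((Real.exp (-x ^ 2) : ℂ) * h x)) = 0 := by
    have hn := DFunLike.congr_fun hmoment (Polynomial.X ^ n)
    simp only [gaussMoment, LinearMap.coe_mk, AddHom.coe_mk, Polynomial.eval_pow,
      Polynomial.eval_X, LinearMap.zero_apply, ofReal_mul, ofReal_pow, mul_assoc] at hn
    rw [integral_const_mul, hn, mul_zero]
  have htsum (x : ℝ) : ∑' n : ℕ, (‖z‖ * |x|) ^ n / n.factorial * (Real.exp (-x ^ 2) * ‖h x‖)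
      = Real.exp (‖z‖ * |x|) * Real.exp (-x ^ 2) * ‖h x‖ := by
    rw [tsum_mul_right, Real.exp_eq_exp_ℝ, NormedSpace.exp_eq_tsum_div, mul_assoc]
  have hsum := hasSum_integral_of_dominated_convergence (μ := volume)
    (F := fun (n : ℕ) (x : ℝ) => z ^ n / n.factorial * (x ^ n * ((Real.exp (-x ^ 2) : ℂ) * h x)))
    (f := fun x : ℝ => exp (z * x) * ((Real.exp (-x ^ 2) : ℂ) * h x))
    (fun n x => (‖z‖ * |x|) ^ n / n.factorial * (Real.exp (-x ^ 2) * ‖h x‖))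
    (fun n => by have := Lp.aestronglyMeasurable h; fun_prop)
    (fun n => Filter.Eventually.of_forall fun x => le_of_eq ?_)
    (Filter.Eventually.of_forall fun x => (Real.summable_pow_div_factorial _).mul_right _)
    (by simp only [htsum]
        exact (memLp_exp_abs_mul_gauss ‖z‖).integrable_mul (Lp.memLp h).norm)
    (Filter.Eventually.of_forall fun x => ?_)
  · simp only [hpow] at hsum
    exact hsum.unique hasSum_zero
  · simp only [norm_mul, norm_div, norm_pow, norm_real, Real.norm_eq_abs, Real.abs_exp,
      RCLike.norm_natCast, mul_pow]
    ring
  · have hexp := (NormedSpace.expSeries_div_hasSum_exp (𝔸 := ℂ) (z * x)).mul_right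
      ((Real.exp (-x ^ 2) : ℂ) * h x)
    rw [← Complex.exp_eq_exp_ℂ] at hexp
    convert! hexp using 2 with n
    rw [mul_pow]
    ring

theorem inner_coherent_eq_zero {h : Mode} (hmoment : gaussMoment h = 0) (w t : ℝ) :
    ⟪coherent ⟨w, t⟩, h⟫_ℂ = 0 := by
  have wave (x : ℝ) : star (coherentWave ⟨w, t⟩ x) * h x
      = (((2 / Real.pi) ^ (1 / 4 : ℝ) : ℝ) * exp (-w ^ 2 + I * w * t))
        * (exp (2 * (w - I * t) * x) * ((Real.exp (-x ^ 2) : ℂ) * h x)) := by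
    have hexp : exp ((starRingEnd ℂ) (-((x : ℂ) - w) ^ 2 + 2 * I * t * x - I * w * t))
        = exp (-w ^ 2 + I * w * t) * exp (2 * (w - I * t) * x) * exp ((-x ^ 2 : ℝ) : ℂ) := by
      rw [← Complex.exp_add, ← Complex.exp_add]
      simp only [map_sub, map_mul, map_add, map_neg, map_pow, Complex.conj_I,
        Complex.conj_ofReal, map_ofNat]
      push_cast
      ring_nf
    rw [coherentWave, RCLike.star_def, map_mul, Complex.conj_ofReal, ← Complex.exp_conj, hexp,
      Complex.ofReal_exp]
    ring
  rw [inner_coherent_eq_integral]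
  simp only [wave]
  rw [integral_const_mul, integral_exp_mul_gauss_mul_eq_zero hmoment, mul_zero]

theorem eq_zero_of_inner_numberState {h : Mode} (hh : ∀ n, ⟪numberState n, h⟫_ℂ = 0) :
    h = 0 := by
  have hnorm := (integral_norm_sq_inner_coherent h).symm
  simp only [inner_coherent_eq_zero (gaussMoment_eq_zero hh), norm_zero, ne_eq,
    OfNat.ofNat_ne_zero, not_false_eq_true, zero_pow, integral_zero, mul_eq_zero,
    Real.pi_ne_zero, false_or, pow_eq_zero_iff, norm_eq_zero] at hnorm
  exact hnorm

/-- The closed span of the photon-number states of the parity of `δ`, for `δ = 0, 1`. -/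
abbrev numberSpan (δ : ℕ) : Submodule ℂ Mode :=
  (Submodule.span ℂ (Set.range fun k : ℕ => numberState (2 * k + δ))).topologicalClosure

theorem numberState_mem_numberSpan (δ k : ℕ) : numberState (2 * k + δ) ∈ numberSpan δ :=
  Submodule.le_topologicalClosure _ (Submodule.subset_span ⟨k, rfl⟩)

theorem parity_of_mem_numberSpan {δ : ℕ} {v : Mode} (hv : v ∈ numberSpan δ) :
    parity v = ((-1) ^ δ : ℂ) • v := by
  have hle : numberSpan δ ≤ (parity - ((-1) ^ δ : ℂ) • (1 : Mode →L[ℂ] Mode)).ker := by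
    refine Submodule.topologicalClosure_minimal _ ?_ (ContinuousLinearMap.isClosed_ker
      (parity - ((-1) ^ δ : ℂ) • (1 : Mode →L[ℂ] Mode)))
    rw [Submodule.span_le]
    rintro _ ⟨k, rfl⟩
    simp [parity_numberState, pow_add, pow_mul]
  simpa [sub_eq_zero] using hle hv

theorem add_parity_eq_zero_of_mem_orthogonal {δ : ℕ} (hδ : δ < 2) {h : Mode}
    (hh : h ∈ (numberSpan δ)ᗮ) : h + ((-1) ^ δ : ℂ) • parity h = 0 := by
  refine eq_zero_of_inner_numberState fun n => ?_
  rw [inner_add_right, inner_smul_right, ← inner_parity_left, parity_numberState,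
    inner_smul_left, map_pow, map_neg, map_one, ← mul_assoc, ← pow_add, ← one_add_mul]
  rcases Nat.even_or_odd (δ + n) with ⟨r, hr⟩ | hodd
  · have hn : n = 2 * (n / 2) + δ := by lia
    have hzero := (Submodule.mem_orthogonal _ _).1 hh _ (numberState_mem_numberSpan δ (n / 2))
    rw [← hn] at hzero
    rw [hzero, mul_zero]
  · rw [hodd.neg_one_pow, add_neg_cancel, zero_mul]

theorem mem_numberSpan_iff {δ : ℕ} (hδ : δ < 2) {v : Mode} :
    v ∈ numberSpan δ ↔ parity v = ((-1) ^ δ : ℂ) • v := by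
  refine ⟨parity_of_mem_numberSpan, fun hv => ?_⟩
  rw [← Submodule.orthogonal_orthogonal (numberSpan δ), Submodule.mem_orthogonal]
  intro h hh
  have hzero : ⟪h + ((-1) ^ δ : ℂ) • parity h, v⟫_ℂ = 0 := by
    rw [add_parity_eq_zero_of_mem_orthogonal hδ hh, inner_zero_left]
  rw [inner_add_left, inner_smul_left, inner_parity_left, hv, inner_smul_right, map_pow, map_neg,
    map_one, ← mul_assoc, ← mul_pow, neg_one_mul, neg_neg, one_pow, one_mul] at hzero
  exact self_eq_neg.1 (eq_neg_of_add_eq_zero_left hzero)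

theorem starProjection_numberSpan {δ : ℕ} (hδ : δ < 2) (ψ : Mode) :
    (numberSpan δ).starProjection ψ = (2⁻¹ : ℂ) • (ψ + ((-1) ^ δ : ℂ) • parity ψ) := by
  have hsq : ((-1) ^ δ : ℂ) * (-1) ^ δ = 1 := by rw [← mul_pow, neg_one_mul, neg_neg, one_pow]
  refine Submodule.eq_starProjection_of_mem_of_inner_eq_zero ?_ fun v hv => ?_
  · rw [mem_numberSpan_iff hδ, map_smul, map_add, map_smul, parity_parity, smul_comm,
      smul_add ((-1) ^ δ : ℂ) ψ, smul_smul, hsq, one_smul, add_comm]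
  · rw [inner_sub_left, inner_smul_left, inner_add_left, inner_smul_left, inner_parity_left,
      parity_of_mem_numberSpan hv, inner_smul_right, map_pow, map_neg, map_one, ← mul_assoc, hsq,
      map_inv₀, map_ofNat]
    ring

theorem evProj_apply (ψ : Mode) : evProj ψ = (2⁻¹ : ℂ) • (ψ + parity ψ) := by
  have h := starProjection_numberSpan zero_lt_two ψ
  rwa [pow_zero, one_smul] at h

theorem odProj_apply (ψ : Mode) : odProj ψ = (2⁻¹ : ℂ) • (ψ - parity ψ) := by
  have h := starProjection_numberSpan one_lt_two ψ
  rwa [pow_one, neg_one_smul, ← sub_eq_add_neg] at h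

/-! ### The blocks as compressed Toeplitz operators -/

theorem parity_odProj (φ : Mode) : parity (odProj φ) = -odProj φ := by
  rw [odProj_apply, map_smul, map_sub, parity_parity, ← smul_neg, neg_sub]

theorem parity_evProj (φ : Mode) : parity (evProj φ) = evProj φ := by
  rw [evProj_apply, map_smul, map_add, parity_parity, add_comm]

theorem odProj_odProj (φ : Mode) : odProj (odProj φ) = odProj φ := by
  rw [odProj_apply (odProj φ), parity_odProj, sub_neg_eq_add, ← two_smul ℂ, smul_smul,
    inv_mul_cancel₀ two_ne_zero, one_smul]

theorem evProj_evProj (φ : Mode) : evProj (evProj φ) = evProj φ := by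
  rw [evProj_apply (evProj φ), parity_evProj, ← two_smul ℂ, smul_smul,
    inv_mul_cancel₀ two_ne_zero, one_smul]

theorem adjoint_odProj : ContinuousLinearMap.adjoint odProj = odProj :=
  isSelfAdjoint_starProjection _

theorem adjoint_evProj : ContinuousLinearMap.adjoint evProj = evProj :=
  isSelfAdjoint_starProjection _

theorem inner_odProj_left (φ ψ : Mode) : ⟪odProj φ, ψ⟫_ℂ = ⟪φ, odProj ψ⟫_ℂ :=
  Submodule.inner_starProjection_left_eq_right _ φ ψ

theorem inner_evProj_left (φ ψ : Mode) : ⟪evProj φ, ψ⟫_ℂ = ⟪φ, evProj ψ⟫_ℂ :=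
  Submodule.inner_starProjection_left_eq_right _ φ ψ

theorem odProj_add_evProj (φ : Mode) : odProj φ + evProj φ = φ := by
  rw [odProj_apply, evProj_apply, ← smul_add, sub_add_add_cancel, ← two_smul ℂ, smul_smul,
    inv_mul_cancel₀ two_ne_zero, one_smul]

theorem norm_sq_eq_odProj_add_evProj (φ : Mode) :
    ‖φ‖ ^ 2 = ‖odProj φ‖ ^ 2 + ‖evProj φ‖ ^ 2 := by
  have horth : ⟪odProj φ, evProj φ⟫_ℂ = 0 := by
    have h := inner_parity_left (odProj φ) (evProj φ)
    rw [parity_odProj, parity_evProj, inner_neg_left] at h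
    exact self_eq_neg.1 h.symm
  have hpyth := norm_add_sq_eq_norm_sq_add_norm_sq_of_inner_eq_zero (𝕜 := ℂ) _ _ horth
  rwa [odProj_add_evProj, ← sq, ← sq, ← sq] at hpyth

section Blocks

variable {μ β : ℝ} {f : ℝ → ℝ}

@[fun_prop]
theorem measurable_theta (μ β : ℝ) : Measurable (theta μ β) := by
  unfold theta
  fun_prop

theorem theta_neg (μ β w : ℝ) : theta μ β (-w) = -theta μ β w := by
  rw [theta, theta, ← Real.arctan_neg, ← mul_neg, ← Real.sinh_neg, mul_neg (2 * β)]

/-- The symbol `cos θ(w) cos(2βt)` by which the diagonal blocks deviate from `f(w)`. -/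
def diagSymbol (μ β : ℝ) (p : ℝ × ℝ) : ℝ := Real.cos (theta μ β p.1) * Real.cos (2 * β * p.2)

/-- The symbol `s sin θ(w) + i cos θ(w) sin(2βt)` of the off-diagonal blocks, before
multiplication by `f(w)`. -/
def offSymbol (μ β s : ℝ) (p : ℝ × ℝ) : ℂ :=
  ((s * Real.sin (theta μ β p.1) : ℝ) : ℂ)
    + ((Real.cos (theta μ β p.1) * Real.sin (2 * β * p.2) : ℝ) : ℂ) * I

/-- The Toeplitz symbol of `M_oo`. -/
def ooSymbol (μ β : ℝ) (f : ℝ → ℝ) (p : ℝ × ℝ) : ℂ := ((f p.1 * (1 + diagSymbol μ β p) : ℝ) : ℂ)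

/-- The Toeplitz symbol of `M_ee`. -/
def eeSymbol (μ β : ℝ) (f : ℝ → ℝ) (p : ℝ × ℝ) : ℂ := ((f p.1 * (1 - diagSymbol μ β p) : ℝ) : ℂ)

/-- The Toeplitz symbol of `M_oe`. -/
def oeSymbol (μ β : ℝ) (f : ℝ → ℝ) (s : ℝ) (p : ℝ × ℝ) : ℂ := f p.1 * offSymbol μ β s p

/-- The symbol of the operator whose kernel is `k` on the diagonal `y = x`, and `k₁`, `k₂` on the
two shifted diagonals `(x, x - β)`, `(x - β, x)`. -/
def blockSymbol (β : ℝ) (k k₁ k₂ : ℝ → ℂ) : ℝ × ℝ → ℂ :=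
  shiftSymbol k 0 0 + (shiftSymbol k₁ 0 β + shiftSymbol k₂ β 0)

theorem blockSymbol_apply (β : ℝ) (k k₁ k₂ : ℝ → ℂ) (w t : ℝ) :
    blockSymbol β k k₁ k₂ (w, t) = k w + ((k₁ w + k₂ w) * Real.cos (2 * β * t)
      - (k₁ w - k₂ w) * (Real.sin (2 * β * t) * I)) := by
  have hneg : 2 * I * ((0 : ℝ) - (β : ℂ)) * t = ((-(2 * β * t) : ℝ) : ℂ) * I := by
    push_cast; ring
  have hpos : 2 * I * ((β : ℂ) - (0 : ℝ)) * t = ((2 * β * t : ℝ) : ℂ) * I := by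
    push_cast; ring
  simp only [blockSymbol, Pi.add_apply, shiftSymbol]
  rw [sub_self, mul_zero, zero_mul, exp_zero, mul_one, hneg, hpos, exp_mul_I, exp_mul_I,
    ← ofReal_cos, ← ofReal_sin, ← ofReal_cos, ← ofReal_sin, Real.cos_neg, Real.sin_neg]
  push_cast
  ring

theorem memLp_blockSymbol {k k₁ k₂ : ℝ → ℂ} (hk : MemLp k ⊤) (hk₁ : MemLp k₁ ⊤)
    (hk₂ : MemLp k₂ ⊤) : MemLp (blockSymbol β k k₁ k₂) ⊤ :=
  (memLp_shiftSymbol hk 0 0).add ((memLp_shiftSymbol hk₁ 0 β).add (memLp_shiftSymbol hk₂ β 0))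

theorem hasWeakIntegral_blockSymbol {k k₁ k₂ : ℝ → ℂ} (hk : MemLp k ⊤) (hk₁ : MemLp k₁ ⊤)
    (hk₂ : MemLp k₂ ⊤) :
    HasWeakIntegral volume (fun p φ ψ => posForm k 0 0 p φ ψ
      + (posForm k₁ 0 β p φ ψ + posForm k₂ β 0 p φ ψ)) (toeplitz (blockSymbol β k k₁ k₂)) := by
  have h₁ := memLp_shiftSymbol hk₁ 0 β
  have h₂ := memLp_shiftSymbol hk₂ β 0
  rw [blockSymbol, toeplitz_add (memLp_shiftSymbol hk 0 0) (h₁.add h₂), toeplitz_add h₁ h₂]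
  exact (hasWeakIntegral_posForm hk 0 0).add
    ((hasWeakIntegral_posForm hk₁ 0 β).add (hasWeakIntegral_posForm hk₂ β 0))

theorem memLp_ofReal_mul (hf : MemLp f ⊤) {g : ℝ → ℝ} (hg : Measurable g) {C : ℝ}
    (hC : ∀ w, |g w| ≤ C) : MemLp (fun w => (f w : ℂ) * g w) ⊤ :=
  MemLp.mul' (memLp_top_of_bound (by fun_prop) C
    (Filter.Eventually.of_forall fun w => by rw [norm_real]; exact hC w)) hf.ofReal

/-- The weight `f(w) cos θ(w) / 2` of the shifted diagonals in the three blocks. -/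
def cosWeight (μ β : ℝ) (f : ℝ → ℝ) (w : ℝ) : ℂ := f w * (Real.cos (theta μ β w) / 2 : ℝ)

/-- The weight `s f(w) sin θ(w)` of the diagonal in the off-diagonal block. -/
def sinWeight (μ β : ℝ) (f : ℝ → ℝ) (s w : ℝ) : ℂ := f w * (s * Real.sin (theta μ β w) : ℝ)

theorem memLp_cosWeight (μ β : ℝ) (hf : MemLp f ⊤) : MemLp (cosWeight μ β f) ⊤ :=
  memLp_ofReal_mul hf (by fun_prop) (C := 2⁻¹) fun w => by
    rw [abs_div, abs_two, div_eq_inv_mul]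
    exact mul_le_of_le_one_right (by positivity) (Real.abs_cos_le_one _)

theorem memLp_sinWeight (μ β : ℝ) (hf : MemLp f ⊤) (s : ℝ) : MemLp (sinWeight μ β f s) ⊤ :=
  memLp_ofReal_mul hf (by fun_prop) (C := |s|) fun w => by
    rw [abs_mul]
    exact mul_le_of_le_one_right (abs_nonneg s) (Real.abs_sin_le_one _)

theorem blockSymbol_eq_ooSymbol (μ β : ℝ) (f : ℝ → ℝ) :
    blockSymbol β (fun w => f w) (cosWeight μ β f) (cosWeight μ β f) = ooSymbol μ β f := by
  ext ⟨w, t⟩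
  rw [blockSymbol_apply, cosWeight, ooSymbol, diagSymbol]
  push_cast
  ring

theorem blockSymbol_eq_eeSymbol (μ β : ℝ) (f : ℝ → ℝ) :
    blockSymbol β (fun w => f w) (-cosWeight μ β f) (-cosWeight μ β f) = eeSymbol μ β f := by
  ext ⟨w, t⟩
  rw [blockSymbol_apply, Pi.neg_apply, cosWeight, eeSymbol, diagSymbol]
  push_cast
  ring

theorem blockSymbol_eq_oeSymbol (μ β : ℝ) (f : ℝ → ℝ) (s : ℝ) :
    blockSymbol β (sinWeight μ β f s) (-cosWeight μ β f) (cosWeight μ β f) = oeSymbol μ β f s := by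
  ext ⟨w, t⟩
  rw [blockSymbol_apply, Pi.neg_apply, sinWeight, cosWeight, oeSymbol, offSymbol]
  push_cast
  ring

theorem memLp_ooSymbol (hf : MemLp f ⊤) : MemLp (ooSymbol μ β f) ⊤ := by
  rw [← blockSymbol_eq_ooSymbol]
  exact memLp_blockSymbol hf.ofReal (memLp_cosWeight μ β hf) (memLp_cosWeight μ β hf)

theorem memLp_eeSymbol (hf : MemLp f ⊤) : MemLp (eeSymbol μ β f) ⊤ := by
  rw [← blockSymbol_eq_eeSymbol]
  exact memLp_blockSymbol hf.ofReal (memLp_cosWeight μ β hf).neg (memLp_cosWeight μ β hf).neg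

theorem memLp_oeSymbol (hf : MemLp f ⊤) (s : ℝ) : MemLp (oeSymbol μ β f s) ⊤ := by
  rw [← blockSymbol_eq_oeSymbol]
  exact memLp_blockSymbol (memLp_sinWeight μ β hf s) (memLp_cosWeight μ β hf).neg
    (memLp_cosWeight μ β hf)

theorem hasWeakIntegral_ooForm (hf : MemLp f ⊤) : HasWeakIntegral volume (ooForm μ β f)
    (odProj ∘L toeplitz (ooSymbol μ β f) ∘L odProj) := by
  have hfc : MemLp (fun w => (f w : ℂ)) ⊤ := hf.ofReal
  have h := (hasWeakIntegral_blockSymbol (β := β) hfc (memLp_cosWeight μ β hf)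
    (memLp_cosWeight μ β hf)).comp odProj odProj
  rw [adjoint_odProj, blockSymbol_eq_ooSymbol] at h
  convert h using 4 with p φ ψ
  simp only [ooForm, posForm, cosWeight, sub_zero]
  push_cast
  ring

theorem hasWeakIntegral_eeForm (hf : MemLp f ⊤) : HasWeakIntegral volume (eeForm μ β f)
    (evProj ∘L toeplitz (eeSymbol μ β f) ∘L evProj) := by
  have hfc : MemLp (fun w => (f w : ℂ)) ⊤ := hf.ofReal
  have h := (hasWeakIntegral_blockSymbol (β := β) hfc (memLp_cosWeight μ β hf).neg
    (memLp_cosWeight μ β hf).neg).comp evProj evProj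
  rw [adjoint_evProj, blockSymbol_eq_eeSymbol] at h
  convert h using 4 with p φ ψ
  simp only [eeForm, posForm, cosWeight, sub_zero, Pi.neg_apply]
  push_cast
  ring

theorem hasWeakIntegral_oeForm (hf : MemLp f ⊤) (s : ℝ) : HasWeakIntegral volume (oeForm μ β f s)
    (odProj ∘L toeplitz (oeSymbol μ β f s) ∘L evProj) := by
  have h := (hasWeakIntegral_blockSymbol (β := β) (memLp_sinWeight μ β hf s)
    (memLp_cosWeight μ β hf).neg (memLp_cosWeight μ β hf)).comp odProj evProj
  rw [adjoint_odProj, blockSymbol_eq_oeSymbol] at h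
  convert h using 4 with p φ ψ
  simp only [oeForm, posForm, sinWeight, cosWeight, sub_zero, Pi.neg_apply]
  push_cast
  ring

theorem Moo_eq (hf : MemLp f ⊤) : Moo μ β f = odProj ∘L toeplitz (ooSymbol μ β f) ∘L odProj :=
  (hasWeakIntegral_ooForm hf).weakIntegral_eq

theorem Mee_eq (hf : MemLp f ⊤) : Mee μ β f = evProj ∘L toeplitz (eeSymbol μ β f) ∘L evProj :=
  (hasWeakIntegral_eeForm hf).weakIntegral_eq

theorem Moe_eq (hf : MemLp f ⊤) (s : ℝ) :
    Moe μ β f s = odProj ∘L toeplitz (oeSymbol μ β f s) ∘L evProj :=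
  (hasWeakIntegral_oeForm hf s).weakIntegral_eq

theorem isSelfAdjoint_Moo (hf : MemLp f ⊤) : IsSelfAdjoint (Moo μ β f) := by
  have hreal : star (ooSymbol μ β f) = ooSymbol μ β f := funext fun _ => conj_ofReal _
  rw [ContinuousLinearMap.isSelfAdjoint_iff', Moo_eq hf, ContinuousLinearMap.adjoint_comp,
    ContinuousLinearMap.adjoint_comp, adjoint_odProj, adjoint_toeplitz (memLp_ooSymbol hf), hreal]
  rfl

theorem isSelfAdjoint_Mee (hf : MemLp f ⊤) : IsSelfAdjoint (Mee μ β f) := by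
  have hreal : star (eeSymbol μ β f) = eeSymbol μ β f := funext fun _ => conj_ofReal _
  rw [ContinuousLinearMap.isSelfAdjoint_iff', Mee_eq hf, ContinuousLinearMap.adjoint_comp,
    ContinuousLinearMap.adjoint_comp, adjoint_evProj, adjoint_toeplitz (memLp_eeSymbol hf), hreal]
  rfl

theorem Moo_odProj (hf : MemLp f ⊤) (ψ : Mode) : Moo μ β f (odProj ψ) = Moo μ β f ψ := by
  simp only [Moo_eq hf, ContinuousLinearMap.comp_apply, odProj_odProj]

theorem Mee_evProj (hf : MemLp f ⊤) (ψ : Mode) : Mee μ β f (evProj ψ) = Mee μ β f ψ := by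
  simp only [Mee_eq hf, ContinuousLinearMap.comp_apply, evProj_evProj]

theorem Moe_evProj (hf : MemLp f ⊤) (s : ℝ) (ψ : Mode) :
    Moe μ β f s (evProj ψ) = Moe μ β f s ψ := by
  simp only [Moe_eq hf, ContinuousLinearMap.comp_apply, evProj_evProj]

theorem Meo_odProj (hf : MemLp f ⊤) (s : ℝ) (ψ : Mode) :
    Meo μ β f s (odProj ψ) = Meo μ β f s ψ := by
  simp only [Meo, Moe_eq hf, ContinuousLinearMap.adjoint_comp, adjoint_odProj,
    ContinuousLinearMap.comp_apply, odProj_odProj]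

theorem inner_Moo_odProj (hf : MemLp f ⊤) (φ ψ : Mode) :
    ⟪odProj φ, Moo μ β f (odProj ψ)⟫_ℂ = ⟪φ, Moo μ β f ψ⟫_ℂ := by
  simp only [Moo_eq hf, ContinuousLinearMap.comp_apply, odProj_odProj, inner_odProj_left]

theorem inner_Mee_evProj (hf : MemLp f ⊤) (φ ψ : Mode) :
    ⟪evProj φ, Mee μ β f (evProj ψ)⟫_ℂ = ⟪φ, Mee μ β f ψ⟫_ℂ := by
  simp only [Mee_eq hf, ContinuousLinearMap.comp_apply, evProj_evProj, inner_evProj_left]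

theorem inner_Moe_proj (hf : MemLp f ⊤) (s : ℝ) (φ ψ : Mode) :
    ⟪odProj φ, Moe μ β f s (evProj ψ)⟫_ℂ = ⟪φ, Moe μ β f s ψ⟫_ℂ := by
  simp only [Moe_eq hf, ContinuousLinearMap.comp_apply, odProj_odProj, evProj_evProj,
    inner_odProj_left]

/-! ### The norm bound on a sector -/

/-- The quadratic form of the self-adjoint block operator `[A, B; B†, D]` on the pair `(φ, ψ)`. -/
def blockQuad {H : Type*} [NormedAddCommGroup H] [InnerProductSpace ℂ H] (A B D : H →L[ℂ] H)
    (φ ψ : H) : ℝ :=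
  (⟪φ, A φ⟫_ℂ).re + (⟪ψ, D ψ⟫_ℂ).re + 2 * (⟪φ, B ψ⟫_ℂ).re

/-- The quadratic form of the symbol matrix `[1 + g, z; z̄, 1 - g]`, with `g = diagSymbol` and
`z = offSymbol`, on the pair of phase-plane amplitudes `(⟨ω|φ⟩, ⟨ω|ψ⟩)`. -/
def sectorDensity (μ β s : ℝ) (φ ψ : Mode) (p : ℝ × ℝ) : ℝ :=
  (1 + diagSymbol μ β p) * ‖⟪coherent ⟨p.1, p.2⟩, φ⟫_ℂ‖ ^ 2
    + (1 - diagSymbol μ β p) * ‖⟪coherent ⟨p.1, p.2⟩, ψ⟫_ℂ‖ ^ 2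
    + 2 * (offSymbol μ β s p * ((starRingEnd ℂ) ⟪coherent ⟨p.1, p.2⟩, φ⟫_ℂ
        * ⟪coherent ⟨p.1, p.2⟩, ψ⟫_ℂ)).re

theorem abs_diagSymbol_le_one (μ β : ℝ) (p : ℝ × ℝ) : |diagSymbol μ β p| ≤ 1 := by
  rw [diagSymbol, abs_mul]
  exact mul_le_one₀ (Real.abs_cos_le_one _) (abs_nonneg _) (Real.abs_cos_le_one _)

theorem norm_offSymbol_sq {s : ℝ} (hs : s ^ 2 = 1) (p : ℝ × ℝ) :
    ‖offSymbol μ β s p‖ ^ 2 = 1 - diagSymbol μ β p ^ 2 := by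
  rw [offSymbol, ← normSq_eq_norm_sq, normSq_add_mul_I, diagSymbol, mul_pow, mul_pow, mul_pow, hs,
    Real.sin_sq, Real.sin_sq]
  ring

theorem abs_two_mul_re_le {g : ℝ} (hg : |g| ≤ 1) {z x y : ℂ} (hz : ‖z‖ ^ 2 = 1 - g ^ 2) :
    |2 * (z * ((starRingEnd ℂ) x * y)).re| ≤ (1 + g) * ‖x‖ ^ 2 + (1 - g) * ‖y‖ ^ 2 := by
  obtain ⟨hneg, hpos⟩ := abs_le.1 hg
  have hfactor : ‖z‖ = Real.sqrt (1 + g) * Real.sqrt (1 - g) := by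
    rw [← Real.sqrt_mul (by linarith), ← Real.sqrt_sq (norm_nonneg z), hz]
    congr 1
    ring
  calc |2 * (z * ((starRingEnd ℂ) x * y)).re|
      ≤ 2 * ‖z * ((starRingEnd ℂ) x * y)‖ := by
        rw [abs_mul, abs_two]
        gcongr
        exact abs_re_le_norm _
    _ = 2 * (Real.sqrt (1 + g) * ‖x‖) * (Real.sqrt (1 - g) * ‖y‖) := by
        rw [norm_mul, norm_mul, RCLike.norm_conj, hfactor]
        ring
    _ ≤ (Real.sqrt (1 + g) * ‖x‖) ^ 2 + (Real.sqrt (1 - g) * ‖y‖) ^ 2 := two_mul_le_add_sq _ _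
    _ = (1 + g) * ‖x‖ ^ 2 + (1 - g) * ‖y‖ ^ 2 := by
        rw [mul_pow, mul_pow, Real.sq_sqrt (by linarith), Real.sq_sqrt (by linarith)]

/- The symbol matrix has trace `2` and determinant `0`, hence eigenvalues `0` and `2`. -/
theorem sectorDensity_mem_Icc {s : ℝ} (hs : s ^ 2 = 1) (φ ψ : Mode) (p : ℝ × ℝ) :
    sectorDensity μ β s φ ψ p ∈ Set.Icc 0
      (2 * (‖⟪coherent ⟨p.1, p.2⟩, φ⟫_ℂ‖ ^ 2 + ‖⟪coherent ⟨p.1, p.2⟩, ψ⟫_ℂ‖ ^ 2)) := by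
  have hg := abs_diagSymbol_le_one μ β p
  have hz := norm_offSymbol_sq (μ := μ) (β := β) hs p
  have hlower := (abs_le.1 (abs_two_mul_re_le hg (x := ⟪coherent ⟨p.1, p.2⟩, φ⟫_ℂ)
    (y := ⟪coherent ⟨p.1, p.2⟩, ψ⟫_ℂ) hz)).1
  have hupper := (abs_le.1 (abs_two_mul_re_le (g := -diagSymbol μ β p) (by rwa [abs_neg])
    (x := ⟪coherent ⟨p.1, p.2⟩, φ⟫_ℂ) (y := ⟪coherent ⟨p.1, p.2⟩, ψ⟫_ℂ) (by rwa [neg_sq]))).2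
  unfold sectorDensity
  constructor <;> linarith

theorem inner_coherent_neg (w t : ℝ) (φ : Mode) :
    ⟪coherent ⟨-w, -t⟩, φ⟫_ℂ = ⟪coherent ⟨w, t⟩, parity φ⟫_ℂ := by
  rw [← inner_parity_left, parity_coherent]
  rfl

theorem sectorDensity_neg (s : ℝ) {φ ψ : Mode} (hφ : parity φ = -φ) (hψ : parity ψ = ψ)
    (p : ℝ × ℝ) : sectorDensity μ β s φ ψ (-p) = sectorDensity μ β s φ ψ p := by
  simp only [sectorDensity, diagSymbol, offSymbol, Prod.fst_neg, Prod.snd_neg, theta_neg,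
    Real.cos_neg, Real.sin_neg, mul_neg, inner_coherent_neg, hφ, hψ, inner_neg_right, norm_neg,
    map_neg]
  congr 3
  push_cast
  ring

theorem integrable_norm_sq_inner_coherent (φ : Mode) :
    Integrable fun p : ℝ × ℝ => ‖⟪coherent ⟨p.1, p.2⟩, φ⟫_ℂ‖ ^ 2 :=
  (memLp_inner_coherent φ).integrable_norm_pow two_ne_zero

theorem sectorDensity_eq_re_toeplitzForm (s : ℝ) (φ ψ : Mode) (p : ℝ × ℝ) :
    f p.1 / Real.pi * sectorDensity μ β s φ ψ p = (toeplitzForm (ooSymbol μ β f) p φ φ).re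
      + (toeplitzForm (eeSymbol μ β f) p ψ ψ).re
      + 2 * (toeplitzForm (oeSymbol μ β f s) p φ ψ).re := by
  have hpi : (Real.pi : ℂ)⁻¹ = ((Real.pi⁻¹ : ℝ) : ℂ) := (ofReal_inv _).symm
  simp only [toeplitzForm, ooSymbol, eeSymbol, oeSymbol, sectorDensity,
    ← inner_conj_symm _ (coherent _), conj_mul', hpi]
  rw [← ofReal_pow, ← ofReal_pow, ← ofReal_mul, ← ofReal_mul, ← ofReal_mul, ← ofReal_mul, ofReal_re,
    ofReal_re, mul_assoc (f p.1 : ℂ), re_ofReal_mul,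
    mul_left_comm (offSymbol μ β s p) ((Real.pi⁻¹ : ℝ) : ℂ), re_ofReal_mul]
  ring

theorem blockQuad_eq_integral (hf : MemLp f ⊤) (s : ℝ) (φ ψ : Mode) :
    Integrable (fun p : ℝ × ℝ => f p.1 / Real.pi
        * sectorDensity μ β s (odProj φ) (evProj ψ) p) ∧
      blockQuad (Moo μ β f) (Moe μ β f s) (Mee μ β f) φ ψ
        = ∫ p : ℝ × ℝ, f p.1 / Real.pi * sectorDensity μ β s (odProj φ) (evProj ψ) p := by
  obtain ⟨ioo, eoo⟩ := hasWeakIntegral_toeplitz (memLp_ooSymbol (μ := μ) (β := β) hf)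
    (odProj φ) (odProj φ)
  obtain ⟨iee, eee⟩ := hasWeakIntegral_toeplitz (memLp_eeSymbol (μ := μ) (β := β) hf)
    (evProj ψ) (evProj ψ)
  obtain ⟨ioe, eoe⟩ := hasWeakIntegral_toeplitz (memLp_oeSymbol (μ := μ) (β := β) hf s)
    (odProj φ) (evProj ψ)
  have idiag := ioo.re.add iee.re
  have ioff := ioe.re.const_mul 2
  simp_rw [sectorDensity_eq_re_toeplitzForm]
  refine ⟨idiag.add ioff, ?_⟩
  refine Eq.trans ?_ (integral_add idiag ioff).symm
  simp only [Pi.add_apply]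
  rw [integral_const_mul, integral_add ioo.re iee.re, integral_re ioo, integral_re iee,
    integral_re ioe, ← eoo, ← eee, ← eoe, blockQuad, Moo_eq hf, Mee_eq hf, Moe_eq hf]
  simp only [ContinuousLinearMap.comp_apply, inner_odProj_left, inner_evProj_left]
  rfl

/- The density is even under `ω ↦ -ω`, so `f(w)` may be replaced by `(f(w) + f(-w)) / 2 ≤ 1 / 2`. -/
theorem blockQuad_le (hf : MemLp f ⊤) (hf_sum : ∀ x, f x + f (-x) ≤ 1) {s : ℝ} (hs : s ^ 2 = 1)
    (φ ψ : Mode) :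
    blockQuad (Moo μ β f) (Moe μ β f s) (Mee μ β f) φ ψ ≤ ‖odProj φ‖ ^ 2 + ‖evProj ψ‖ ^ 2 := by
  obtain ⟨hint, heq⟩ := blockQuad_eq_integral (μ := μ) (β := β) hf s φ ψ
  set D := sectorDensity μ β s (odProj φ) (evProj ψ)
  have hDneg : ∀ p, D (-p) = D p := sectorDensity_neg s (parity_odProj φ) (parity_evProj ψ)
  have hint_neg := hint.comp_neg
  have heq_neg := integral_neg_eq_self (fun p : ℝ × ℝ => f p.1 / Real.pi * D p) volume
  simp only [hDneg, Prod.fst_neg] at hint_neg heq_neg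
  have iodd := integrable_norm_sq_inner_coherent (odProj φ)
  have ieven := integrable_norm_sq_inner_coherent (evProj ψ)
  have hdouble : 2 * blockQuad (Moo μ β f) (Moe μ β f s) (Mee μ β f) φ ψ
      ≤ 2 * (‖odProj φ‖ ^ 2 + ‖evProj ψ‖ ^ 2) :=
    calc 2 * blockQuad (Moo μ β f) (Moe μ β f s) (Mee μ β f) φ ψ
        = ∫ p : ℝ × ℝ, (f p.1 / Real.pi * D p + f (-p.1) / Real.pi * D p) := by
          rw [integral_add hint hint_neg, heq_neg, ← heq, two_mul]
      _ ≤ ∫ p : ℝ × ℝ, Real.pi⁻¹ * 2 * (‖⟪coherent ⟨p.1, p.2⟩, odProj φ⟫_ℂ‖ ^ 2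
            + ‖⟪coherent ⟨p.1, p.2⟩, evProj ψ⟫_ℂ‖ ^ 2) := by
          refine integral_mono (hint.add hint_neg) ((iodd.add ieven).const_mul _) fun p => ?_
          obtain ⟨hD0, hD2⟩ := sectorDensity_mem_Icc (μ := μ) (β := β) hs (odProj φ) (evProj ψ) p
          calc f p.1 / Real.pi * D p + f (-p.1) / Real.pi * D p
              = Real.pi⁻¹ * ((f p.1 + f (-p.1)) * D p) := by ring
            _ ≤ Real.pi⁻¹ * (1 * D p) := by gcongr; exact hf_sum _
            _ ≤ _ := by rw [one_mul, mul_assoc]; gcongr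
      _ = 2 * (‖odProj φ‖ ^ 2 + ‖evProj ψ‖ ^ 2) := by
          rw [integral_const_mul, integral_add iodd ieven, integral_norm_sq_inner_coherent,
            integral_norm_sq_inner_coherent]
          field_simp
  linarith

end Blocks

/-! ### The twisting unitary -/

/-- The reflection `sin θ Z + cos θ X`. -/
def reflection (θ : ℝ) : Matrix (Fin 2) (Fin 2) ℂ :=
  !![(Real.sin θ : ℂ), (Real.cos θ : ℂ); (Real.cos θ : ℂ), -(Real.sin θ : ℂ)]

section Spectral

variable {u v : Fin 2 → ℂ} {T : Matrix (Fin 2) (Fin 2) ℂ} {l m : ℝ}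

theorem proj_add_proj_eq_one (hu : star u ⬝ᵥ u = 1) (hv : star v ⬝ᵥ v = 1)
    (huv : star u ⬝ᵥ v = 0) : proj u + proj v = 1 := by
  have hvu : star v ⬝ᵥ u = 0 := by rw [Matrix.star_dotProduct, huv, star_zero]
  have hisometry : Matrix.of ![star u, star v] * (Matrix.of ![u, v]).transpose = 1 := by
    ext i j
    fin_cases i <;> fin_cases j
    exacts [hu, huv, hvu, hv]
  rw [mul_eq_one_comm] at hisometry
  rw [← hisometry]
  ext i j
  simp only [proj, Matrix.add_apply, Matrix.vecMulVec_apply, Matrix.mul_apply, Fin.sum_univ_two]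
  rfl

theorem dotProduct_eq_zero_of_eigenvectors (hT : T.IsHermitian) (hu : T.mulVec u = (l : ℂ) • u)
    (hv : T.mulVec v = (m : ℂ) • v) (hlm : l ≠ m) : star u ⬝ᵥ v = 0 := by
  have heq : (l : ℂ) * (star u ⬝ᵥ v) = m * (star u ⬝ᵥ v) :=
    calc (l : ℂ) * (star u ⬝ᵥ v) = star (T.mulVec u) ⬝ᵥ v := by
          rw [hu, star_smul, smul_dotProduct, smul_eq_mul, RCLike.star_def, conj_ofReal]
      _ = star u ⬝ᵥ T.mulVec v := by
          rw [Matrix.star_mulVec, hT.eq, Matrix.dotProduct_mulVec]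
      _ = m * (star u ⬝ᵥ v) := by rw [hv, dotProduct_smul, smul_eq_mul]
  exact (mul_eq_mul_right_iff.1 heq).resolve_left (ofReal_injective.ne hlm)

theorem sub_smul_proj_sub_proj (hproj : proj u + proj v = 1) (hu : T.mulVec u = (l : ℂ) • u)
    (hv : T.mulVec v = (m : ℂ) • v) :
    ((l : ℂ) - m) • (proj u - proj v) = (2 : ℂ) • T - ((l : ℂ) + m) • 1 := by
  have hT : T = (l : ℂ) • proj u + (m : ℂ) • proj v := by
    rw [← mul_one T, ← hproj, mul_add, proj, proj, Matrix.mul_vecMulVec, Matrix.mul_vecMulVec, hu,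
      hv, Matrix.smul_vecMulVec, Matrix.smul_vecMulVec]
  rw [hT, ← hproj]
  module

theorem trace_proj (hu : star u ⬝ᵥ u = 1) : (proj u).trace = 1 := by
  rw [proj, Matrix.trace_vecMulVec, dotProduct_comm, hu]

theorem proj_sub_proj_mul_self (hu : star u ⬝ᵥ u = 1) (hv : star v ⬝ᵥ v = 1)
    (huv : star u ⬝ᵥ v = 0) : (proj u - proj v) * (proj u - proj v) = 1 := by
  have hvu : star v ⬝ᵥ u = 0 := by rw [Matrix.star_dotProduct, huv, star_zero]
  rw [← proj_add_proj_eq_one hu hv huv]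
  simp only [proj, sub_mul, mul_sub, Matrix.vecMulVec_mul_vecMulVec, hu, hv, huv, hvu, one_smul,
    zero_smul]
  simp

theorem reflection_mul_self (θ : ℝ) : reflection θ * reflection θ = 1 := by
  have hsq : (Real.sin θ : ℂ) * Real.sin θ + Real.cos θ * Real.cos θ = 1 := by
    rw [← sq, ← sq]
    exact_mod_cast Real.sin_sq_add_cos_sq θ
  rw [reflection, Matrix.mul_fin_two, Matrix.one_fin_two, neg_mul_neg, hsq,
    add_comm (_ * _) ((Real.sin θ : ℂ) * Real.sin θ), hsq]
  simp only [neg_mul, mul_comm (Real.cos θ : ℂ), add_neg_cancel]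

theorem sqrt_smul_reflection_arctan (X : ℝ) :
    (Real.sqrt (1 + X ^ 2) : ℂ) • reflection (Real.arctan X) = !![(X : ℂ), 1; 1, -(X : ℂ)] := by
  have hsin : Real.sqrt (1 + X ^ 2) * Real.sin (Real.arctan X) = X := by
    rw [Real.sin_arctan, mul_div_cancel₀ _ (by positivity)]
  have hcos : Real.sqrt (1 + X ^ 2) * Real.cos (Real.arctan X) = 1 := by
    rw [Real.cos_arctan, mul_div_cancel₀ _ (by positivity)]
  simp only [reflection, Matrix.smul_of, Matrix.smul_cons, Matrix.smul_empty, smul_eq_mul, mul_neg]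
  simp only [← ofReal_mul, hsin, hcos, ofReal_one]

theorem two_smul_sub_trace_smul_one {p c q X : ℝ} (hpq : p - q = 2 * c * X) :
    (2 : ℂ) • !![(p : ℂ), c; c, q] - ((p : ℂ) + q) • (1 : Matrix (Fin 2) (Fin 2) ℂ)
      = ((2 * c * Real.sqrt (1 + X ^ 2) : ℝ) : ℂ) • reflection (Real.arctan X) := by
  have hpqC : (p : ℂ) - q = 2 * c * X := by exact_mod_cast hpq
  rw [ofReal_mul, mul_smul, sqrt_smul_reflection_arctan]
  ext i j
  fin_cases i <;> fin_cases j <;>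
    simp only [Fin.zero_eta, Fin.mk_one, Fin.isValue, Matrix.sub_apply, Matrix.smul_apply,
      smul_eq_mul, Matrix.of_apply, Matrix.cons_val', Matrix.cons_val_zero,
      Matrix.cons_val_one, Matrix.cons_val_fin_one, Matrix.one_fin_two, ofReal_mul,
      ofReal_ofNat] <;>
    first
    | ring1
    | linear_combination hpqC
    | linear_combination -hpqC

/- `2T - tr T` is `2c [X, 1; 1, -X]` and also `(l - m)` times the difference of the spectral
projections; squaring gives `l - m = 2c √(1 + X²)`. -/
theorem proj_sub_proj_eq_reflection {p c q X : ℝ} (hc : 0 < c) (hpq : p - q = 2 * c * X)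
    (hu : star u ⬝ᵥ u = 1) (hv : star v ⬝ᵥ v = 1) (hl : 0 < l) (hm : m < 0)
    (hul : Matrix.mulVec !![(p : ℂ), c; c, q] u = (l : ℂ) • u)
    (hvm : Matrix.mulVec !![(p : ℂ), c; c, q] v = (m : ℂ) • v) :
    proj u - proj v = reflection (Real.arctan X) := by
  have hT : (!![(p : ℂ), c; c, q] : Matrix (Fin 2) (Fin 2) ℂ).IsHermitian := by
    ext i j
    fin_cases i <;> fin_cases j <;> simp
  have huv := dotProduct_eq_zero_of_eigenvectors hT hul hvm (by linarith)
  have hspec := sub_smul_proj_sub_proj (proj_add_proj_eq_one hu hv huv) hul hvm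
  have hsq := proj_sub_proj_mul_self hu hv huv
  have htrace := congrArg Matrix.trace hspec
  set W := proj u - proj v with hW
  have hlm : (l : ℂ) + m = p + q := by
    rw [Matrix.trace_smul, hW, Matrix.trace_sub, trace_proj hu, trace_proj hv, sub_self, smul_zero,
      Matrix.trace_sub, Matrix.trace_smul, Matrix.trace_smul, Matrix.trace_one,
      Matrix.trace_fin_two_of, Fintype.card_fin, smul_eq_mul, smul_eq_mul] at htrace
    push_cast at htrace
    linear_combination htrace / 2
  have hsmul : ((l - m : ℝ) : ℂ) • W
      = ((2 * c * Real.sqrt (1 + X ^ 2) : ℝ) : ℂ) • reflection (Real.arctan X) := by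
    rw [ofReal_sub, hspec, hlm, two_smul_sub_trace_smul_one hpq]
  have hnorm : l - m = 2 * c * Real.sqrt (1 + X ^ 2) := by
    have hsq_smul := congrArg (fun A => A * A) hsmul
    simp only [smul_mul_smul_comm, hsq, reflection_mul_self] at hsq_smul
    have hsq_eq : (l - m) * (l - m)
        = 2 * c * Real.sqrt (1 + X ^ 2) * (2 * c * Real.sqrt (1 + X ^ 2)) := by
      have hentry := congrFun (congrFun hsq_smul 0) 0
      simp only [Matrix.smul_apply, Matrix.one_apply_eq, smul_eq_mul, mul_one] at hentry
      exact_mod_cast hentry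
    exact (mul_self_inj (by linarith) (by positivity)).1 hsq_eq
  rw [hnorm] at hsmul
  exact smul_right_injective _ (ofReal_ne_zero.2 (by positivity)) hsmul

end Spectral

section Twist

variable {μ β w : ℝ}

theorem gaussianPDFReal_eq (β w : ℝ) :
    gaussianPDFReal β (1 / 2) w = Real.sqrt (gaussianPDFReal β (1 / 2) w) *
      Real.sqrt (gaussianPDFReal (-β) (1 / 2) w) * Real.exp (2 * β * w) := by
  have hprod : gaussianPDFReal β (1 / 2) w * gaussianPDFReal (-β) (1 / 2) w
      = (gaussianPDFReal β (1 / 2) w * Real.exp (-(2 * β * w))) ^ 2 := by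
    simp only [gaussianPDFReal]
    rw [mul_mul_mul_comm, ← Real.exp_add, mul_assoc _ (Real.exp _) (Real.exp _), ← Real.exp_add,
      mul_pow, ← Real.exp_nat_mul, sq (Real.sqrt _)⁻¹]
    congr 2
    push_cast
    ring
  rw [← Real.sqrt_mul (gaussianPDFReal_nonneg _ _ _), hprod,
    Real.sqrt_sq (mul_nonneg (gaussianPDFReal_nonneg _ _ _) (Real.exp_pos _).le), mul_assoc,
    ← Real.exp_add, neg_add_cancel, Real.exp_zero, mul_one]

theorem gaussianPDFReal_sub_neg (β w : ℝ) :
    gaussianPDFReal β (1 / 2) w - gaussianPDFReal (-β) (1 / 2) w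
      = 2 * (Real.sqrt (gaussianPDFReal β (1 / 2) w) * Real.sqrt (gaussianPDFReal (-β) (1 / 2) w))
        * Real.sinh (2 * β * w) := by
  have hneg := gaussianPDFReal_eq (-β) w
  rw [neg_neg, mul_neg, neg_mul, mul_comm (Real.sqrt _) (Real.sqrt _)] at hneg
  rw [Real.sinh_eq]
  linear_combination gaussianPDFReal_eq β w - hneg

theorem inv_sqrt_two_mul_self : (Real.sqrt 2 : ℂ)⁻¹ * (Real.sqrt 2 : ℂ)⁻¹ = 2⁻¹ := by
  rw [← mul_inv, ← ofReal_mul, Real.mul_self_sqrt zero_le_two, ofReal_ofNat]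

theorem tau01_apply (μ β w : ℝ) (i j : Fin 2) :
    tau01 μ β w i j = 2⁻¹ * ((1 - qErr μ β : ℝ) * proj (gaussKet β 1 w) i j
      - qErr μ β * proj (gaussKet β (-1) w) i j) := by
  have hplus : proj ketP 0 1 = 2⁻¹ := by
    simp [proj, Matrix.vecMulVec_apply, ketP, inv_sqrt_two_mul_self]
  have hminus : proj ketM 0 1 = -2⁻¹ := by
    simp [proj, Matrix.vecMulVec_apply, ketM, inv_sqrt_two_mul_self]
  simp only [tau01, tauAB, Matrix.of_apply, Matrix.add_apply, Matrix.smul_apply,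
    Matrix.kroneckerMap_apply, smul_eq_mul, hplus, hminus]
  ring

theorem tau01_eq (μ β w : ℝ) : tau01 μ β w =
    !![((Real.exp (-2 * (μ - β ^ 2)) * (Real.sqrt (gaussianPDFReal β (1 / 2) w)
          * Real.sqrt (gaussianPDFReal β (1 / 2) w)) / 2 : ℝ) : ℂ),
        ((Real.sqrt (gaussianPDFReal β (1 / 2) w)
          * Real.sqrt (gaussianPDFReal (-β) (1 / 2) w) / 2 : ℝ) : ℂ);
      ((Real.sqrt (gaussianPDFReal β (1 / 2) w)
          * Real.sqrt (gaussianPDFReal (-β) (1 / 2) w) / 2 : ℝ) : ℂ),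
        ((Real.exp (-2 * (μ - β ^ 2)) * (Real.sqrt (gaussianPDFReal (-β) (1 / 2) w)
          * Real.sqrt (gaussianPDFReal (-β) (1 / 2) w)) / 2 : ℝ) : ℂ)] := by
  ext i j
  rw [tau01_apply, proj, proj, Matrix.vecMulVec_apply, Matrix.vecMulVec_apply]
  fin_cases i <;> fin_cases j <;> simp [gaussKet, qErr] <;> ring

theorem twistW_eq {up um : ℝ → Fin 2 → ℂ} (hup : IsPosEigenvector (tau01 μ β w) (up w))
    (hum : IsNegEigenvector (tau01 μ β w) (um w)) :
    twistW up um w = reflection (theta μ β w) := by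
  obtain ⟨hu, l, hl, hul⟩ := hup
  obtain ⟨hv, m, hm, hvm⟩ := hum
  rw [tau01_eq] at hul hvm
  have hpos (b : ℝ) : 0 < Real.sqrt (gaussianPDFReal b (1 / 2) w) :=
    Real.sqrt_pos.2 (gaussianPDFReal_pos _ _ _ (by norm_num))
  refine proj_sub_proj_eq_reflection (half_pos (mul_pos (hpos β) (hpos (-β)))) ?_ hu hv hl hm
    hul hvm
  rw [Real.mul_self_sqrt (gaussianPDFReal_nonneg _ _ _),
    Real.mul_self_sqrt (gaussianPDFReal_nonneg _ _ _)]
  linear_combination Real.exp (-2 * (μ - β ^ 2)) / 2 * gaussianPDFReal_sub_neg β w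

end Twist

/-! ### The phase-error operator -/

/-- The operator `(⟨0| + s⟨1|)/√2` on Alice's qubit: `⟨+|` for `s = 1` and `⟨-|` for `s = -1`. -/
def braA (s : ℝ) : WithA Mode →L[ℂ] Mode :=
  (Real.sqrt 2 : ℂ)⁻¹ • (PiLp.proj 2 (fun _ : Fin 2 => Mode) 0
    + (s : ℂ) • PiLp.proj 2 (fun _ : Fin 2 => Mode) 1)

theorem braA_apply (s : ℝ) (Ψ : WithA Mode) :
    braA s Ψ = (Real.sqrt 2 : ℂ)⁻¹ • (Ψ 0 + (s : ℂ) • Ψ 1) := rfl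

theorem projB_ket0_zero (v : Qubit) : projB ket0 v 0 = v 0 := by
  simp [projB, ket0, PiLp.inner_apply]

theorem projB_ket0_one (v : Qubit) : projB ket0 v 1 = 0 := by
  simp [projB, ket0]

theorem projB_ket1_zero (v : Qubit) : projB ket1 v 0 = 0 := by
  simp [projB, ket1]

theorem projB_ket1_one (v : Qubit) : projB ket1 v 1 = v 1 := by
  simp [projB, ket1, PiLp.inner_apply]

theorem inner_ketM (v : Qubit) :
    ⟪(WithLp.toLp 2 ketM : Qubit), v⟫_ℂ = (Real.sqrt 2 : ℂ)⁻¹ * (v 0 - v 1) := by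
  rw [PiLp.inner_apply, Fin.sum_univ_two]
  simp only [ketM, RCLike.inner_apply, Matrix.cons_val_zero, Matrix.cons_val_one, one_div, map_neg,
    map_inv₀, conj_ofReal]
  ring

theorem inner_ketM_ctrlV (β : ℝ) (up um : ℝ → Fin 2 → ℂ) (ω : ℂ) (ψ : WithA Qubit) :
    (fun i => ⟪(WithLp.toLp 2 ketM : Qubit), ctrlV β up um ω ψ i⟫_ℂ) = (Real.sqrt 2 : ℂ)⁻¹ •
      ((rotZ (2 * ω.im * β)).conjTranspose.mulVec ![ψ 0 0, ψ 1 0]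
        - (twistW up um ω.re * (rotZ (2 * ω.im * β)).conjTranspose).mulVec ![ψ 1 1, ψ 0 1]) := by
  ext i
  rw [inner_ketM, ctrlV]
  fin_cases i <;>
    simp [tens_apply, cX, pauliX, projB_ket0_zero, projB_ket0_one, projB_ket1_zero,
      projB_ket1_one, Matrix.one_apply]

theorem Ksuc_zero (f : ℝ → ℝ) (ω : ℂ) (ψ : Mode) :
    Ksuc f ω ψ 0 = (Real.sqrt (f ω.re / Real.pi) : ℂ) * ⟪coherent ω, ψ⟫_ℂ := by
  simp [Ksuc, ket0, ket1]

theorem Ksuc_one (f : ℝ → ℝ) (ω : ℂ) (ψ : Mode) :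
    Ksuc f ω ψ 1 = (Real.sqrt (f ω.re / Real.pi) : ℂ) * ⟪coherent ω, parity ψ⟫_ℂ := by
  rw [← inner_parity_left, parity_coherent]
  simp [Ksuc, ket0, ket1]

theorem rotZ_conjTranspose (t β : ℝ) : (rotZ (2 * t * β)).conjTranspose
    = !![exp (I * β * t), 0; 0, exp (-(I * β * t))] := by
  ext i j
  fin_cases i <;> fin_cases j <;>
    simp [rotZ, ← exp_conj, show (starRingEnd ℂ) 2 = 2 from map_ofNat _ 2] <;> ring_nf

/-- The amplitude `⟨-|_B V(ω) K(ω)` applied to a vector of `AC`; it takes values in `A`. -/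
def errorAmp (β : ℝ) (f : ℝ → ℝ) (up um : ℝ → Fin 2 → ℂ) (ω : ℂ) (Ψ : WithA Mode) : Fin 2 → ℂ :=
  fun i => ⟪(WithLp.toLp 2 ketM : Qubit), ctrlV β up um ω (tens 1 (Ksuc f ω) Ψ) i⟫_ℂ

theorem tens_one_apply {H K : Type*} [NormedAddCommGroup H] [InnerProductSpace ℂ H]
    [NormedAddCommGroup K] [InnerProductSpace ℂ K] (T : H →L[ℂ] K) (Ψ : WithA H) (i : Fin 2) :
    tens 1 T Ψ i = T (Ψ i) := by
  simp [tens_apply, Matrix.one_apply]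

theorem phForm_eq_dotProduct (β : ℝ) (f : ℝ → ℝ) (up um : ℝ → Fin 2 → ℂ) (p : ℝ × ℝ)
    (Φ Ψ : WithA Mode) : phForm β f up um p Φ Ψ
      = star (errorAmp β f up um ⟨p.1, p.2⟩ Φ) ⬝ᵥ errorAmp β f up um ⟨p.1, p.2⟩ Ψ := by
  unfold phForm phaseErrorDensity errorAmp
  generalize ctrlV β up um ⟨p.1, p.2⟩ = V
  generalize Ksuc f ⟨p.1, p.2⟩ = K
  rw [ContinuousLinearMap.comp_apply, ContinuousLinearMap.adjoint_inner_right, PiLp.inner_apply]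
  refine Finset.sum_congr rfl fun i _ => ?_
  rw [ContinuousLinearMap.comp_apply, ContinuousLinearMap.comp_apply,
    ContinuousLinearMap.comp_apply, tens_one_apply, projB, InnerProductSpace.rankOne_apply,
    inner_smul_right, mul_comm, ← inner_conj_symm _ (WithLp.toLp 2 ketM)]
  rfl

/-- The amplitude of the sector `s` at `θ` and `t`, when the odd part of `⟨s|_A` has the overlap
`x`, and the even part of `⟨-s|_A` the overlap `y`, with the coherent state. -/
def sectorAmp (β θ t s : ℝ) (x y : ℂ) : Fin 2 → ℂ :=
  let E := exp (I * β * t)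
  let F := exp (-(I * β * t))
  ![x * (E + s * Real.sin θ * E + Real.cos θ * F) + y * (E + s * Real.sin θ * E - Real.cos θ * F),
    s * (x * (F + Real.cos θ * E - s * Real.sin θ * F)
      + y * (Real.cos θ * E - F + s * Real.sin θ * F))]

theorem errorAmp_eq {β : ℝ} {up um : ℝ → Fin 2 → ℂ} {ω : ℂ} {θ : ℝ} (f : ℝ → ℝ)
    (hW : twistW up um ω.re = reflection θ) (Ψ : WithA Mode) :
    errorAmp β f up um ω Ψ = (2⁻¹ * Real.sqrt (f ω.re / Real.pi) : ℂ) •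
      (sectorAmp β θ ω.im 1 ⟪coherent ω, odProj (braA 1 Ψ)⟫_ℂ
          ⟪coherent ω, evProj (braA (-1) Ψ)⟫_ℂ
        + sectorAmp β θ ω.im (-1) ⟪coherent ω, odProj (braA (-1) Ψ)⟫_ℂ
          ⟪coherent ω, evProj (braA 1 Ψ)⟫_ℂ) := by
  unfold errorAmp
  rw [inner_ketM_ctrlV, hW, rotZ_conjTranspose]
  simp only [tens_one_apply, Ksuc_zero, Ksuc_one, odProj_apply, evProj_apply, braA_apply]
  ext i
  fin_cases i <;>
  · simp [reflection, sectorAmp, inner_smul_right, inner_add_right, inner_sub_right]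
    ring

theorem star_sectorAmp_zero (β θ t s : ℝ) (x y : ℂ) :
    (starRingEnd ℂ) (sectorAmp β θ t s x y 0)
      = (starRingEnd ℂ) x * (exp (-(I * β * t)) + s * Real.sin θ * exp (-(I * β * t))
          + Real.cos θ * exp (I * β * t))
        + (starRingEnd ℂ) y * (exp (-(I * β * t)) + s * Real.sin θ * exp (-(I * β * t))
          - Real.cos θ * exp (I * β * t)) := by
  simp [sectorAmp, ← exp_conj, -ofReal_sin, -ofReal_cos]

theorem star_sectorAmp_one (β θ t s : ℝ) (x y : ℂ) :
    (starRingEnd ℂ) (sectorAmp β θ t s x y 1)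
      = s * ((starRingEnd ℂ) x * (exp (I * β * t) + Real.cos θ * exp (-(I * β * t))
          - s * Real.sin θ * exp (I * β * t))
        + (starRingEnd ℂ) y * (Real.cos θ * exp (-(I * β * t)) - exp (I * β * t)
          + s * Real.sin θ * exp (I * β * t))) := by
  simp [sectorAmp, ← exp_conj, -ofReal_sin, -ofReal_cos]

theorem star_sectorAmp_dotProduct_neg {s : ℝ} (hs : s ^ 2 = 1) (β θ t : ℝ) (X Y x y : ℂ) :
    star (sectorAmp β θ t s X Y) ⬝ᵥ sectorAmp β θ t (-s) x y = 0 := by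
  have htrig : (Real.sin θ : ℂ) ^ 2 + (Real.cos θ : ℂ) ^ 2 = 1 := by
    exact_mod_cast Real.sin_sq_add_cos_sq θ
  rw [dotProduct, Fin.sum_univ_two, Pi.star_apply, Pi.star_apply, RCLike.star_def,
    star_sectorAmp_zero, star_sectorAmp_one]
  simp only [sectorAmp, ofReal_neg, Matrix.cons_val_zero, Matrix.cons_val_one]
  rcases mul_self_eq_one_iff.1 ((sq s).symm.trans hs) with rfl | rfl <;>
    simp only [ofReal_neg, ofReal_one] <;>
    linear_combination -(2 * exp (I * β * t) * exp (-(I * β * t))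
      * ((starRingEnd ℂ) X * y + (starRingEnd ℂ) Y * x)) * htrig

theorem star_sectorAmp_dotProduct {s : ℝ} (hs : s ^ 2 = 1) (μ β : ℝ) (p : ℝ × ℝ) (X Y x y : ℂ) :
    star (sectorAmp β (theta μ β p.1) p.2 s X Y) ⬝ᵥ sectorAmp β (theta μ β p.1) p.2 s x y
      = 4 * ((1 + diagSymbol μ β p : ℝ) * ((starRingEnd ℂ) X * x)
        + (1 - diagSymbol μ β p : ℝ) * ((starRingEnd ℂ) Y * y)
        + (offSymbol μ β s p * ((starRingEnd ℂ) X * y)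
          + (starRingEnd ℂ) (offSymbol μ β s p) * ((starRingEnd ℂ) Y * x))) := by
  have hexp : exp (I * β * p.2) * exp (-(I * β * p.2)) = 1 := by
    rw [← exp_add, add_neg_cancel, exp_zero]
  have htrig : (Real.sin (theta μ β p.1) : ℂ) ^ 2 + (Real.cos (theta μ β p.1) : ℂ) ^ 2 = 1 := by
    exact_mod_cast Real.sin_sq_add_cos_sq _
  have hcos : (exp (I * β * p.2) ^ 2 + exp (-(I * β * p.2)) ^ 2) / 2 = cos (2 * β * p.2) := by
    rw [← cosh_mul_I, cosh, ← exp_nat_mul, ← exp_nat_mul]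
    push_cast
    ring_nf
  have hsin : (exp (I * β * p.2) ^ 2 - exp (-(I * β * p.2)) ^ 2) / 2 = sin (2 * β * p.2) * I := by
    rw [← sinh_mul_I, sinh, ← exp_nat_mul, ← exp_nat_mul]
    push_cast
    ring_nf
  rw [dotProduct, Fin.sum_univ_two, Pi.star_apply, Pi.star_apply, RCLike.star_def,
    star_sectorAmp_zero, star_sectorAmp_one]
  simp only [sectorAmp, diagSymbol, offSymbol, Matrix.cons_val_zero, Matrix.cons_val_one, map_add,
    map_mul, conj_ofReal, conj_I]
  generalize Real.sin (theta μ β p.1) = S at *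
  generalize Real.cos (theta μ β p.1) = C at *
  generalize exp (I * β * p.2) = E at *
  generalize exp (-(I * β * p.2)) = F at *
  rcases mul_self_eq_one_iff.1 ((sq s).symm.trans hs) with rfl | rfl
  all_goals
    push_cast
    set X' := (starRingEnd ℂ) X
    set Y' := (starRingEnd ℂ) Y
  · linear_combination (2 * (1 + S ^ 2 + C ^ 2) * (X' * x + Y' * y)
        + 4 * S * (X' * y + Y' * x)) * hexp + 2 * (X' * x + Y' * y) * htrig
      + 4 * C * (X' * x - Y' * y) * hcos + 4 * C * (X' * y - Y' * x) * hsin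
  · linear_combination (2 * (1 + S ^ 2 + C ^ 2) * (X' * x + Y' * y)
        - 4 * S * (X' * y + Y' * x)) * hexp + 2 * (X' * x + Y' * y) * htrig
      + 4 * C * (X' * x - Y' * y) * hcos + 4 * C * (X' * y - Y' * x) * hsin

/-- The form, in the amplitude of the coherent states, of the sector in which `⟨s|_A` carries the
odd photon numbers and `⟨-s|_A` the even ones. -/
def sectorForm (μ β : ℝ) (f : ℝ → ℝ) (s : ℝ) (p : ℝ × ℝ) (Φ Ψ : WithA Mode) : ℂ :=
  (toeplitzForm (ooSymbol μ β f) p (odProj (braA s Φ)) (odProj (braA s Ψ))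
    + toeplitzForm (eeSymbol μ β f) p (evProj (braA (-s) Φ)) (evProj (braA (-s) Ψ)))
  + (toeplitzForm (oeSymbol μ β f s) p (odProj (braA s Φ)) (evProj (braA (-s) Ψ))
    + star (toeplitzForm (oeSymbol μ β f s) p (odProj (braA s Ψ)) (evProj (braA (-s) Φ))))

theorem sectorForm_eq {s : ℝ} (hs : s ^ 2 = 1) (μ β : ℝ) (f : ℝ → ℝ) (p : ℝ × ℝ)
    (Φ Ψ : WithA Mode) : sectorForm μ β f s p Φ Ψ = (4⁻¹ * (f p.1 / Real.pi : ℝ) : ℂ)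
      * (star (sectorAmp β (theta μ β p.1) p.2 s ⟪coherent ⟨p.1, p.2⟩, odProj (braA s Φ)⟫_ℂ
            ⟪coherent ⟨p.1, p.2⟩, evProj (braA (-s) Φ)⟫_ℂ)
        ⬝ᵥ sectorAmp β (theta μ β p.1) p.2 s ⟪coherent ⟨p.1, p.2⟩, odProj (braA s Ψ)⟫_ℂ
            ⟪coherent ⟨p.1, p.2⟩, evProj (braA (-s) Ψ)⟫_ℂ) := by
  rw [star_sectorAmp_dotProduct hs]
  simp only [sectorForm, toeplitzForm, ooSymbol, eeSymbol, oeSymbol, RCLike.star_def, map_mul,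
    map_inv₀, conj_ofReal, inner_conj_symm]
  push_cast
  ring

theorem phForm_eq_sectorForm {μ β : ℝ} {f : ℝ → ℝ} {up um : ℝ → Fin 2 → ℂ}
    (hf : ∀ x, 0 ≤ f x) (hW : ∀ w, twistW up um w = reflection (theta μ β w)) (p : ℝ × ℝ)
    (Φ Ψ : WithA Mode) : phForm β f up um p Φ Ψ
      = sectorForm μ β f 1 p Φ Ψ + sectorForm μ β f (-1) p Φ Ψ := by
  have hsqrt : (Real.sqrt (f p.1 / Real.pi) : ℂ) * Real.sqrt (f p.1 / Real.pi)
      = (f p.1 / Real.pi : ℝ) := by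
    rw [← ofReal_mul, Real.mul_self_sqrt (div_nonneg (hf _) Real.pi_pos.le)]
  have cross := star_sectorAmp_dotProduct_neg (s := 1) (by norm_num) β (theta μ β p.1) p.2
  have cross' := star_sectorAmp_dotProduct_neg (s := -1) (by norm_num) β (theta μ β p.1) p.2
  rw [neg_neg] at cross'
  rw [phForm_eq_dotProduct, errorAmp_eq f (hW p.1), errorAmp_eq f (hW p.1),
    sectorForm_eq (by norm_num), sectorForm_eq (by norm_num), neg_neg, star_smul, smul_dotProduct,
    dotProduct_smul, star_add, add_dotProduct, dotProduct_add, dotProduct_add, cross, cross',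
    add_zero, zero_add, ← hsqrt]
  simp only [smul_eq_mul, RCLike.star_def, map_mul, map_inv₀, map_ofNat, conj_ofReal]
  ring

/-- The part of `M_ph^het` living on the sector selected by `s`. -/
def sectorOp (μ β : ℝ) (f : ℝ → ℝ) (s : ℝ) : WithA Mode →L[ℂ] WithA Mode :=
  (ContinuousLinearMap.adjoint (braA s) ∘L Moo μ β f ∘L braA s
    + ContinuousLinearMap.adjoint (braA (-s)) ∘L Mee μ β f ∘L braA (-s))
  + (ContinuousLinearMap.adjoint (braA s) ∘L Moe μ β f s ∘L braA (-s)
    + ContinuousLinearMap.adjoint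
        (ContinuousLinearMap.adjoint (braA s) ∘L Moe μ β f s ∘L braA (-s)))

theorem hasWeakIntegral_sectorForm {μ β : ℝ} {f : ℝ → ℝ} (hf : MemLp f ⊤) (s : ℝ) :
    HasWeakIntegral volume (sectorForm μ β f s) (sectorOp μ β f s) := by
  have oo := (hasWeakIntegral_toeplitz (memLp_ooSymbol (μ := μ) (β := β) hf)).comp odProj odProj
  have ee := (hasWeakIntegral_toeplitz (memLp_eeSymbol (μ := μ) (β := β) hf)).comp evProj evProj
  have oe := (hasWeakIntegral_toeplitz (memLp_oeSymbol (μ := μ) (β := β) hf s)).comp odProj evProj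
  rw [adjoint_odProj, ← Moo_eq hf] at oo
  rw [adjoint_evProj, ← Mee_eq hf] at ee
  rw [adjoint_odProj, ← Moe_eq hf] at oe
  have oe' := oe.comp (braA s) (braA (-s))
  exact ((oo.comp _ _).add (ee.comp _ _)).add (oe'.add oe'.adjoint)

theorem hasWeakIntegral_phForm {μ β : ℝ} {f : ℝ → ℝ} {up um : ℝ → Fin 2 → ℂ} (hf : MemLp f ⊤)
    (hf_nonneg : ∀ x, 0 ≤ f x) (hW : ∀ w, twistW up um w = reflection (theta μ β w)) :
    HasWeakIntegral volume (phForm β f up um) (sectorOp μ β f 1 + sectorOp μ β f (-1)) := by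
  have h := (hasWeakIntegral_sectorForm (μ := μ) (β := β) hf 1).add
    (hasWeakIntegral_sectorForm (μ := μ) (β := β) hf (-1))
  rwa [show phForm β f up um = _ from funext fun p => funext fun Φ => funext fun Ψ =>
    phForm_eq_sectorForm hf_nonneg hW p Φ Ψ]

/-! ### The largest eigenvalue of a Hermitian matrix -/

theorem star_dotProduct_self {n : Type*} [Fintype n] (z : n → ℂ) :
    star z ⬝ᵥ z = ((∑ i, ‖z i‖ ^ 2 : ℝ) : ℂ) := by
  simp only [dotProduct, Pi.star_apply, RCLike.star_def, conj_mul', ofReal_sum, ofReal_pow]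

section SigmaSup

variable {n : Type*} [Fintype n] [DecidableEq n] {A : Matrix n n ℂ}

theorem bddAbove_spectrum (hA : A.IsHermitian) : BddAbove (spectrum ℝ A) := by
  rw [hA.spectrum_real_eq_range_eigenvalues]
  exact (Set.finite_range _).bddAbove

open scoped ComplexOrder MatrixOrder in
theorem le_algebraMap_iff_re_dotProduct_le (hA : A.IsHermitian) (c : ℝ) :
    A ≤ algebraMap ℝ (Matrix n n ℂ) c ↔
      ∀ z : n → ℂ, (star z ⬝ᵥ A.mulVec z).re ≤ c * ∑ i, ‖z i‖ ^ 2 := by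
  have hB : (algebraMap ℝ (Matrix n n ℂ) c - A).IsHermitian :=
    (IsSelfAdjoint.algebraMap _ (IsSelfAdjoint.all c)).sub hA
  have hform : ∀ z : n → ℂ, (star z ⬝ᵥ (algebraMap ℝ (Matrix n n ℂ) c - A).mulVec z).re
      = c * ∑ i, ‖z i‖ ^ 2 - (star z ⬝ᵥ A.mulVec z).re := fun z => by
    rw [Matrix.sub_mulVec, dotProduct_sub, Algebra.algebraMap_eq_smul_one, Matrix.smul_mulVec,
      Matrix.one_mulVec, dotProduct_smul, star_dotProduct_self, sub_re, smul_re, ofReal_re,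
      smul_eq_mul]
  rw [Matrix.le_iff, Matrix.posSemidef_iff_dotProduct_mulVec]
  refine ⟨fun h z => ?_, fun h => ⟨hB, fun z => ?_⟩⟩
  · rw [← sub_nonneg, ← hform]
    exact (Complex.le_def.1 (h.2 z)).1
  · refine Complex.le_def.2 ⟨?_, ?_⟩
    · rw [hform]
      exact sub_nonneg.2 (h z)
    · exact (hB.im_star_dotProduct_mulVec_self z).symm

open scoped ComplexOrder MatrixOrder Matrix.Norms.L2Operator in
theorem sigmaSup_le_iff [Nonempty n] (hA : A.IsHermitian) {c : ℝ} :
    sigmaSup A ≤ c ↔ ∀ z : n → ℂ, (star z ⬝ᵥ A.mulVec z).re ≤ c * ∑ i, ‖z i‖ ^ 2 := by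
  have hne : (spectrum ℝ A).Nonempty := by
    rw [hA.spectrum_real_eq_range_eigenvalues]
    exact Set.range_nonempty _
  rw [← le_algebraMap_iff_re_dotProduct_le hA,
    le_algebraMap_iff_spectrum_le (ha := hA.isSelfAdjoint), sigmaSup,
    csSup_le_iff (bddAbove_spectrum hA) hne]

theorem re_dotProduct_le_sigmaSup [Nonempty n] (hA : A.IsHermitian) (z : n → ℂ) :
    (star z ⬝ᵥ A.mulVec z).re ≤ sigmaSup A * ∑ i, ‖z i‖ ^ 2 :=
  (sigmaSup_le_iff hA).1 le_rfl z

theorem convexOn_sigmaSup [Nonempty n] {E : Type*} [AddCommGroup E] [Module ℝ E]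
    {A : E → Matrix n n ℂ} (hA : ∀ x, (A x).IsHermitian)
    (hconv : ∀ z : n → ℂ, ConvexOn ℝ Set.univ fun x => (star z ⬝ᵥ (A x).mulVec z).re) :
    ConvexOn ℝ Set.univ fun x => sigmaSup (A x) := by
  refine ⟨convex_univ, fun x _ y _ a b ha hb hab => (sigmaSup_le_iff (hA _)).2 fun z => ?_⟩
  calc (star z ⬝ᵥ (A (a • x + b • y)).mulVec z).re
      ≤ a * (star z ⬝ᵥ (A x).mulVec z).re + b * (star z ⬝ᵥ (A y).mulVec z).re :=
        (hconv z).2 (Set.mem_univ x) (Set.mem_univ y) ha hb hab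
    _ ≤ a * (sigmaSup (A x) * ∑ i, ‖z i‖ ^ 2) + b * (sigmaSup (A y) * ∑ i, ‖z i‖ ^ 2) := by
        gcongr
        exacts [re_dotProduct_le_sigmaSup (hA x) z, re_dotProduct_le_sigmaSup (hA y) z]
    _ = (a • sigmaSup (A x) + b • sigmaSup (A y)) * ∑ i, ‖z i‖ ^ 2 := by
        rw [smul_eq_mul, smul_eq_mul]
        ring

end SigmaSup

/-! ### The six-dimensional compression -/

/-- A real symmetric matrix of the shape of `sixMatrix`. -/
def sixShape (p a b r c d e soo seo soe see : ℝ) : Matrix (Fin 6) (Fin 6) ℂ :=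
  !![(p : ℂ), 0, 0, d, 0, 0;
     0, p, soo, soe, 0, 0;
     0, soo, a, c, seo, 0;
     d, soe, c, b, see, e;
     0, 0, seo, see, r, 0;
     0, 0, 0, e, 0, r]

theorem isHermitian_sixShape (p a b r c d e soo seo soe see : ℝ) :
    (sixShape p a b r c d e soo seo soe see).IsHermitian := by
  ext i j
  fin_cases i <;> fin_cases j <;> simp [sixShape]

/-- The quadratic form of `sixShape`. -/
def sixQuad (p a b r c d e soo seo soe see : ℝ) (z : Fin 6 → ℂ) : ℝ :=
  p * (‖z 0‖ ^ 2 + ‖z 1‖ ^ 2) + a * ‖z 2‖ ^ 2 + b * ‖z 3‖ ^ 2 + r * (‖z 4‖ ^ 2 + ‖z 5‖ ^ 2)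
    + 2 * (d * ((starRingEnd ℂ) (z 3) * z 0).re + soo * ((starRingEnd ℂ) (z 2) * z 1).re
      + soe * ((starRingEnd ℂ) (z 3) * z 1).re + c * ((starRingEnd ℂ) (z 2) * z 3).re
      + seo * ((starRingEnd ℂ) (z 2) * z 4).re + see * ((starRingEnd ℂ) (z 3) * z 4).re
      + e * ((starRingEnd ℂ) (z 3) * z 5).re)

section SixQuad

variable (p a b r c d e soo seo soe see : ℝ)

theorem re_dotProduct_sixShape (z : Fin 6 → ℂ) :
    (star z ⬝ᵥ (sixShape p a b r c d e soo seo soe see).mulVec z).re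
      = sixQuad p a b r c d e soo seo soe see z := by
  simp [sixQuad, sixShape, dotProduct, Matrix.mulVec, Fin.sum_univ_succ,
    ← Complex.normSq_eq_norm_sq, Complex.normSq_apply]
  ring

theorem sixQuad_le_sigmaSup (z : Fin 6 → ℂ) :
    sixQuad p a b r c d e soo seo soe see z
      ≤ sigmaSup (sixShape p a b r c d e soo seo soe see) * ∑ i, ‖z i‖ ^ 2 :=
  (re_dotProduct_sixShape ..).symm.trans_le
    (re_dotProduct_le_sigmaSup (isHermitian_sixShape ..) z)

theorem le_sigmaSup_sixShape_left : p ≤ sigmaSup (sixShape p a b r c d e soo seo soe see) := by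
  simpa [sixQuad, Fin.sum_univ_succ] using
    sixQuad_le_sigmaSup p a b r c d e soo seo soe see ![1, 0, 0, 0, 0, 0]

theorem le_sigmaSup_sixShape_right : r ≤ sigmaSup (sixShape p a b r c d e soo seo soe see) := by
  simpa [sixQuad, Fin.sum_univ_succ] using
    sixQuad_le_sigmaSup p a b r c d e soo seo soe see ![0, 0, 0, 0, 0, 1]

end SixQuad

theorem sixQuad_eq_add (la ld lb d e soo seo soe see κ x y go ge : ℝ) (z : Fin 6 → ℂ) :
    sixQuad (1 - go) (κ * x ^ 2 + la - go) (κ * y ^ 2 + ld - ge) (1 - ge) (κ * (x * y) + lb)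
        d e soo seo soe see z
      = sixQuad 0 la ld 0 lb d e soo seo soe see z + κ * ‖(x : ℂ) * z 2 + (y : ℂ) * z 3‖ ^ 2
        + (1 - go) * (‖z 0‖ ^ 2 + ‖z 1‖ ^ 2) - go * ‖z 2‖ ^ 2
        + (1 - ge) * (‖z 4‖ ^ 2 + ‖z 5‖ ^ 2) - ge * ‖z 3‖ ^ 2 := by
  have hcross : ‖(x : ℂ) * z 2 + (y : ℂ) * z 3‖ ^ 2 = x ^ 2 * ‖z 2‖ ^ 2 + y ^ 2 * ‖z 3‖ ^ 2
      + 2 * (x * y) * ((starRingEnd ℂ) (z 2) * z 3).re := by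
    simp only [← Complex.normSq_eq_norm_sq, Complex.normSq_apply, add_re, add_im, mul_re, mul_im,
      conj_re, conj_im, ofReal_re, ofReal_im]
    ring
  rw [hcross, sixQuad, sixQuad]
  ring

section Compression

open NormedSpace (normalize)

variable {H : Type*} [NormedAddCommGroup H] [InnerProductSpace ℂ H]

theorem ofReal_norm_smul_normalize (v : H) : (‖v‖ : ℂ) • normalize v = v := by
  rw [Complex.coe_smul, NormedSpace.norm_smul_normalize]

theorem inner_normalize_left (v φ : H) : ⟪normalize v, φ⟫_ℂ = (‖v‖⁻¹ : ℝ) * ⟪v, φ⟫_ℂ := by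
  rw [NormedSpace.normalize, ← Complex.coe_smul, inner_smul_left, conj_ofReal]

theorem norm_normalize_le_one (v : H) : ‖normalize v‖ ≤ 1 := by
  rcases eq_or_ne v 0 with rfl | hv
  · simp only [NormedSpace.normalize_zero_eq_zero, norm_zero, zero_le_one]
  · exact (NormedSpace.norm_normalize_eq_one_iff.2 hv).le

theorem inner_normalize_residual (r t : H) :
    ⟪normalize r, t - ⟪normalize r, t⟫_ℂ • normalize r⟫_ℂ = 0 := by
  rcases eq_or_ne r 0 with rfl | hr
  · simp only [NormedSpace.normalize_zero_eq_zero, inner_zero_left]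
  · rw [inner_sub_right, inner_smul_right, inner_self_eq_norm_sq_to_K,
      NormedSpace.norm_normalize_eq_one_iff.2 hr, RCLike.ofReal_one, one_pow, mul_one, sub_self]

theorem norm_residual_sq (r t : H) :
    ‖t - ⟪normalize r, t⟫_ℂ • normalize r‖ ^ 2 = ‖t‖ ^ 2 - ‖⟪normalize r, t⟫_ℂ‖ ^ 2 := by
  rcases eq_or_ne r 0 with rfl | hr
  · simp only [NormedSpace.normalize_zero_eq_zero, inner_zero_left, zero_smul, sub_zero, norm_zero,
      ne_eq, OfNat.ofNat_ne_zero, not_false_eq_true, zero_pow]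
  · have hpyth := norm_add_sq_eq_norm_sq_add_norm_sq_of_inner_eq_zero (𝕜 := ℂ)
      (⟪normalize r, t⟫_ℂ • normalize r) (t - ⟪normalize r, t⟫_ℂ • normalize r)
      (by rw [inner_smul_left, inner_normalize_residual, mul_zero])
    rw [add_sub_cancel, norm_smul, NormedSpace.norm_normalize_eq_one_iff.2 hr, mul_one] at hpyth
    linarith

theorem norm_inner_sq_add_norm_inner_sq_le {a b : H} (ha : ‖a‖ ≤ 1) (hb : ‖b‖ ≤ 1)
    (hab : ⟪a, b⟫_ℂ = 0) (φ : H) : ‖⟪a, φ⟫_ℂ‖ ^ 2 + ‖⟪b, φ⟫_ℂ‖ ^ 2 ≤ ‖φ‖ ^ 2 := by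
  have hres : 0 ≤ ‖φ - (⟪a, φ⟫_ℂ • a + ⟪b, φ⟫_ℂ • b)‖ ^ 2 := by positivity
  rw [@norm_sub_sq ℂ, @norm_add_sq ℂ, inner_add_right, inner_smul_right, inner_smul_right,
    inner_smul_left, inner_smul_right, hab, norm_smul, norm_smul, ← inner_conj_symm φ a,
    ← inner_conj_symm φ b, RCLike.mul_conj, RCLike.mul_conj] at hres
  simp only [mul_zero, map_zero, map_add, add_zero] at hres
  norm_cast at hres
  simp only [mul_pow] at hres
  have ha2 : ‖a‖ ^ 2 ≤ 1 := pow_le_one₀ (norm_nonneg _) ha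
  have hb2 : ‖b‖ ^ 2 ≤ 1 := pow_le_one₀ (norm_nonneg _) hb
  nlinarith [sq_nonneg ‖⟪a, φ⟫_ℂ‖, sq_nonneg ‖⟪b, φ⟫_ℂ‖]

/- `x` and `y` are the coefficients of `φ` along the Gram-Schmidt vectors of `r`, `t`. -/
theorem exists_gramSchmidt_coords (r t φ : H) {s : ℂ} (hs : s = (‖r‖⁻¹ : ℝ) * ⟪r, t⟫_ℂ) :
    ∃ x y : ℂ, ⟪r, φ⟫_ℂ = ‖r‖ * y ∧
      ⟪t, φ⟫_ℂ = (starRingEnd ℂ) s * y + Real.sqrt (‖t‖ ^ 2 - ‖s‖ ^ 2) * x ∧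
      ‖x‖ ^ 2 + ‖y‖ ^ 2 ≤ ‖φ‖ ^ 2 := by
  obtain rfl : s = ⟪normalize r, t⟫_ℂ := hs.trans (inner_normalize_left r t).symm
  set t' := t - ⟪normalize r, t⟫_ℂ • normalize r with ht'
  have horth : ⟪normalize t', normalize r⟫_ℂ = 0 := by
    rw [inner_normalize_left, ← inner_conj_symm, inner_normalize_residual, map_zero, mul_zero]
  refine ⟨⟪normalize t', φ⟫_ℂ, ⟪normalize r, φ⟫_ℂ, ?_, ?_,
    norm_inner_sq_add_norm_inner_sq_le (norm_normalize_le_one _) (norm_normalize_le_one _)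
      horth φ⟩
  · nth_rewrite 1 [← ofReal_norm_smul_normalize r]
    rw [inner_smul_left, conj_ofReal]
  · have ht : t = ⟪normalize r, t⟫_ℂ • normalize r + (‖t'‖ : ℂ) • normalize t' := by
      rw [ofReal_norm_smul_normalize, ht', add_sub_cancel]
    rw [← norm_residual_sq, ← ht', Real.sqrt_sq (norm_nonneg _)]
    conv_lhs => rw [ht, inner_add_left, inner_smul_left, inner_smul_left, conj_ofReal]

theorem inner_self_residual {u : H} (hu : ‖u‖ = 1) (φ : H) : ⟪u, φ - ⟪u, φ⟫_ℂ • u⟫_ℂ = 0 := by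
  simpa only [NormedSpace.normalize_eq_self_of_norm_eq_one hu] using inner_normalize_residual u φ

theorem inner_residual_residual {u : H} (hu : ‖u‖ = 1) (φ ψ : H) :
    ⟪φ - ⟪u, φ⟫_ℂ • u, ψ - ⟪u, ψ⟫_ℂ • u⟫_ℂ = ⟪φ, ψ⟫_ℂ - (starRingEnd ℂ) ⟪u, φ⟫_ℂ * ⟪u, ψ⟫_ℂ := by
  rw [inner_sub_left, inner_smul_left, inner_self_residual hu, mul_zero, sub_zero, inner_sub_right,
    inner_smul_right, inner_conj_symm, mul_comm]

theorem norm_self_residual_sq {u : H} (hu : ‖u‖ = 1) (φ : H) :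
    ‖φ - ⟪u, φ⟫_ℂ • u‖ ^ 2 = ‖φ‖ ^ 2 - ‖⟪u, φ⟫_ℂ‖ ^ 2 := by
  simpa only [NormedSpace.normalize_eq_self_of_norm_eq_one hu] using norm_residual_sq u φ

theorem inner_self_residual_left {u φ : H} (hφ : ⟪u, φ⟫_ℂ = 0) (l : ℂ) (v : H) :
    ⟪v - l • u, φ⟫_ℂ = ⟪v, φ⟫_ℂ := by
  rw [inner_sub_left, inner_smul_left, hφ, mul_zero, sub_zero]

variable [CompleteSpace H]

theorem re_inner_selfAdjoint_expand {A : H →L[ℂ] H} (hA : IsSelfAdjoint A) {u φ : H} {l : ℝ}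
    (hl : ⟪u, A u⟫_ℂ = l) (hφ : ⟪u, φ⟫_ℂ = 0) (z : ℂ) :
    (⟪z • u + φ, A (z • u + φ)⟫_ℂ).re = l * ‖z‖ ^ 2
      + 2 * ((starRingEnd ℂ) z * ⟪A u - (l : ℂ) • u, φ⟫_ℂ).re + (⟪φ, A φ⟫_ℂ).re := by
  have huφ : ⟪u, A φ⟫_ℂ = ⟪A u, φ⟫_ℂ := by
    rw [← ContinuousLinearMap.adjoint_inner_left, hA.adjoint_eq]
  have hφu : ⟪φ, A u⟫_ℂ = (starRingEnd ℂ) ⟪A u, φ⟫_ℂ := (inner_conj_symm _ _).symm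
  rw [inner_self_residual_left hφ, map_add, map_smul, inner_add_left, inner_add_right,
    inner_add_right, inner_smul_left, inner_smul_left, inner_smul_right, inner_smul_right, huφ, hφu,
    hl, ← Complex.normSq_eq_norm_sq]
  generalize ⟪A u, φ⟫_ℂ = y
  simp only [Complex.normSq_apply, add_re, mul_re, mul_im, conj_re, conj_im, ofReal_re, ofReal_im]
  ring

theorem re_inner_expand (B : H →L[ℂ] H) {u v φ ψ : H} {l : ℝ} (hl : ⟪u, B v⟫_ℂ = l)
    (hφ : ⟪u, φ⟫_ℂ = 0) (hψ : ⟪v, ψ⟫_ℂ = 0) (z w : ℂ) :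
    (⟪z • u + φ, B (w • v + ψ)⟫_ℂ).re = l * ((starRingEnd ℂ) z * w).re
      + ((starRingEnd ℂ) z * ⟪ContinuousLinearMap.adjoint B u - (l : ℂ) • v, ψ⟫_ℂ).re
      + ((starRingEnd ℂ) w * ⟪B v - (l : ℂ) • u, φ⟫_ℂ).re + (⟪φ, B ψ⟫_ℂ).re := by
  have hφv : ⟪φ, B v⟫_ℂ = (starRingEnd ℂ) ⟪B v, φ⟫_ℂ := (inner_conj_symm _ _).symm
  rw [inner_self_residual_left hφ, inner_self_residual_left hψ,
    ContinuousLinearMap.adjoint_inner_left, map_add, map_smul, inner_add_left, inner_add_right,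
    inner_add_right, inner_smul_left, inner_smul_left, inner_smul_right, inner_smul_right, hφv, hl]
  generalize ⟪B v, φ⟫_ℂ = y
  simp only [add_re, mul_re, mul_im, conj_re, conj_im, ofReal_re, ofReal_im]
  ring

section Block

variable {A B D : H →L[ℂ] H} {u v : H} {la ld lb soe see : ℝ}

theorem exists_blockQuad_le_sixQuad (hA : IsSelfAdjoint A) (hD : IsSelfAdjoint D)
    (hQ : ∀ φ ψ : H, blockQuad A B D φ ψ ≤ ‖φ‖ ^ 2 + ‖ψ‖ ^ 2) (hu : ‖u‖ = 1) (hv : ‖v‖ = 1)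
    (hla : ⟪u, A u⟫_ℂ = la) (hld : ⟪v, D v⟫_ℂ = ld) (hlb : ⟪u, B v⟫_ℂ = lb)
    (hsoe : (soe : ℂ) = (‖A u - (la : ℂ) • u‖⁻¹ : ℝ)
      * ⟪A u - (la : ℂ) • u, B v - (lb : ℂ) • u⟫_ℂ)
    (hsee : (see : ℂ) = (‖ContinuousLinearMap.adjoint B u - (lb : ℂ) • v‖⁻¹ : ℝ)
      * ⟪ContinuousLinearMap.adjoint B u - (lb : ℂ) • v, D v - (ld : ℂ) • v⟫_ℂ) (φ ψ : H) :
    ∃ z : Fin 6 → ℂ, z 2 = ⟪u, φ⟫_ℂ ∧ z 3 = ⟪v, ψ⟫_ℂ ∧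
      ‖z 0‖ ^ 2 + ‖z 1‖ ^ 2 ≤ ‖φ‖ ^ 2 - ‖z 2‖ ^ 2 ∧
      ‖z 4‖ ^ 2 + ‖z 5‖ ^ 2 ≤ ‖ψ‖ ^ 2 - ‖z 3‖ ^ 2 ∧
      blockQuad A B D φ ψ ≤ sixQuad 0 la ld 0 lb
          (Real.sqrt (‖B v - (lb : ℂ) • u‖ ^ 2 - ‖(soe : ℂ)‖ ^ 2))
          (Real.sqrt (‖D v - (ld : ℂ) • v‖ ^ 2 - ‖(see : ℂ)‖ ^ 2)) ‖A u - (la : ℂ) • u‖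
          ‖ContinuousLinearMap.adjoint B u - (lb : ℂ) • v‖ soe see z
        + (‖φ‖ ^ 2 - ‖z 2‖ ^ 2) + (‖ψ‖ ^ 2 - ‖z 3‖ ^ 2) := by
  have hφ0 := inner_self_residual hu φ
  have hψ0 := inner_self_residual hv ψ
  obtain ⟨z0, z1, hAu, hBv, hφz⟩ := exists_gramSchmidt_coords (A u - (la : ℂ) • u)
    (B v - (lb : ℂ) • u) (φ - ⟪u, φ⟫_ℂ • u) hsoe
  obtain ⟨z5, z4, hBu, hDv, hψz⟩ := exists_gramSchmidt_coords
    (ContinuousLinearMap.adjoint B u - (lb : ℂ) • v) (D v - (ld : ℂ) • v) (ψ - ⟪v, ψ⟫_ℂ • v) hsee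
  have hAφ := re_inner_selfAdjoint_expand hA hla hφ0 ⟪u, φ⟫_ℂ
  have hDψ := re_inner_selfAdjoint_expand hD hld hψ0 ⟪v, ψ⟫_ℂ
  have hBφψ := re_inner_expand B hlb hφ0 hψ0 ⟪u, φ⟫_ℂ ⟪v, ψ⟫_ℂ
  have hres := hQ (φ - ⟪u, φ⟫_ℂ • u) (ψ - ⟪v, ψ⟫_ℂ • v)
  rw [add_sub_cancel, hAu] at hAφ
  rw [add_sub_cancel, hDv] at hDψ
  rw [add_sub_cancel, add_sub_cancel, hBu, hBv] at hBφψ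
  rw [norm_self_residual_sq hu] at hφz hres
  rw [norm_self_residual_sq hv] at hψz hres
  refine ⟨![z0, z1, ⟪u, φ⟫_ℂ, ⟪v, ψ⟫_ℂ, z4, z5], rfl, rfl, hφz, (add_comm _ _).trans_le hψz, ?_⟩
  refine le_trans (le_of_eq ?_) (add_le_add_right hres _ |>.trans_eq (add_assoc _ _ _).symm)
  rw [blockQuad, blockQuad, hAφ, hDψ, hBφψ]
  simp only [sixQuad, conj_ofReal, Matrix.cons_val]
  simp only [mul_add, add_re, mul_re, mul_im, conj_re, conj_im, ofReal_re, ofReal_im]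
  ring

/- On the orthogonal complement of the six vectors the matrix is replaced by the scalars `1 - go`
and `1 - ge`, which occur on its diagonal and hence are at most its largest eigenvalue. -/
theorem blockQuad_perturbed_le_sigmaSup (hA : IsSelfAdjoint A) (hD : IsSelfAdjoint D)
    (hQ : ∀ φ ψ : H, blockQuad A B D φ ψ ≤ ‖φ‖ ^ 2 + ‖ψ‖ ^ 2) (hu : ‖u‖ = 1) (hv : ‖v‖ = 1)
    (hla : ⟪u, A u⟫_ℂ = la) (hld : ⟪v, D v⟫_ℂ = ld) (hlb : ⟪u, B v⟫_ℂ = lb)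
    (hsoe : (soe : ℂ) = (‖A u - (la : ℂ) • u‖⁻¹ : ℝ)
      * ⟪A u - (la : ℂ) • u, B v - (lb : ℂ) • u⟫_ℂ)
    (hsee : (see : ℂ) = (‖ContinuousLinearMap.adjoint B u - (lb : ℂ) • v‖⁻¹ : ℝ)
      * ⟪ContinuousLinearMap.adjoint B u - (lb : ℂ) • v, D v - (ld : ℂ) • v⟫_ℂ)
    (κ x y go ge : ℝ) (φ ψ : H) :
    blockQuad A B D φ ψ + κ * ‖(x : ℂ) * ⟪u, φ⟫_ℂ + (y : ℂ) * ⟪v, ψ⟫_ℂ‖ ^ 2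
        - go * ‖φ‖ ^ 2 - ge * ‖ψ‖ ^ 2
      ≤ sigmaSup (sixShape (1 - go) (κ * x ^ 2 + la - go) (κ * y ^ 2 + ld - ge) (1 - ge)
          (κ * (x * y) + lb) (Real.sqrt (‖B v - (lb : ℂ) • u‖ ^ 2 - ‖(soe : ℂ)‖ ^ 2))
          (Real.sqrt (‖D v - (ld : ℂ) • v‖ ^ 2 - ‖(see : ℂ)‖ ^ 2)) ‖A u - (la : ℂ) • u‖
          ‖ContinuousLinearMap.adjoint B u - (lb : ℂ) • v‖ soe see) * (‖φ‖ ^ 2 + ‖ψ‖ ^ 2) := by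
  obtain ⟨z, hz2, hz3, hφz, hψz, hz⟩ :=
    exists_blockQuad_le_sixQuad hA hD hQ hu hv hla hld hlb hsoe hsee φ ψ
  rw [← hz2, ← hz3]
  set σ := sigmaSup (_ : Matrix (Fin 6) (Fin 6) ℂ)
  have hgo : 1 - go ≤ σ := le_sigmaSup_sixShape_left ..
  have hge : 1 - ge ≤ σ := le_sigmaSup_sixShape_right ..
  have hmain : _ ≤ σ * ∑ i, ‖z i‖ ^ 2 := sixQuad_le_sigmaSup ..
  rw [sixQuad_eq_add, Fin.sum_univ_six] at hmain
  have hcompl_o := mul_le_mul_of_nonneg_right hgo (sub_nonneg.2 hφz)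
  have hcompl_e := mul_le_mul_of_nonneg_right hge (sub_nonneg.2 hψz)
  linarith

end Block

end Compression

/-! ### Complex conjugation of wave functions -/

/-- Complex conjugation of wave functions. -/
def conjMode : Mode →L[ℝ] Mode := Complex.conjCLE.toContinuousLinearMap.compLpL 2 volume

theorem coeFn_conjMode (φ : Mode) : conjMode φ =ᵐ[volume] fun x => (starRingEnd ℂ) (φ x) :=
  ContinuousLinearMap.coeFn_compLpL _ φ

theorem conjMode_conjMode (φ : Mode) : conjMode (conjMode φ) = φ := by
  refine Lp.ext ?_
  filter_upwards [coeFn_conjMode (conjMode φ), coeFn_conjMode φ] with x hφφ hφ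
  rw [hφφ, hφ, conj_conj]

theorem inner_conjMode_conjMode (φ ψ : Mode) :
    ⟪conjMode φ, conjMode ψ⟫_ℂ = (starRingEnd ℂ) ⟪φ, ψ⟫_ℂ := by
  rw [L2.inner_def, L2.inner_def, ← integral_conj]
  refine integral_congr_ae ?_
  filter_upwards [coeFn_conjMode φ, coeFn_conjMode ψ] with x hφ hψ
  rw [hφ, hψ, RCLike.inner_apply, RCLike.inner_apply, map_mul]

theorem parity_conjMode (φ : Mode) : parity (conjMode φ) = conjMode (parity φ) := by
  refine Lp.ext ?_
  have hconj_neg := (Measure.measurePreserving_neg (volume : Measure ℝ)).quasiMeasurePreserving.ae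
    (coeFn_conjMode φ)
  filter_upwards [coeFn_parity (conjMode φ), coeFn_conjMode (parity φ), coeFn_parity φ, hconj_neg]
    with x hparity_conj hconj_parity hparity hconj
  rw [hparity_conj, hconj_parity, hparity, hconj]

theorem conjMode_half_smul (φ : Mode) :
    conjMode ((2⁻¹ : ℂ) • φ) = (2⁻¹ : ℂ) • conjMode φ := by
  have hreal : ∀ ψ : Mode, (2⁻¹ : ℂ) • ψ = (2⁻¹ : ℝ) • ψ := fun ψ => by
    rw [RCLike.real_smul_eq_coe_smul (K := ℂ), RCLike.ofReal_inv, RCLike.ofReal_ofNat]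
  rw [hreal, hreal, map_smul]

theorem odProj_conjMode (φ : Mode) : odProj (conjMode φ) = conjMode (odProj φ) := by
  rw [odProj_apply, odProj_apply, conjMode_half_smul, map_sub, parity_conjMode]

theorem evProj_conjMode (φ : Mode) : evProj (conjMode φ) = conjMode (evProj φ) := by
  rw [evProj_apply, evProj_apply, conjMode_half_smul, map_add, parity_conjMode]

theorem conjMode_coherent (w t : ℝ) : conjMode (coherent ⟨w, t⟩) = coherent ⟨w, -t⟩ := by
  refine Lp.ext ?_
  filter_upwards [coeFn_conjMode (coherent ⟨w, t⟩), (memLp_coherentWave ⟨w, t⟩).coeFn_toLp,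
    (memLp_coherentWave ⟨w, -t⟩).coeFn_toLp] with x hconj hleft hright
  rw [hconj, coherent, coherent, hleft, hright, coherentWave_mk, coherentWave_mk, map_mul,
    conj_ofReal, ← exp_conj]
  congr 2
  simp only [map_sub, map_mul, conj_I, conj_ofReal, map_ofNat]
  push_cast
  ring

theorem conjMode_coherent_ofReal (β : ℝ) : conjMode (coherent β) = coherent β := by
  have h := conjMode_coherent β 0
  rwa [neg_zero] at h

section Reality

variable {μ β : ℝ} {f : ℝ → ℝ}

theorem inner_coherent_conjMode (w t : ℝ) (ψ : Mode) :
    ⟪coherent ⟨w, t⟩, conjMode ψ⟫_ℂ = (starRingEnd ℂ) ⟪coherent ⟨w, -t⟩, ψ⟫_ℂ := by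
  rw [← inner_conjMode_conjMode, conjMode_coherent, neg_neg]

theorem inner_conjMode_coherent (w t : ℝ) (ψ : Mode) :
    ⟪conjMode ψ, coherent ⟨w, t⟩⟫_ℂ = (starRingEnd ℂ) ⟪ψ, coherent ⟨w, -t⟩⟫_ℂ := by
  rw [← inner_conjMode_conjMode, conjMode_coherent, neg_neg]

theorem toeplitz_conjMode {h : ℝ × ℝ → ℂ} (hh : MemLp h ⊤)
    (hconj : ∀ w t, h (w, -t) = (starRingEnd ℂ) (h (w, t))) (ψ : Mode) :
    toeplitz h (conjMode ψ) = conjMode (toeplitz h ψ) := by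
  refine ext_inner_left ℂ fun φ => ?_
  have hreflect : MeasurePreserving ((MeasurableEquiv.refl ℝ).prodCongr (MeasurableEquiv.neg ℝ))
      (volume : Measure (ℝ × ℝ)) volume :=
    (MeasurePreserving.id volume).prod (Measure.measurePreserving_neg volume)
  rw [← conjMode_conjMode φ, inner_conjMode_conjMode, (hasWeakIntegral_toeplitz hh _ _).2,
    (hasWeakIntegral_toeplitz hh _ _).2, ← integral_conj,
    ← hreflect.integral_comp (MeasurableEquiv.measurableEmbedding _)
      (fun p => (starRingEnd ℂ) (toeplitzForm h p (conjMode φ) ψ))]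
  congr 1 with ⟨w, t⟩
  change _ = (starRingEnd ℂ) (toeplitzForm h (w, -t) (conjMode φ) ψ)
  simp only [toeplitzForm, hconj, inner_coherent_conjMode, inner_conjMode_coherent, map_mul,
    map_inv₀, conj_ofReal, conj_conj]

theorem ooSymbol_neg_right (w t : ℝ) :
    ooSymbol μ β f (w, -t) = (starRingEnd ℂ) (ooSymbol μ β f (w, t)) := by
  simp only [ooSymbol, diagSymbol, mul_neg, Real.cos_neg, conj_ofReal]

theorem eeSymbol_neg_right (w t : ℝ) :
    eeSymbol μ β f (w, -t) = (starRingEnd ℂ) (eeSymbol μ β f (w, t)) := by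
  simp only [eeSymbol, diagSymbol, mul_neg, Real.cos_neg, conj_ofReal]

theorem oeSymbol_neg_right (s w t : ℝ) :
    oeSymbol μ β f s (w, -t) = (starRingEnd ℂ) (oeSymbol μ β f s (w, t)) := by
  simp only [oeSymbol, offSymbol, mul_neg, Real.sin_neg, map_mul, map_add, conj_ofReal, conj_I,
    ofReal_neg, neg_mul]

theorem Moo_conjMode (hf : MemLp f ⊤) (ψ : Mode) :
    Moo μ β f (conjMode ψ) = conjMode (Moo μ β f ψ) := by
  simp only [Moo_eq hf, ContinuousLinearMap.comp_apply, odProj_conjMode,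
    toeplitz_conjMode (memLp_ooSymbol hf) ooSymbol_neg_right]

theorem Mee_conjMode (hf : MemLp f ⊤) (ψ : Mode) :
    Mee μ β f (conjMode ψ) = conjMode (Mee μ β f ψ) := by
  simp only [Mee_eq hf, ContinuousLinearMap.comp_apply, evProj_conjMode,
    toeplitz_conjMode (memLp_eeSymbol hf) eeSymbol_neg_right]

theorem Moe_conjMode (hf : MemLp f ⊤) (s : ℝ) (ψ : Mode) :
    Moe μ β f s (conjMode ψ) = conjMode (Moe μ β f s ψ) := by
  simp only [Moe_eq hf, ContinuousLinearMap.comp_apply, odProj_conjMode, evProj_conjMode,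
    toeplitz_conjMode (memLp_oeSymbol hf s) (oeSymbol_neg_right s)]

theorem star_expect {T : Mode →L[ℂ] Mode} (hT : ∀ ψ, T (conjMode ψ) = conjMode (T ψ)) :
    star (expect β T) = expect β T := by
  rw [RCLike.star_def, expect, ← inner_conjMode_conjMode, ← hT, conjMode_coherent_ofReal]

theorem star_lamOO (hf : MemLp f ⊤) : star (lamOO μ β f) = lamOO μ β f := by
  rw [lamOO, star_mul', star_expect (Moo_conjMode hf), RCLike.star_def, conj_ofReal]

theorem star_lamEE (hf : MemLp f ⊤) : star (lamEE μ β f) = lamEE μ β f := by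
  rw [lamEE, star_mul', star_expect (Mee_conjMode hf), RCLike.star_def, conj_ofReal]

theorem star_lamOE (hf : MemLp f ⊤) (s : ℝ) : star (lamOE μ β f s) = lamOE μ β f s := by
  rw [lamOE, star_mul', star_expect (Moe_conjMode hf s), RCLike.star_def, conj_ofReal]

theorem star_sigOE (hf : MemLp f ⊤) (s : ℝ) : star (sigOE μ β f s) = sigOE μ β f s := by
  have h : star (expect β (Moo μ β f ∘L Moe μ β f s)) = expect β (Moo μ β f ∘L Moe μ β f s) :=
    star_expect fun ψ => by
      simp only [ContinuousLinearMap.comp_apply, Moe_conjMode hf, Moo_conjMode hf]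
  rw [sigOE, star_mul', star_sub, star_mul', star_mul', h, star_lamOO hf, star_lamOE hf,
    RCLike.star_def, conj_ofReal, conj_ofReal]

theorem star_sigEE (hf : MemLp f ⊤) (s : ℝ) : star (sigEE μ β f s) = sigEE μ β f s := by
  have h : star (expect β (Moe μ β f s ∘L Mee μ β f)) = expect β (Moe μ β f s ∘L Mee μ β f) :=
    star_expect fun ψ => by
      simp only [ContinuousLinearMap.comp_apply, Moe_conjMode hf, Mee_conjMode hf]
  rw [sigEE, star_mul', star_sub, star_mul', star_mul', h, star_lamEE hf, star_lamOE hf,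
    RCLike.star_def, conj_ofReal, conj_ofReal]

end Reality

/-! ### The weights -/

theorem inner_coherent_coherent_ofReal (a b : ℝ) :
    ⟪coherent a, coherent b⟫_ℂ = (Real.exp (-(a - b) ^ 2 / 2) : ℂ) := by
  have complete_square : ∀ x, realWave a x * realWave b x
      = Real.exp (-(a - b) ^ 2 / 2) * realWave x ((a + b) / 2) ^ 2 := fun x => by
    rw [realWave_sq, realWave, realWave, mul_mul_mul_comm, ← Real.rpow_add (by positivity),
      ← Real.exp_add, mul_left_comm, ← Real.exp_add, Real.sqrt_eq_rpow]
    congr 2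
    · norm_num
    · ring
  have overlap : ∫ x, realWave a x * realWave b x = Real.exp (-(a - b) ^ 2 / 2) := by
    simp_rw [complete_square]
    rw [integral_const_mul, integral_realWave_sq_left, mul_one]
  rw [inner_coherent_eq_integral, ← overlap, ← integral_complex_ofReal]
  refine integral_congr_ae ?_
  filter_upwards [(memLp_coherentWave b).coeFn_toLp] with x hx
  rw [coherent, hx, coherentWave_ofReal, coherentWave_ofReal, RCLike.star_def,
    conj_ofReal, ofReal_mul]

theorem expect_odProj (β : ℝ) :
    expect β odProj = ((Real.exp (-β ^ 2) * Real.sinh (β ^ 2) : ℝ) : ℂ) := by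
  have h : Real.exp (-β ^ 2) * Real.sinh (β ^ 2)
      = 2⁻¹ * (Real.exp (-(β - β) ^ 2 / 2) - Real.exp (-(β - -β) ^ 2 / 2)) := by
    rw [Real.sinh_eq, mul_div_assoc', mul_sub, ← Real.exp_add, ← Real.exp_add]
    ring_nf
  rw [expect, odProj_apply, inner_smul_right, inner_sub_right, parity_coherent,
    ← ofReal_neg, inner_coherent_coherent_ofReal, inner_coherent_coherent_ofReal, h]
  push_cast
  rfl

theorem expect_evProj (β : ℝ) :
    expect β evProj = ((Real.exp (-β ^ 2) * Real.cosh (β ^ 2) : ℝ) : ℂ) := by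
  have h : Real.exp (-β ^ 2) * Real.cosh (β ^ 2)
      = 2⁻¹ * (Real.exp (-(β - β) ^ 2 / 2) + Real.exp (-(β - -β) ^ 2 / 2)) := by
    rw [Real.cosh_eq, mul_div_assoc', mul_add, ← Real.exp_add, ← Real.exp_add]
    ring_nf
  rw [expect, evProj_apply, inner_smul_right, inner_add_right, parity_coherent,
    ← ofReal_neg, inner_coherent_coherent_ofReal, inner_coherent_coherent_ofReal, h]
  push_cast
  rfl

theorem Co_eq (β : ℝ) : Co β = Real.exp (-β ^ 2) * Real.sinh (β ^ 2) := by
  rw [Co, expect_odProj, ofReal_re]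

theorem Ce_eq (β : ℝ) : Ce β = Real.exp (-β ^ 2) * Real.cosh (β ^ 2) := by
  rw [Ce, expect_evProj, ofReal_re]

theorem norm_sq_odProj_coherent (β : ℝ) : ‖odProj (coherent β)‖ ^ 2 = Co β := by
  rw [← inner_self_eq_norm_sq (𝕜 := ℂ), inner_odProj_left, odProj_odProj]
  rfl

theorem norm_sq_evProj_coherent (β : ℝ) : ‖evProj (coherent β)‖ ^ 2 = Ce β := by
  rw [← inner_self_eq_norm_sq (𝕜 := ℂ), inner_evProj_left, evProj_evProj]
  rfl

/-! ### Identification of the parameters -/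

section Parameters

variable {μ β : ℝ} {f : ℝ → ℝ}

theorem Co_pos (hβ : β ≠ 0) : 0 < Co β := by
  rw [Co_eq]
  exact mul_pos (Real.exp_pos _) (Real.sinh_pos_iff.2 (by positivity))

theorem Ce_pos (β : ℝ) : 0 < Ce β := by
  rw [Ce_eq]
  exact mul_pos (Real.exp_pos _) (Real.cosh_pos _)

theorem inner_odProj_Moo (hf : MemLp f ⊤) (φ ψ : Mode) :
    ⟪odProj φ, Moo μ β f ψ⟫_ℂ = ⟪φ, Moo μ β f ψ⟫_ℂ := by
  simp only [Moo_eq hf, ContinuousLinearMap.comp_apply, inner_odProj_left, odProj_odProj]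

theorem inner_evProj_Mee (hf : MemLp f ⊤) (φ ψ : Mode) :
    ⟪evProj φ, Mee μ β f ψ⟫_ℂ = ⟪φ, Mee μ β f ψ⟫_ℂ := by
  simp only [Mee_eq hf, ContinuousLinearMap.comp_apply, inner_evProj_left, evProj_evProj]

theorem inner_odProj_Moe (hf : MemLp f ⊤) (s : ℝ) (φ ψ : Mode) :
    ⟪odProj φ, Moe μ β f s ψ⟫_ℂ = ⟪φ, Moe μ β f s ψ⟫_ℂ := by
  simp only [Moe_eq hf, ContinuousLinearMap.comp_apply, inner_odProj_left, odProj_odProj]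

/-- The normalised odd part of the coherent state. -/
def oddKet (β : ℝ) : Mode := (((Real.sqrt (Co β))⁻¹ : ℝ) : ℂ) • odProj (coherent β)

/-- The normalised even part of the coherent state. -/
def evenKet (β : ℝ) : Mode := (((Real.sqrt (Ce β))⁻¹ : ℝ) : ℂ) • evProj (coherent β)

theorem norm_oddKet (hβ : β ≠ 0) : ‖oddKet β‖ = 1 := by
  have h := Co_pos hβ
  rw [oddKet, norm_smul, norm_real, Real.norm_of_nonneg (by positivity),
    ← Real.sqrt_sq (norm_nonneg (odProj _)), norm_sq_odProj_coherent,
    inv_mul_cancel₀ (Real.sqrt_pos.2 h).ne']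

theorem norm_evenKet (β : ℝ) : ‖evenKet β‖ = 1 := by
  have h := Ce_pos β
  rw [evenKet, norm_smul, norm_real, Real.norm_of_nonneg (by positivity),
    ← Real.sqrt_sq (norm_nonneg (evProj _)), norm_sq_evProj_coherent,
    inv_mul_cancel₀ (Real.sqrt_pos.2 h).ne']

theorem sqrt_Co_mul_inner_oddKet (hβ : β ≠ 0) (φ : Mode) :
    (Real.sqrt (Co β) : ℂ) * ⟪oddKet β, φ⟫_ℂ = ⟪coherent β, odProj φ⟫_ℂ := by
  rw [oddKet, inner_smul_left, conj_ofReal, ← mul_assoc, ← ofReal_mul,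
    mul_inv_cancel₀ (Real.sqrt_pos.2 (Co_pos hβ)).ne', ofReal_one, one_mul,
    inner_odProj_left]

theorem sqrt_Ce_mul_inner_evenKet (φ : Mode) :
    (Real.sqrt (Ce β) : ℂ) * ⟪evenKet β, φ⟫_ℂ = ⟪coherent β, evProj φ⟫_ℂ := by
  rw [evenKet, inner_smul_left, conj_ofReal, ← mul_assoc, ← ofReal_mul,
    mul_inv_cancel₀ (Real.sqrt_pos.2 (Ce_pos β)).ne', ofReal_one, one_mul,
    inner_evProj_left]

theorem ofReal_inv_sqrt_mul_self {a : ℝ} (ha : 0 ≤ a) :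
    (((Real.sqrt a)⁻¹ : ℝ) : ℂ) * (((Real.sqrt a)⁻¹ : ℝ) : ℂ) = ((a⁻¹ : ℝ) : ℂ) := by
  rw [← ofReal_mul, ← mul_inv, Real.mul_self_sqrt ha]

theorem norm_sq_inv_sqrt_smul {E : Type*} [SeminormedAddCommGroup E] [NormedSpace ℂ E] {a : ℝ}
    (ha : 0 ≤ a) (φ : E) : ‖(((Real.sqrt a)⁻¹ : ℝ) : ℂ) • φ‖ ^ 2 = a⁻¹ * ‖φ‖ ^ 2 := by
  rw [norm_smul, norm_real, Real.norm_of_nonneg (by positivity), mul_pow, inv_pow,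
    Real.sq_sqrt ha]

theorem ofReal_inv_sqrt_mul (hβ : β ≠ 0) :
    (((Real.sqrt (Co β))⁻¹ : ℝ) : ℂ) * (((Real.sqrt (Ce β))⁻¹ : ℝ) : ℂ) = (cInv β : ℂ) := by
  rw [← ofReal_mul, ← mul_inv, cInv, Real.sqrt_mul (Co_pos hβ).le]

theorem Moo_oddKet (hf : MemLp f ⊤) :
    Moo μ β f (oddKet β) = (((Real.sqrt (Co β))⁻¹ : ℝ) : ℂ) • Moo μ β f (coherent β) := by
  rw [oddKet, map_smul, Moo_odProj hf]

theorem Mee_evenKet (hf : MemLp f ⊤) :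
    Mee μ β f (evenKet β) = (((Real.sqrt (Ce β))⁻¹ : ℝ) : ℂ) • Mee μ β f (coherent β) := by
  rw [evenKet, map_smul, Mee_evProj hf]

theorem Moe_evenKet (hf : MemLp f ⊤) (s : ℝ) :
    Moe μ β f s (evenKet β) = (((Real.sqrt (Ce β))⁻¹ : ℝ) : ℂ) • Moe μ β f s (coherent β) := by
  rw [evenKet, map_smul, Moe_evProj hf]

theorem Meo_oddKet (hf : MemLp f ⊤) (s : ℝ) :
    Meo μ β f s (oddKet β) = (((Real.sqrt (Co β))⁻¹ : ℝ) : ℂ) • Meo μ β f s (coherent β) := by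
  rw [oddKet, map_smul, Meo_odProj hf]

theorem inner_oddKet_Moo (hf : MemLp f ⊤) (hβ : β ≠ 0) :
    ⟪oddKet β, Moo μ β f (oddKet β)⟫_ℂ = lamOO μ β f := by
  rw [Moo_oddKet hf, oddKet, inner_smul_left, inner_smul_right, conj_ofReal,
    inner_odProj_Moo hf, ← mul_assoc, ofReal_inv_sqrt_mul_self (Co_pos hβ).le]
  rfl

theorem inner_evenKet_Mee (hf : MemLp f ⊤) :
    ⟪evenKet β, Mee μ β f (evenKet β)⟫_ℂ = lamEE μ β f := by
  rw [Mee_evenKet hf, evenKet, inner_smul_left, inner_smul_right, conj_ofReal,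
    inner_evProj_Mee hf, ← mul_assoc, ofReal_inv_sqrt_mul_self (Ce_pos β).le]
  rfl

theorem inner_oddKet_Moe (hf : MemLp f ⊤) (hβ : β ≠ 0) (s : ℝ) :
    ⟪oddKet β, Moe μ β f s (evenKet β)⟫_ℂ = lamOE μ β f s := by
  rw [Moe_evenKet hf, oddKet, inner_smul_left, inner_smul_right, conj_ofReal,
    inner_odProj_Moe hf, ← mul_assoc, ofReal_inv_sqrt_mul hβ]
  rfl

theorem inner_Meo_oddKet (hf : MemLp f ⊤) (hβ : β ≠ 0) (s : ℝ) :
    ⟪Meo μ β f s (oddKet β), evenKet β⟫_ℂ = lamOE μ β f s := by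
  rw [Meo, ContinuousLinearMap.adjoint_inner_left, inner_oddKet_Moe hf hβ]

theorem inner_evenKet_Meo (hf : MemLp f ⊤) (hβ : β ≠ 0) (s : ℝ) :
    ⟪evenKet β, Meo μ β f s (oddKet β)⟫_ℂ = lamOE μ β f s := by
  rw [← inner_conj_symm, inner_Meo_oddKet hf hβ]
  exact star_lamOE hf s

theorem sigOO_eq (hf : MemLp f ⊤) (hβ : β ≠ 0) :
    sigOO μ β f = ‖Moo μ β f (oddKet β) - lamOO μ β f • oddKet β‖ := by
  have h := norm_self_residual_sq (norm_oddKet hβ) (Moo μ β f (oddKet β))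
  rw [inner_oddKet_Moo hf hβ] at h
  rw [sigOO, ← norm_sq_inv_sqrt_smul (Co_pos hβ).le, ← Moo_oddKet hf, ← h,
    Real.sqrt_sq (norm_nonneg _)]

theorem sigEO_eq (hf : MemLp f ⊤) (hβ : β ≠ 0) (s : ℝ) :
    sigEO μ β f s = ‖Meo μ β f s (oddKet β) - lamOE μ β f s • evenKet β‖ := by
  have h := norm_self_residual_sq (norm_evenKet β) (Meo μ β f s (oddKet β))
  rw [inner_evenKet_Meo hf hβ] at h
  rw [sigEO, ← norm_sq_inv_sqrt_smul (Co_pos hβ).le, ← Meo_oddKet hf, ← h,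
    Real.sqrt_sq (norm_nonneg _)]

theorem sigOE_eq (hf : MemLp f ⊤) (hβ : β ≠ 0) (s : ℝ) :
    sigOE μ β f s = ((sigOO μ β f)⁻¹ : ℝ) * ⟪Moo μ β f (oddKet β) - lamOO μ β f • oddKet β,
      Moe μ β f s (evenKet β) - lamOE μ β f s • oddKet β⟫_ℂ := by
  have hcross : ⟪Moo μ β f (oddKet β), Moe μ β f s (evenKet β)⟫_ℂ
      = (cInv β : ℂ) * expect β (Moo μ β f ∘L Moe μ β f s) := by
    rw [← ContinuousLinearMap.adjoint_inner_right, (isSelfAdjoint_Moo hf).adjoint_eq,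
      Moe_evenKet hf, map_smul, oddKet, inner_smul_left, inner_smul_right, conj_ofReal,
      inner_odProj_Moo hf, ← mul_assoc, ofReal_inv_sqrt_mul hβ]
    rfl
  have hres := inner_residual_residual (norm_oddKet hβ) (Moo μ β f (oddKet β))
    (Moe μ β f s (evenKet β))
  rw [inner_oddKet_Moo hf hβ, inner_oddKet_Moe hf hβ, ← RCLike.star_def,
    star_lamOO hf] at hres
  rw [sigOE, hres, hcross]

theorem sigEE_eq (hf : MemLp f ⊤) (hβ : β ≠ 0) (s : ℝ) :
    sigEE μ β f s = ((sigEO μ β f s)⁻¹ : ℝ) * ⟪Meo μ β f s (oddKet β) - lamOE μ β f s • evenKet β,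
      Mee μ β f (evenKet β) - lamEE μ β f • evenKet β⟫_ℂ := by
  have hcross : ⟪Meo μ β f s (oddKet β), Mee μ β f (evenKet β)⟫_ℂ
      = (cInv β : ℂ) * expect β (Moe μ β f s ∘L Mee μ β f) := by
    rw [Meo, ContinuousLinearMap.adjoint_inner_left, Mee_evenKet hf, map_smul, oddKet,
      inner_smul_left, inner_smul_right, conj_ofReal, inner_odProj_Moe hf, ← mul_assoc,
      ofReal_inv_sqrt_mul hβ]
    rfl
  have hres := inner_residual_residual (norm_evenKet β) (Meo μ β f s (oddKet β))
    (Mee μ β f (evenKet β))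
  rw [inner_evenKet_Meo hf hβ, inner_evenKet_Mee hf, ← RCLike.star_def,
    star_lamOE hf] at hres
  rw [sigEE, hres, hcross]

theorem delOE_eq (hf : MemLp f ⊤) (hβ : β ≠ 0) (s : ℝ) :
    delOE μ β f s = Real.sqrt (‖Moe μ β f s (evenKet β) - lamOE μ β f s • oddKet β‖ ^ 2
      - ‖sigOE μ β f s‖ ^ 2) := by
  have h := norm_self_residual_sq (norm_oddKet hβ) (Moe μ β f s (evenKet β))
  rw [inner_oddKet_Moe hf hβ] at h
  rw [delOE, ← norm_sq_inv_sqrt_smul (Ce_pos β).le, ← Moe_evenKet hf, h]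

theorem delEE_eq (hf : MemLp f ⊤) (s : ℝ) :
    delEE μ β f s = Real.sqrt (‖Mee μ β f (evenKet β) - lamEE μ β f • evenKet β‖ ^ 2
      - ‖sigEE μ β f s‖ ^ 2) := by
  have h := norm_self_residual_sq (norm_evenKet β) (Mee μ β f (evenKet β))
  rw [inner_evenKet_Mee hf] at h
  rw [delEE, ← norm_sq_inv_sqrt_smul (Ce_pos β).le, ← Mee_evenKet hf, h]

theorem sixMatrix_eq_sixShape (hf : MemLp f ⊤) (s κ go ge : ℝ) :
    sixMatrix μ β f s κ go ge = sixShape (1 - go) (κ * Co β + (lamOO μ β f).re - go)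
      (κ * Ce β + (lamEE μ β f).re - ge) (1 - ge) (κ * Real.sqrt (Co β * Ce β) + (lamOE μ β f s).re)
      (delOE μ β f s) (delEE μ β f s) (sigOO μ β f) (sigEO μ β f s) (sigOE μ β f s).re
      (sigEE μ β f s).re := by
  simp only [sixMatrix, sixShape, ofReal_sub, ofReal_add, ofReal_mul,
    ofReal_one, conj_eq_iff_re.1 (star_lamOO hf),
    conj_eq_iff_re.1 (star_lamEE hf), conj_eq_iff_re.1 (star_lamOE hf s),
    conj_eq_iff_re.1 (star_sigOE hf s), conj_eq_iff_re.1 (star_sigEE hf s)]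

theorem blockQuad_le_norm_sq (hf : MemLp f ⊤) (hf_sum : ∀ x, f x + f (-x) ≤ 1) {s : ℝ}
    (hs : s ^ 2 = 1) (φ ψ : Mode) :
    blockQuad (Moo μ β f) (Moe μ β f s) (Mee μ β f) φ ψ ≤ ‖φ‖ ^ 2 + ‖ψ‖ ^ 2 := by
  have hφ := norm_sq_eq_odProj_add_evProj φ
  have hψ := norm_sq_eq_odProj_add_evProj ψ
  linarith [blockQuad_le (μ := μ) (β := β) hf hf_sum hs φ ψ, sq_nonneg ‖evProj φ‖,
    sq_nonneg ‖odProj ψ‖]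

theorem blockQuad_odProj_evProj (hf : MemLp f ⊤) (s : ℝ) (φ ψ : Mode) :
    blockQuad (Moo μ β f) (Moe μ β f s) (Mee μ β f) (odProj φ) (evProj ψ)
      = blockQuad (Moo μ β f) (Moe μ β f s) (Mee μ β f) φ ψ := by
  rw [blockQuad, blockQuad, inner_Moo_odProj hf, inner_Mee_evProj hf, inner_Moe_proj hf]

theorem blockQuad_perturbed_le (hf : MemLp f ⊤) (hf_sum : ∀ x, f x + f (-x) ≤ 1) (hβ : β ≠ 0)
    {s : ℝ} (hs : s ^ 2 = 1) (κ go ge : ℝ) (φ ψ : Mode) :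
    blockQuad (Moo μ β f) (Moe μ β f s) (Mee μ β f) φ ψ
        + κ * ‖⟪coherent β, odProj φ⟫_ℂ + ⟪coherent β, evProj ψ⟫_ℂ‖ ^ 2
        - go * ‖odProj φ‖ ^ 2 - ge * ‖evProj ψ‖ ^ 2
      ≤ sigmaSup (sixMatrix μ β f s κ go ge) * (‖odProj φ‖ ^ 2 + ‖evProj ψ‖ ^ 2) := by
  have hOO := conj_eq_iff_re.1 (star_lamOO (μ := μ) (β := β) hf)
  have hEE := conj_eq_iff_re.1 (star_lamEE (μ := μ) (β := β) hf)
  have hOE := conj_eq_iff_re.1 (star_lamOE (μ := μ) (β := β) hf s)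
  have hsOE := conj_eq_iff_re.1 (star_sigOE (μ := μ) (β := β) hf s)
  have hsEE := conj_eq_iff_re.1 (star_sigEE (μ := μ) (β := β) hf s)
  have h := blockQuad_perturbed_le_sigmaSup (isSelfAdjoint_Moo hf) (isSelfAdjoint_Mee hf)
    (blockQuad_le_norm_sq hf hf_sum hs) (norm_oddKet hβ) (norm_evenKet β)
    ((inner_oddKet_Moo hf hβ).trans hOO.symm) ((inner_evenKet_Mee hf).trans hEE.symm)
    ((inner_oddKet_Moe hf hβ s).trans hOE.symm)
    (soe := (sigOE μ β f s).re) (see := (sigEE μ β f s).re)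
    (by rw [hsOE, hOO, hOE, ← sigOO_eq hf hβ, ← sigOE_eq hf hβ])
    (by rw [hsEE, hOE, hEE, ← Meo, ← sigEO_eq hf hβ, ← sigEE_eq hf hβ])
    κ (Real.sqrt (Co β)) (Real.sqrt (Ce β)) go ge (odProj φ) (evProj ψ)
  rwa [hsOE, hsEE, hOO, hEE, hOE, ← Meo, ← sigOO_eq hf hβ, ← sigEO_eq hf hβ, ← delOE_eq hf hβ,
    ← delEE_eq hf, Real.sq_sqrt (Co_pos hβ).le, Real.sq_sqrt (Ce_pos β).le,
    ← Real.sqrt_mul (Co_pos hβ).le, ← sixMatrix_eq_sixShape hf, sqrt_Co_mul_inner_oddKet hβ,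
    sqrt_Ce_mul_inner_evenKet, odProj_odProj, evProj_evProj, blockQuad_odProj_evProj hf] at h

/-! ### Convexity of the bound -/

theorem convexOn_sigmaSup_sixMatrix (hf : MemLp f ⊤) (s : ℝ) :
    ConvexOn ℝ Set.univ
      (fun q : ℝ × ℝ × ℝ => sigmaSup (sixMatrix μ β f s q.1 q.2.1 q.2.2)) := by
  simp only [sixMatrix_eq_sixShape hf]
  refine convexOn_sigmaSup (fun _ => isHermitian_sixShape ..) fun z => ?_
  refine ⟨convex_univ, fun p _ q _ a b _ _ hab => le_of_eq ?_⟩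
  obtain rfl := eq_sub_of_add_eq' hab
  simp only [re_dotProduct_sixShape, sixQuad, Prod.fst_add, Prod.snd_add, Prod.smul_fst,
    Prod.smul_snd, smul_eq_mul]
  ring

theorem convexOn_Bhet (hf : MemLp f ⊤) :
    ConvexOn ℝ Set.univ (fun p : ℝ × ℝ => Bhet μ β f p.1 p.2) := by
  have hplus := (convexOn_sigmaSup_sixMatrix (μ := μ) (β := β) hf 1).comp_linearMap
    ((LinearMap.fst ℝ ℝ ℝ).prod ((0 : ℝ × ℝ →ₗ[ℝ] ℝ).prod (LinearMap.snd ℝ ℝ ℝ)))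
  have hminus := (convexOn_sigmaSup_sixMatrix (μ := μ) (β := β) hf (-1)).comp_linearMap
    ((LinearMap.fst ℝ ℝ ℝ).prod ((LinearMap.snd ℝ ℝ ℝ).prod (0 : ℝ × ℝ →ₗ[ℝ] ℝ)))
  exact hplus.sup hminus

end Parameters

/-! ### The operator inequality -/

section Hilbert

variable {H : Type*} [NormedAddCommGroup H] [InnerProductSpace ℂ H]

theorem le_smul_one_of_inner_eq {T : H →L[ℂ] H} {q : H → ℝ} {c : ℝ}
    (hT : ∀ φ, ⟪φ, T φ⟫_ℂ = q φ) (hq : ∀ φ, q φ ≤ c * ‖φ‖ ^ 2) : T ≤ (c : ℂ) • 1 := by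
  rw [ContinuousLinearMap.le_def, ContinuousLinearMap.isPositive_iff_complex]
  intro φ
  have hform : ⟪((c : ℂ) • (1 : H →L[ℂ] H) - T) φ, φ⟫_ℂ = ((c * ‖φ‖ ^ 2 - q φ : ℝ) : ℂ) := by
    rw [sub_apply, smul_apply, one_apply_eq_self, inner_sub_left, inner_smul_left,
      ← inner_conj_symm (T φ), hT, inner_self_eq_norm_sq_to_K, conj_ofReal, conj_ofReal]
    push_cast
    rfl
  rw [hform]
  exact ⟨rfl, sub_nonneg.2 (hq φ)⟩

theorem norm_sq_add_norm_sq_eq_hadamard (x y : H) :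
    ‖x‖ ^ 2 + ‖y‖ ^ 2
      = ‖(Real.sqrt 2 : ℂ)⁻¹ • (x + y)‖ ^ 2 + ‖(Real.sqrt 2 : ℂ)⁻¹ • (x - y)‖ ^ 2 := by
  have hnorm : ‖(Real.sqrt 2 : ℂ)⁻¹‖ ^ 2 = 2⁻¹ := by
    rw [norm_inv, norm_real, inv_pow, Real.norm_of_nonneg (by positivity),
      Real.sq_sqrt (by norm_num)]
  rw [norm_smul, norm_smul, mul_pow, mul_pow, hnorm]
  linarith [parallelogram_law_with_norm ℂ x y]

end Hilbert

theorem inner_sectorOp {μ β : ℝ} {f : ℝ → ℝ} (hf : MemLp f ⊤) (s : ℝ) (Ψ : WithA Mode) :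
    ⟪Ψ, sectorOp μ β f s Ψ⟫_ℂ
      = (blockQuad (Moo μ β f) (Moe μ β f s) (Mee μ β f) (braA s Ψ) (braA (-s) Ψ) : ℂ) := by
  have hOO : ∀ φ : Mode, ((⟪φ, Moo μ β f φ⟫_ℂ).re : ℂ) = ⟪φ, Moo μ β f φ⟫_ℂ :=
    (isSelfAdjoint_Moo hf).isSymmetric.coe_re_inner_self_apply
  have hEE : ∀ φ : Mode, ((⟪φ, Mee μ β f φ⟫_ℂ).re : ℂ) = ⟪φ, Mee μ β f φ⟫_ℂ :=
    (isSelfAdjoint_Mee hf).isSymmetric.coe_re_inner_self_apply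
  simp only [sectorOp, add_apply, inner_add_right, ContinuousLinearMap.adjoint_inner_right,
    ContinuousLinearMap.comp_apply]
  rw [ContinuousLinearMap.adjoint_inner_left, ← inner_conj_symm (Moe μ β f s _), add_conj,
    ← hOO, ← hEE, blockQuad, ofReal_add, ofReal_add]

theorem fidProj_zero (β : ℝ) (Ψ : WithA Mode) :
    fidProj β Ψ 0 = ⟪coherent β, Ψ 0⟫_ℂ • coherent β := by
  simp only [fidProj, add_apply, PiLp.add_apply, tens_apply, Fin.sum_univ_two]
  simp [proj, Matrix.vecMulVec_apply, ket0, ket1]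

theorem fidProj_one (β : ℝ) (Ψ : WithA Mode) :
    fidProj β Ψ 1 = ⟪coherent (-β), Ψ 1⟫_ℂ • coherent (-β) := by
  simp only [fidProj, add_apply, PiLp.add_apply, tens_apply, Fin.sum_univ_two]
  simp [proj, Matrix.vecMulVec_apply, ket0, ket1]

theorem inner_fidProj (β : ℝ) (Ψ : WithA Mode) : ⟪Ψ, fidProj β Ψ⟫_ℂ
    = ((‖⟪coherent β, Ψ 0⟫_ℂ‖ ^ 2 + ‖⟪coherent β, parity (Ψ 1)⟫_ℂ‖ ^ 2 : ℝ) : ℂ) := by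
  rw [← inner_parity_left, parity_coherent, PiLp.inner_apply, Fin.sum_univ_two, fidProj_zero,
    fidProj_one, inner_smul_right, inner_smul_right, ← inner_conj_symm (Ψ 0),
    ← inner_conj_symm (Ψ 1), mul_conj', mul_conj']
  push_cast
  rfl

theorem inner_braA_left (s : ℝ) (Ψ : WithA Mode) (φ : Mode) :
    ⟪braA s Ψ, φ⟫_ℂ = (Real.sqrt 2 : ℂ)⁻¹ * (⟪Ψ 0, φ⟫_ℂ + s * ⟪Ψ 1, φ⟫_ℂ) := by
  rw [braA_apply, inner_smul_left, inner_add_left, inner_smul_left, map_inv₀, conj_ofReal,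
    conj_ofReal]

theorem trashProj_zero (Ψ : WithA Mode) : trashProj Ψ 0 = (Real.sqrt 2 : ℂ)⁻¹ • braA (-1) Ψ := by
  rw [trashProj, tens_apply, Fin.sum_univ_two]
  simp [proj, Matrix.vecMulVec_apply, ketM, braA_apply, mul_smul, smul_add]

theorem trashProj_one (Ψ : WithA Mode) : trashProj Ψ 1 = -(Real.sqrt 2 : ℂ)⁻¹ • braA (-1) Ψ := by
  rw [trashProj, tens_apply, Fin.sum_univ_two]
  simp [proj, Matrix.vecMulVec_apply, ketM, braA_apply, mul_smul, smul_add]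

theorem inner_trashProj (Ψ : WithA Mode) :
    ⟪Ψ, trashProj Ψ⟫_ℂ = ((‖braA (-1) Ψ‖ ^ 2 : ℝ) : ℂ) :=
  calc ⟪Ψ, trashProj Ψ⟫_ℂ = ⟪braA (-1) Ψ, braA (-1) Ψ⟫_ℂ := by
        rw [PiLp.inner_apply, Fin.sum_univ_two, trashProj_zero, trashProj_one, inner_smul_right,
          inner_smul_right, inner_braA_left]
        push_cast
        ring
    _ = ((‖braA (-1) Ψ‖ ^ 2 : ℝ) : ℂ) := by
        rw [inner_self_eq_norm_sq_to_K, ofReal_pow]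
        rfl

theorem norm_sq_eq_braA (Ψ : WithA Mode) : ‖Ψ‖ ^ 2 = ‖braA 1 Ψ‖ ^ 2 + ‖braA (-1) Ψ‖ ^ 2 := by
  rw [PiLp.norm_sq_eq_of_L2, Fin.sum_univ_two, norm_sq_add_norm_sq_eq_hadamard, braA_apply,
    braA_apply, ofReal_one, ofReal_neg, ofReal_one, one_smul, neg_smul, one_smul, ← sub_eq_add_neg]

theorem norm_sq_inner_eq_braA (χ : Mode) (Ψ : WithA Mode) :
    ‖⟪χ, Ψ 0⟫_ℂ‖ ^ 2 + ‖⟪χ, parity (Ψ 1)⟫_ℂ‖ ^ 2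
      = ‖⟪χ, odProj (braA 1 Ψ)⟫_ℂ + ⟪χ, evProj (braA (-1) Ψ)⟫_ℂ‖ ^ 2
        + ‖⟪χ, odProj (braA (-1) Ψ)⟫_ℂ + ⟪χ, evProj (braA 1 Ψ)⟫_ℂ‖ ^ 2 := by
  have hminus : ⟪χ, odProj (braA 1 Ψ)⟫_ℂ + ⟪χ, evProj (braA (-1) Ψ)⟫_ℂ
      = (Real.sqrt 2 : ℂ)⁻¹ * (⟪χ, Ψ 0⟫_ℂ - ⟪χ, parity (Ψ 1)⟫_ℂ) := by
    simp only [odProj_apply, evProj_apply, braA_apply, inner_smul_right, inner_add_right,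
      inner_sub_right, map_smul, map_add, ofReal_one, ofReal_neg]
    ring
  have hplus : ⟪χ, odProj (braA (-1) Ψ)⟫_ℂ + ⟪χ, evProj (braA 1 Ψ)⟫_ℂ
      = (Real.sqrt 2 : ℂ)⁻¹ * (⟪χ, Ψ 0⟫_ℂ + ⟪χ, parity (Ψ 1)⟫_ℂ) := by
    simp only [odProj_apply, evProj_apply, braA_apply, inner_smul_right, inner_add_right,
      inner_sub_right, map_smul, map_add, ofReal_one, ofReal_neg]
    ring
  rw [hminus, hplus, norm_sq_add_norm_sq_eq_hadamard, smul_eq_mul, smul_eq_mul, add_comm]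

section Mhet

variable {μ β : ℝ} {f : ℝ → ℝ} {up um : ℝ → Fin 2 → ℂ}

theorem inner_Mhet (hf : MemLp f ⊤)
    (hMph : Mph β f up um = sectorOp μ β f 1 + sectorOp μ β f (-1)) (κ γ : ℝ) (Ψ : WithA Mode) :
    ⟪Ψ, Mhet β f up um κ γ Ψ⟫_ℂ
      = ((blockQuad (Moo μ β f) (Moe μ β f 1) (Mee μ β f) (braA 1 Ψ) (braA (-1) Ψ)
        + blockQuad (Moo μ β f) (Moe μ β f (-1)) (Mee μ β f) (braA (-1) Ψ) (braA 1 Ψ)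
        + κ * (‖⟪coherent β, odProj (braA 1 Ψ)⟫_ℂ + ⟪coherent β, evProj (braA (-1) Ψ)⟫_ℂ‖ ^ 2
          + ‖⟪coherent β, odProj (braA (-1) Ψ)⟫_ℂ + ⟪coherent β, evProj (braA 1 Ψ)⟫_ℂ‖ ^ 2)
        - γ * ‖braA (-1) Ψ‖ ^ 2 : ℝ) : ℂ) := by
  simp only [Mhet, hMph, sub_apply, add_apply, smul_apply, inner_sub_right, inner_add_right,
    inner_smul_right, inner_sectorOp hf, neg_neg, inner_fidProj, norm_sq_inner_eq_braA,
    inner_trashProj, ofReal_add, ofReal_sub, ofReal_mul]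

theorem Mhet_le (hf : MemLp f ⊤) (hf_sum : ∀ x, f x + f (-x) ≤ 1) (hβ : β ≠ 0)
    (hMph : Mph β f up um = sectorOp μ β f 1 + sectorOp μ β f (-1)) (κ γ : ℝ) :
    Mhet β f up um κ γ ≤ (Bhet μ β f κ γ : ℂ) • (1 : WithA Mode →L[ℂ] WithA Mode) := by
  refine le_smul_one_of_inner_eq (inner_Mhet hf hMph κ γ) fun Ψ => ?_
  have hzero : sigmaSup (sixMatrix μ β f 1 κ 0 γ) ≤ Bhet μ β f κ γ := le_max_left _ _
  have hone : sigmaSup (sixMatrix μ β f (-1) κ γ 0) ≤ Bhet μ β f κ γ := le_max_right _ _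
  have hplus := (blockQuad_perturbed_le (μ := μ) hf hf_sum hβ (one_pow 2) κ 0 γ (braA 1 Ψ)
    (braA (-1) Ψ)).trans (mul_le_mul_of_nonneg_right hzero (by positivity))
  have hminus := (blockQuad_perturbed_le (μ := μ) hf hf_sum hβ neg_one_sq κ γ 0 (braA (-1) Ψ)
    (braA 1 Ψ)).trans (mul_le_mul_of_nonneg_right hone (by positivity))
  rw [norm_sq_eq_braA, norm_sq_eq_odProj_add_evProj (braA 1 Ψ),
    norm_sq_eq_odProj_add_evProj (braA (-1) Ψ)]
  linarith

end Mhet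

end HetQKD

end

open HetQKD in
theorem mainTheorem3_general (μ : ℝ) {β : ℝ} (hβ : β ≠ 0) {f : ℝ → ℝ} (hf_meas : Measurable f)
    (hf_nonneg : ∀ x, 0 ≤ f x) (hf_sum : ∀ x, f x + f (-x) ≤ 1) {up um : ℝ → Fin 2 → ℂ}
    (hup : ∀ w, IsPosEigenvector (tau01 μ β w) (up w))
    (hum : ∀ w, IsNegEigenvector (tau01 μ β w) (um w)) :
    (WeaklyIntegrable volume (phForm β f up um) ∧ WeaklyIntegrable volume (ooForm μ β f) ∧
      WeaklyIntegrable volume (eeForm μ β f) ∧ ∀ s, WeaklyIntegrable volume (oeForm μ β f s)) ∧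
    (Co β = Real.exp (-β ^ 2) * Real.sinh (β ^ 2) ∧
      Ce β = Real.exp (-β ^ 2) * Real.cosh (β ^ 2)) ∧
    (star (lamOO μ β f) = lamOO μ β f ∧ star (lamEE μ β f) = lamEE μ β f ∧
      ∀ s, star (lamOE μ β f s) = lamOE μ β f s ∧ star (sigOE μ β f s) = sigOE μ β f s ∧
        star (sigEE μ β f s) = sigEE μ β f s) ∧
    ConvexOn ℝ Set.univ (fun p : ℝ × ℝ => Bhet μ β f p.1 p.2) ∧
    ∀ κ γ : ℝ, Mhet β f up um κ γ ≤ (Bhet μ β f κ γ : ℂ) • (1 : WithA Mode →L[ℂ] WithA Mode) := by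
  have hf_le : ∀ x, ‖f x‖ ≤ 1 := fun x => by
    rw [Real.norm_of_nonneg (hf_nonneg x)]
    linarith [hf_nonneg (-x), hf_sum x]
  have hf : MemLp f ⊤ :=
    memLp_top_of_bound hf_meas.aestronglyMeasurable 1 (Filter.Eventually.of_forall hf_le)
  have hph := hasWeakIntegral_phForm (β := β) hf hf_nonneg fun w => twistW_eq (hup w) (hum w)
  exact ⟨⟨⟨_, hph⟩, ⟨_, hasWeakIntegral_ooForm hf⟩, ⟨_, hasWeakIntegral_eeForm hf⟩,
      fun s => ⟨_, hasWeakIntegral_oeForm hf s⟩⟩, ⟨Co_eq β, Ce_eq β⟩,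
    ⟨star_lamOO hf, star_lamEE hf,
      fun s => ⟨star_lamOE hf s, star_sigOE hf s, star_sigEE hf s⟩⟩,
    convexOn_Bhet hf, Mhet_le hf hf_sum hβ hph.weakIntegral_eq⟩

open HetQKD in
theorem mainTheorem3 (μ β : ℝ) (hβ : 0 < β) (hβμ : β < Real.sqrt μ)
    (f : ℝ → ℝ) (hf_meas : Measurable f) (hf_nonneg : ∀ x, 0 ≤ f x)
    (hf_sum : ∀ x, f x + f (-x) ≤ 1)
    (up um : ℝ → Fin 2 → ℂ)
    (hup : ∀ w, IsPosEigenvector (tau01 μ β w) (up w))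
    (hum : ∀ w, IsNegEigenvector (tau01 μ β w) (um w)) :
    -- all operator integrals converge weakly to bounded operators
    (WeaklyIntegrable MeasureTheory.volume (phForm β f up um) ∧
      WeaklyIntegrable MeasureTheory.volume (ooForm μ β f) ∧
      WeaklyIntegrable MeasureTheory.volume (eeForm μ β f) ∧
      WeaklyIntegrable MeasureTheory.volume (oeForm μ β f 1) ∧
      WeaklyIntegrable MeasureTheory.volume (oeForm μ β f (-1))) ∧
    -- values of the weights, and reality of the parameters
    (Co β = Real.exp (-β ^ 2) * Real.sinh (β ^ 2) ∧
      Ce β = Real.exp (-β ^ 2) * Real.cosh (β ^ 2)) ∧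
    (star (lamOO μ β f) = lamOO μ β f ∧ star (lamEE μ β f) = lamEE μ β f ∧
      ∀ s : ℝ, s = 1 ∨ s = -1 →
        star (lamOE μ β f s) = lamOE μ β f s ∧ star (sigOE μ β f s) = sigOE μ β f s ∧
        star (sigEE μ β f s) = sigEE μ β f s) ∧
    -- convexity of the bound
    ConvexOn ℝ Set.univ (fun p : ℝ × ℝ => Bhet μ β f p.1 p.2) ∧
    -- the operator inequality
    ∀ κ γ : ℝ, 0 ≤ κ → 0 ≤ γ →
      Mhet β f up um κ γ ≤ (Bhet μ β f κ γ : ℂ) • (1 : WithA Mode →L[ℂ] WithA Mode) := by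
  obtain ⟨⟨hph, hoo, hee, hoe⟩, hweights, ⟨hlamOO, hlamEE, hreal⟩, hconvex, hle⟩ :=
    mainTheorem3_general μ hβ.ne' hf_meas hf_nonneg hf_sum hup hum
  exact ⟨⟨hph, hoo, hee, hoe 1, hoe (-1)⟩, hweights, ⟨hlamOO, hlamEE, fun s _ => hreal s⟩, hconvex,
    fun κ γ _ _ => hle κ γ⟩
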